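/- Let $N \ge 1$ and $m \ge 1$ be integers and let $n \in \mathbb{Z}$. Let $\mathbb{P}^N = \operatorname{Proj}\mathbb{C}[X_0,\dots,X_N]$ be the complex projective space of dimension $N$, with homogeneous coordinates $X_0,\dots,X_N \in H^0(\mathbb{P}^N,\mathcal{O}_{\mathbb{P}^N}(1))$, let $\Omega_{\mathbb{P}^N}$ be its cotangent sheaf (the sheaf of Kähler differentials over $\mathbb{C}$), and write $S^m\Omega_{\mathbb{P}^N}(k) = S^m\Omega_{\mathbb{P}^N} \otimes \mathcal{O}_{\mathbb{P}^N}(k)$. For $d \in \mathbb{N}$ let $\mathbb{C}[Y]_d$ be the space of homogeneous polynomials of degree $d$ in $Y = (Y_0,\dots,Y_N)$. Let $$\delta = \sum_{i=0}^{N} X_i \frac{\partial}{\partial Y_i} \colon \mathbb{C}[Y]_m \otimes_{\mathbb{C}} \mathcal{O}_{\mathbb{P}^N}(n) \to \mathbb{C}[Y]_{m-1} \otimes_{\mathbb{C}} \mathcal{O}_{\mathbb{P}^N}(n+1), \qquad P \otimes s \mapsto \sum_{i=0}^{N} \frac{\partial P}{\partial Y_i} \otimes X_i s .$$ Then $S^m\Omega_{\mathbb{P}^N}(m+n)$,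 $\mathbb{C}[Y]_m \otimes \mathcal{O}_{\mathbb{P}^N}(n)$ and $\mathbb{C}[Y]_{m-1} \otimes \mathcal{O}_{\mathbb{P}^N}(n+1)$ are vector bundles (locally free sheaves of finite rank), and there is a short exact sequence of sheaves of $\mathcal{O}_{\mathbb{P}^N}$-modules $$0 \to S^m\Omega_{\mathbb{P}^N}(m+n) \to \mathbb{C}[Y]_m \otimes \mathcal{O}_{\mathbb{P}^N}(n) \xrightarrow{\ \delta\ } \mathbb{C}[Y]_{m-1} \otimes \mathcal{O}_{\mathbb{P}^N}(n+1) \to 0 .$$ -/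

import Mathlib

open CategoryTheory AlgebraicGeometry TopologicalSpace Opposite
open scoped TensorProduct

namespace GenEuler
noncomputable section

section Presheaves
variable {C : Type} [Category.{0} C] {R : Cᵒᵖ ⥤ CommRingCat.{0}}

/-- A presheaf of modules over a presheaf of commutative rings, from its modules of sections and
its (semilinear) restriction maps. -/
def mkPresheaf (A : ∀ U : Cᵒᵖ, ModuleCat.{0} (R.obj U))
    (res : ∀ {U V : Cᵒᵖ} (f : U ⟶ V), A U →ₛₗ[(R.map f).hom] A V)
    (res_id : ∀ (U : Cᵒᵖ) (a : A U), res (𝟙 U) a = a)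
    (res_comp : ∀ {U V W : Cᵒᵖ} (f : U ⟶ V) (g : V ⟶ W) (a : A U),
      res (f ≫ g) a = res g (res f a)) :
    PresheafOfModules.{0} (R ⋙ forget₂ CommRingCat RingCat) where
  obj U := A U
  map {U V} f := ModuleCat.ofHom (Y := (ModuleCat.restrictScalars (R.map f).hom).obj (A V))
    { toFun := res f
      map_add' := map_add (res f)
      map_smul' := (res f).map_smulₛₗ }
  map_id U := by
    ext a
    exact res_id U a
  map_comp f g := by
    ext a
    exact res_comp f g a

/-- A morphism of presheaves of modules, from linear maps on sections commuting with restriction. -/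
def mkHom {P Q : PresheafOfModules.{0} (R ⋙ forget₂ CommRingCat RingCat)}
    (φ : ∀ U : Cᵒᵖ, P.obj U →ₗ[R.obj U] Q.obj U)
    (hφ : ∀ {U V : Cᵒᵖ} (f : U ⟶ V) (a : P.obj U),
      φ V (P.restrictₛₗ f a) = Q.restrictₛₗ f (φ U a)) : P ⟶ Q where
  app U := ModuleCat.ofHom (φ U)
  naturality f := by
    ext a
    exact hφ f a

end Presheaves

section Sym

/-- The symmetric power `S^m M`: the degree `m` part of the symmetric algebra of `M`, i.e. the span
of the products of `m` elements of `M`. -/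
def symPow (R M : Type) [CommRing R] [AddCommGroup M] [Module R M] (m : ℕ) :
    Submodule R (SymmetricAlgebra R M) :=
  LinearMap.range (SymmetricAlgebra.ι R M) ^ m

variable {R S M M' : Type} [CommRing R] [CommRing S] [AddCommGroup M] [Module R M]
  [AddCommGroup M'] [Module S M'] {σ : R →+* S}

/-- The ring homomorphism `Sym_R M → Sym_S M'` induced by a semilinear map `M → M'`. -/
def symAlgMap (f : M →ₛₗ[σ] M') : SymmetricAlgebra R M →+* SymmetricAlgebra S M' :=
  letI : Algebra R (SymmetricAlgebra S M') := ((algebraMap S _).comp σ).toAlgebra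
  (SymmetricAlgebra.lift (R := R) (A := SymmetricAlgebra S M')
    { toFun := fun x => SymmetricAlgebra.ι S M' (f x)
      map_add' := by simp
      map_smul' := fun r x => by
        rw [f.map_smulₛₗ, map_smul, Algebra.smul_def, Algebra.smul_def]
        rfl }).toRingHom

theorem symAlgMap_ι (f : M →ₛₗ[σ] M') (x : M) :
    symAlgMap f (SymmetricAlgebra.ι R M x) = SymmetricAlgebra.ι S M' (f x) := by
  let : Algebra R (SymmetricAlgebra S M') := ((algebraMap S _).comp σ).toAlgebra
  exact SymmetricAlgebra.lift_ι_apply _ x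

theorem symAlgMap_algebraMap (f : M →ₛₗ[σ] M') (r : R) :
    symAlgMap f (algebraMap R _ r) = algebraMap S _ (σ r) := by
  let : Algebra R (SymmetricAlgebra S M') := ((algebraMap S _).comp σ).toAlgebra
  exact AlgHom.commutes (SymmetricAlgebra.lift (R := R) (A := SymmetricAlgebra S M') _) r

theorem symAlgMap_smul (f : M →ₛₗ[σ] M') (r : R) (a : SymmetricAlgebra R M) :
    symAlgMap f (r • a) = σ r • symAlgMap f a := by
  rw [Algebra.smul_def, map_mul, symAlgMap_algebraMap, Algebra.smul_def]

theorem symAlgMap_mem (f : M →ₛₗ[σ] M') (m : ℕ) {a : SymmetricAlgebra R M}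
    (ha : a ∈ symPow R M m) : symAlgMap f a ∈ symPow S M' m := by
  refine Submodule.pow_induction_on_left' (LinearMap.range (SymmetricAlgebra.ι R M))
    (C := fun k x _ => symAlgMap f x ∈ symPow S M' k) ?_ ?_ ?_ ha
  · intro r
    rw [symAlgMap_algebraMap, symPow, pow_zero]
    exact Submodule.algebraMap_mem _
  · intro x y i hx hy h1 h2
    rw [map_add]
    exact add_mem h1 h2
  · rintro _ ⟨x, rfl⟩ i y hy h
    rw [map_mul, symAlgMap_ι, symPow, pow_succ']
    exact Submodule.mul_mem_mul ⟨_, rfl⟩ h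

/-- The semilinear map `S^m M → S^m M'` induced by a semilinear map `M → M'`. -/
def symPowMap (f : M →ₛₗ[σ] M') (m : ℕ) : symPow R M m →ₛₗ[σ] symPow S M' m where
  toFun a := ⟨symAlgMap f a.1, symAlgMap_mem f m a.2⟩
  map_add' _ _ := Subtype.ext (map_add _ _ _)
  map_smul' r a := Subtype.ext (symAlgMap_smul f r a.1)

theorem symAlgMap_eq_self (f : M →ₛₗ[σ] M') (g : SymmetricAlgebra R M →+* SymmetricAlgebra S M') (hg : ∀ r, g (algebraMap R _ r) = algebraMap S _ (σ r))
    (hι : ∀ x, g (SymmetricAlgebra.ι R M x) = SymmetricAlgebra.ι S M' (f x)) (a) : g a = symAlgMap f a := by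
  induction a using SymmetricAlgebra.induction with
  | algebraMap r => rw [hg, symAlgMap_algebraMap]
  | ι x => rw [hι, symAlgMap_ι]
  | mul a b ha hb => rw [map_mul, map_mul, ha, hb]
  | add a b ha hb => rw [map_add, map_add, ha, hb]

end Sym

section Operations

variable {C : Type} [Category.{0} C] {R : Cᵒᵖ ⥤ CommRingCat.{0}}

theorem restr_id (P : PresheafOfModules.{0} (R ⋙ forget₂ CommRingCat RingCat)) (U : Cᵒᵖ)
    (a : P.obj U) : P.restrictₛₗ (𝟙 U) a = a := by
  rw [PresheafOfModules.restrictₛₗ_apply, P.map_id]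
  rfl

theorem restr_comp (P : PresheafOfModules.{0} (R ⋙ forget₂ CommRingCat RingCat)) {U V W : Cᵒᵖ}
    (f : U ⟶ V) (g : V ⟶ W) (a : P.obj U) :
    P.restrictₛₗ (f ≫ g) a = P.restrictₛₗ g (P.restrictₛₗ f a) :=
  P.map_comp_apply f g a

/-- The presheaf `U ↦ S^m_{R(U)} (P(U))`. -/
def symPresheaf (P : PresheafOfModules.{0} (R ⋙ forget₂ CommRingCat RingCat)) (m : ℕ) :
    PresheafOfModules.{0} (R ⋙ forget₂ CommRingCat RingCat) :=
  mkPresheaf (fun U => ModuleCat.of (R.obj U) (symPow (R.obj U) (P.obj U) m))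
    (fun {U V} f => symPowMap (σ := (R.map f).hom) (P.restrictₛₗ f) m)
    (fun U a => Subtype.ext (symAlgMap_eq_self (σ := (R.map (𝟙 U)).hom) _ (RingHom.id _)
      (by simp) (fun x => by rw [restr_id]; rfl) a.1).symm)
    (fun {U V W} f g a => Subtype.ext (symAlgMap_eq_self (σ := (R.map (f ≫ g)).hom) _
      ((symAlgMap (σ := (R.map g).hom) (P.restrictₛₗ g)).comp
        (symAlgMap (σ := (R.map f).hom) (P.restrictₛₗ f)))
      (by simp [symAlgMap_algebraMap])
      (fun x => by
        rw [restr_comp, RingHom.comp_apply, symAlgMap_ι, symAlgMap_ι]) a.1).symm)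

end Operations

section VectorSpaceTensor

/-- The abelian group `M`, an `R`-module, regarded also as a complex vector space through
`ρ : ℂ → R`. -/
def Res {R : Type} [CommRing R] (_ρ : ℂ →+* R) (M : Type) : Type := M

variable {R S M M' E E' : Type} [CommRing R] [CommRing S] [AddCommGroup M] [Module R M]
  [AddCommGroup M'] [Module S M'] [AddCommGroup E] [Module ℂ E] [AddCommGroup E'] [Module ℂ E']
  {ρ : ℂ →+* R} {ρ' : ℂ →+* S} {σ : R →+* S}

instance : AddCommGroup (Res ρ M) := inferInstanceAs (AddCommGroup M)

instance : Module R (Res ρ M) := inferInstanceAs (Module R M)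

instance : Module ℂ (Res ρ M) := Module.compHom M ρ

theorem Res.smul_def (c : ℂ) (x : Res ρ M) : c • x = ρ c • x := rfl

instance : SMulCommClass ℂ R (Res ρ M) :=
  ⟨fun c r x => by rw [Res.smul_def, Res.smul_def, smul_smul, smul_smul, mul_comm]⟩

/-- A semilinear map, regarded as a `ℂ`-linear map. -/
def Res.map (f : M →ₛₗ[σ] M') (hσ : ∀ c, σ (ρ c) = ρ' c) : Res ρ M →ₗ[ℂ] Res ρ' M' where
  toFun := f
  map_add' := map_add f
  map_smul' c x := (f.map_smulₛₗ (ρ c) x).trans (by rw [hσ]; rfl)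

/-- The map `x ⊗ e ↦ f x ⊗ g e`, for a semilinear map `f` and a `ℂ`-linear map `g`. -/
def vecMap (f : M →ₛₗ[σ] M') (g : E →ₗ[ℂ] E') (hσ : ∀ c, σ (ρ c) = ρ' c) :
    (Res ρ M ⊗[ℂ] E) →ₛₗ[σ] (Res ρ' M' ⊗[ℂ] E') where
  toFun := TensorProduct.map (Res.map f hσ) g
  map_add' := map_add _
  map_smul' r a := by
    induction a using TensorProduct.induction_on with
    | zero => simp
    | tmul x e =>
      rw [TensorProduct.smul_tmul', TensorProduct.map_tmul, TensorProduct.map_tmul,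
        TensorProduct.smul_tmul']
      exact congrArg (fun y : Res ρ' M' => y ⊗ₜ[ℂ] g e) (f.map_smulₛₗ r x)
    | add a b h1 h2 => rw [smul_add, map_add, map_add, smul_add, h1, h2]

theorem vecMap_tmul (f : M →ₛₗ[σ] M') (g : E →ₗ[ℂ] E') (hσ : ∀ c, σ (ρ c) = ρ' c)
    (x : Res ρ M) (e : E) :
    vecMap f g hσ (x ⊗ₜ[ℂ] e) = Res.map f hσ x ⊗ₜ[ℂ] g e := rfl

variable {C : Type} [Category.{0} C] {R : Cᵒᵖ ⥤ CommRingCat.{0}}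
  (κ : (Functor.const Cᵒᵖ).obj (CommRingCat.of ℂ) ⟶ R)

theorem const_comm {U V : Cᵒᵖ} (f : U ⟶ V) (c : ℂ) :
    (R.map f).hom ((κ.app U).hom c) = (κ.app V).hom c := by
  have h := congrArg (fun g => g.hom c) (κ.naturality f)
  exact h.symm

/-- For a complex vector space `E`, the presheaf `U ↦ P(U) ⊗_ℂ E`, with `R(U)` acting on the
factor `P(U)`. The structure of `ℂ`-algebra on `R` is given by `κ`. -/
def vecPresheaf (P : PresheafOfModules.{0} (R ⋙ forget₂ CommRingCat RingCat))
    (E : Type) [AddCommGroup E] [Module ℂ E] :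
    PresheafOfModules.{0} (R ⋙ forget₂ CommRingCat RingCat) :=
  mkPresheaf (fun U => ModuleCat.of (R.obj U) (Res (κ.app U).hom (P.obj U) ⊗[ℂ] E))
    (fun {U V} f => vecMap (σ := (R.map f).hom) (P.restrictₛₗ f) LinearMap.id (const_comm κ f))
    (fun U a => by
      induction a using TensorProduct.induction_on with
      | zero => exact map_zero _
      | tmul x e =>
        exact congrArg (fun y : Res (κ.app U).hom (P.obj U) => y ⊗ₜ[ℂ] e) (restr_id P U x)
      | add a b h1 h2 => exact (map_add _ a b).trans (congrArg₂ _ h1 h2))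
    (fun {U V W} f g a => by
      induction a using TensorProduct.induction_on with
      | zero => exact (map_zero _).trans ((congrArg _ (map_zero _)).trans (map_zero _)).symm
      | tmul x e =>
        exact congrArg (fun y : Res (κ.app W).hom (P.obj W) => y ⊗ₜ[ℂ] e) (restr_comp P f g x)
      | add a b h1 h2 =>
        exact (map_add _ a b).trans ((congrArg₂ _ h1 h2).trans
          ((congrArg _ (map_add _ a b)).trans (map_add _ _ _)).symm))

/-- The morphism of presheaves `φ ⊗ g`. -/
def vecPresheafMap {P Q : PresheafOfModules.{0} (R ⋙ forget₂ CommRingCat RingCat)}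
    {E E' : Type} [AddCommGroup E] [Module ℂ E] [AddCommGroup E'] [Module ℂ E']
    (φ : P ⟶ Q) (g : E →ₗ[ℂ] E') : vecPresheaf κ P E ⟶ vecPresheaf κ Q E' :=
  mkHom (fun U => vecMap (σ := RingHom.id (R.obj U)) (φ.app U).hom g (fun _ => rfl))
    (fun {U V} f a => by
      induction a using TensorProduct.induction_on with
      | zero => exact (congrArg _ (map_zero _)).trans ((map_zero _).trans
          ((congrArg _ (map_zero _)).trans (map_zero _)).symm)
      | tmul x e =>
        exact congrArg (fun y : Res (κ.app V).hom (Q.obj V) => y ⊗ₜ[ℂ] g e)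
          (PresheafOfModules.naturality_apply φ f x)
      | add a b h1 h2 =>
        exact (congrArg _ (map_add _ a b)).trans ((map_add _ _ _).trans ((congrArg₂ _ h1 h2).trans
          ((congrArg _ (map_add _ a b)).trans (map_add _ _ _)).symm)))

end VectorSpaceTensor

section General
variable {X : Scheme.{0}}

/-- The sheaf of modules associated with a presheaf of modules on a scheme. -/
def assocSheaf (P : X.PresheafOfModules) : X.Modules :=
  (PresheafOfModules.sheafification (𝟙 X.ringCatSheaf.obj)).obj P

/-- Functoriality of the associated sheaf. -/
def assocSheafMap {P Q : X.PresheafOfModules} (f : P ⟶ Q) : assocSheaf P ⟶ assocSheaf Q :=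
  (PresheafOfModules.sheafification (𝟙 X.ringCatSheaf.obj)).map f

/-- The tensor product `F ⊗ G` of two sheaves of modules: the sheaf associated with
`U ↦ F(U) ⊗_{O(U)} G(U)`. -/
def tensorSheaf (F G : X.Modules) : X.Modules :=
  assocSheaf (PresheafOfModules.Monoidal.tensorObj (R := X.presheaf) F.val G.val)

/-- The sheaf of Kähler differentials `Ω_X` over `ℂ`: the sheaf associated with
`U ↦ Ω_{O(U)/ℂ}`, where the `ℂ`-algebra structure of `O(U)` is given by `κ`. -/
def cotangentSheaf (κ : (Functor.const X.Opensᵒᵖ).obj (CommRingCat.of ℂ) ⟶ X.presheaf) : X.Modules :=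
  assocSheaf (PresheafOfModules.DifferentialsConstruction.relativeDifferentials' κ)

/-- A vector bundle: a sheaf of modules which is locally free of finite rank. -/
def IsVectorBundle (F : X.Modules) : Prop :=
  ∀ x : X, ∃ (U : X.Opens) (_ : x ∈ U) (r : ℕ),
    Nonempty ((Scheme.Modules.restrictFunctor U.ι).obj F ≅
      (SheafOfModules.free (Fin r) : SheafOfModules U.toScheme.ringCatSheaf))

/-- The symmetric power `S^m F` of a sheaf of modules: the sheaf associated with
`U ↦ S^m_{O(U)} (F(U))`. -/
def symSheaf (F : X.Modules) (m : ℕ) : X.Modules :=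
  assocSheaf (symPresheaf (R := X.presheaf) F.val m)

/-- The sheaf `E ⊗_ℂ F`, for a complex vector space `E`: the sheaf associated with
`U ↦ F(U) ⊗_ℂ E`. -/
def vecTensorSheaf (κ : (Functor.const X.Opensᵒᵖ).obj (CommRingCat.of ℂ) ⟶ X.presheaf)
    (E : Type) [AddCommGroup E] [Module ℂ E] (F : X.Modules) : X.Modules :=
  assocSheaf (vecPresheaf κ F.val E)

end General

section ProjectiveSpace
variable (N : ℕ)

/-- Complex polynomials in `N + 1` variables. -/
abbrev Poly : Type := MvPolynomial (Fin (N + 1)) ℂ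

/-- Homogeneous polynomials of degree `d` in `N + 1` variables. This serves both for the
homogeneous coordinate ring `ℂ[X]` of projective space and for the spaces `ℂ[Y]_d`. -/
abbrev Homog (d : ℕ) : Submodule ℂ (Poly N) := MvPolynomial.homogeneousSubmodule (Fin (N + 1)) ℂ d

instance : GradedAlgebra (Homog N) := MvPolynomial.gradedAlgebra

/-- The projective space of dimension `N` over `ℂ`, as the scheme `Proj ℂ[X_0, …, X_N]`. -/
abbrev PN : Scheme.{0} := Proj (Homog N)

/-- The localization of `ℂ[X]` at the homogeneous prime ideal `x`. -/
abbrev Loc (x : ProjectiveSpectrum (Homog N)) : Type :=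
  Localization.AtPrime x.asHomogeneousIdeal.toIdeal

variable {N}

/-- The germ at `x` of a section of the structure sheaf, as an element of the localization at `x`
of `ℂ[X]`. -/
def secVal {U : (PN N).Opensᵒᵖ} (s : (PN N).presheaf.obj U) (x : U.unop) : Loc N x.1 :=
  HomogeneousLocalization.val (s.1 x)

/-- All germs of a section, as a ring homomorphism. -/
def secValHom (U : (PN N).Opensᵒᵖ) : (PN N).presheaf.obj U →+* (∀ x : U.unop, Loc N x.1) where
  toFun s := secVal s
  map_one' := by
    funext x
    exact HomogeneousLocalization.val_one
  map_mul' s t := by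
    funext x
    exact HomogeneousLocalization.val_mul (s.1 x) (t.1 x)
  map_zero' := by
    funext x
    exact HomogeneousLocalization.val_zero
  map_add' s t := by
    funext x
    exact HomogeneousLocalization.val_add (s.1 x) (t.1 x)

/-- The family of germs `f` is given on all of `U` by a single fraction `a / b` of homogeneous
polynomials with `deg a - deg b = n` and with `b` vanishing nowhere on `U`. -/
def IsTwistFraction (n : ℤ) {U : Opens (ProjectiveSpectrum.top (Homog N))}
    (f : ∀ x : U, Loc N x.1) : Prop :=
  ∃ (i j : ℕ) (a b : Poly N) (_ : a ∈ Homog N i) (_ : b ∈ Homog N j) (_ : (i : ℤ) = j + n)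
    (hb : ∀ x : U, b ∉ x.1.asHomogeneousIdeal.toIdeal),
    ∀ x : U, f x = Localization.mk a ⟨b, hb x⟩

/-- The condition of being a fraction of degree `n`, as a condition stable under restriction. -/
def isTwistFractionPrelocal (n : ℤ) :
    TopCat.PrelocalPredicate (X := ProjectiveSpectrum.top (Homog N)) fun x => Loc N x where
  pred f := IsTwistFraction n f
  res := by
    rintro V U i f ⟨k, j, a, b, ha, hb, h, hb', hf⟩
    exact ⟨k, j, a, b, ha, hb, h, fun x => hb' (i x), fun x => hf (i x)⟩

/-- The condition of being locally a fraction of degree `n`. -/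
def isLocallyTwistFraction (n : ℤ) :
    TopCat.LocalPredicate (X := ProjectiveSpectrum.top (Homog N)) fun x => Loc N x :=
  (isTwistFractionPrelocal n).sheafify

theorem exists_notMem (x : ProjectiveSpectrum (Homog N)) :
    ∃ (d : ℕ) (b : Poly N), 0 < d ∧ b ∈ Homog N d ∧ b ∉ x.asHomogeneousIdeal.toIdeal := by
  by_contra! h
  exact x.not_irrelevant_le
    ((HomogeneousIdeal.irrelevant_le (Homog N)).2 fun d hd b hb => h d b hd hb)

theorem isLocallyTwistFraction_zero (n : ℤ) (U : Opens (ProjectiveSpectrum.top (Homog N))) :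
    (isLocallyTwistFraction n).pred (0 : ∀ x : U, Loc N x.1) := by
  intro x
  obtain ⟨d, b, hd, hb, hbx⟩ := exists_notMem x.1
  refine ⟨U ⊓ ProjectiveSpectrum.basicOpen (Homog N) (b ^ n.natAbs), ⟨x.2, ?_⟩,
    Opens.infLELeft _ _, (n.natAbs * d + n).toNat, n.natAbs * d, 0, b ^ n.natAbs, zero_mem _, ?_,
    ?_, fun y => y.2.2, ?_⟩
  · exact fun h => hbx (x.1.isPrime.mem_of_pow_mem _ h)
  · exact SetLike.pow_mem_graded _ hb
  · have : (n.natAbs : ℤ) ≤ n.natAbs * d := le_mul_of_one_le_right (by omega) (by omega)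
    rw [Int.toNat_of_nonneg (by omega)]
    push_cast
    rfl
  · intro y
    exact (Localization.mk_zero _).symm

theorem isLocallyTwistFraction_add (n : ℤ) {U : Opens (ProjectiveSpectrum.top (Homog N))}
    {f g : ∀ x : U, Loc N x.1} (hf : (isLocallyTwistFraction n).pred f)
    (hg : (isLocallyTwistFraction n).pred g) : (isLocallyTwistFraction n).pred (f + g) := by
  intro x
  obtain ⟨V, hV, iV, i, j, a, b, ha, hb, h, hbV, hfV⟩ := hf x
  obtain ⟨W, hW, iW, i', j', a', b', ha', hb', h', hbW, hgW⟩ := hg x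
  refine ⟨V ⊓ W, ⟨hV, hW⟩, Opens.infLELeft _ _ ≫ iV, j + i', j + j', b * a' + b' * a, b * b',
    ?_, SetLike.mul_mem_graded hb hb', by omega,
    fun y hy => (y.1.isPrime.mem_or_mem hy).elim (hbV ⟨y.1, y.2.1⟩) (hbW ⟨y.1, y.2.2⟩), ?_⟩
  · refine add_mem (SetLike.mul_mem_graded hb ha') ?_
    have e : j + i' = j' + i := by omega
    rw [e]
    exact SetLike.mul_mem_graded hb' ha
  · intro y
    have h1 := hfV ⟨y.1, y.2.1⟩
    have h2 := hgW ⟨y.1, y.2.2⟩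
    exact (congrArg₂ (· + ·) h1 h2).trans (Localization.add_mk _ _ _ _)

theorem isLocallyTwistFraction_smul (n : ℤ) {U : (PN N).Opensᵒᵖ} (s : (PN N).presheaf.obj U)
    {f : ∀ x : U.unop, Loc N x.1} (hf : (isLocallyTwistFraction n).pred f) :
    (isLocallyTwistFraction n).pred (secVal s * f) := by
  intro x
  obtain ⟨V, hV, iV, i, j, a, b, ha, hb, h, hbV, hfV⟩ := hf x
  obtain ⟨W, hW, iW, d, p, q, hq, hs⟩ := s.2 x
  refine ⟨V ⊓ W, ⟨hV, hW⟩, Opens.infLELeft _ _ ≫ iV, d + i, d + j, p.1 * a, q.1 * b,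
    SetLike.mul_mem_graded p.2 ha, SetLike.mul_mem_graded q.2 hb, by push_cast; omega,
    fun y hy => (y.1.isPrime.mem_or_mem hy).elim (hq ⟨y.1, y.2.2⟩) (hbV ⟨y.1, y.2.1⟩), ?_⟩
  intro y
  have h1 := hfV ⟨y.1, y.2.1⟩
  have h2 := congrArg HomogeneousLocalization.val (hs ⟨y.1, y.2.2⟩)
  exact (congrArg₂ (· * ·) h2 h1).trans (Localization.mk_mul _ _ _ _)

/-- A section of the structure sheaf acts on families of germs by pointwise multiplication. -/
instance (U : (PN N).Opensᵒᵖ) :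
    Module ((PN N).presheaf.obj U) (∀ x : U.unop, Loc N x.1) :=
  Module.compHom _ (secValHom U)

/-- Sections over `U` of the Serre twist `O(n)`: families of germs on `U` which are locally a
fraction of homogeneous polynomials of degree `n`. -/
def twistSections (n : ℤ) (U : (PN N).Opensᵒᵖ) :
    Submodule ((PN N).presheaf.obj U) (∀ x : U.unop, Loc N x.1) where
  carrier := {f | (isLocallyTwistFraction n).pred f}
  zero_mem' := isLocallyTwistFraction_zero n _
  add_mem' := isLocallyTwistFraction_add n
  smul_mem' s _ hf := isLocallyTwistFraction_smul n s hf

/-- Restriction of sections of `O(n)`. -/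
def twistRes (n : ℤ) {U V : (PN N).Opensᵒᵖ} (f : U ⟶ V) :
    twistSections n U →ₛₗ[((PN N).presheaf.map f).hom] twistSections n V where
  toFun s := ⟨fun x => s.1 (f.unop x),
    (isLocallyTwistFraction n).res f.unop s.1 s.2⟩
  map_add' _ _ := rfl
  map_smul' _ _ := rfl

/-- The presheaf underlying `O(n)`. -/
def twistPresheaf (N : ℕ) (n : ℤ) :
    PresheafOfModules.{0} ((PN N).presheaf ⋙ forget₂ CommRingCat RingCat) :=
  mkPresheaf (R := (PN N).presheaf)
    (fun U => ModuleCat.of ((PN N).presheaf.obj U) (twistSections n U))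
    (fun f => twistRes n f) (fun _ _ => rfl) (fun _ _ _ => rfl)

theorem twistPresheaf_isSheaf (N : ℕ) (n : ℤ) :
    TopCat.Presheaf.IsSheaf (twistPresheaf N n).presheaf := by
  refine (TopCat.Presheaf.isSheaf_iff_isSheaf_comp (forget Ab) _).2 ?_
  exact TopCat.Presheaf.isSheaf_of_iso (NatIso.ofComponents (fun U => Iso.refl _) (fun f => rfl))
    (TopCat.subsheafToTypes (isLocallyTwistFraction (N := N) n)).property

/-- The line bundle `O(n)` on projective space. -/
def twist (N : ℕ) (n : ℤ) : (PN N).Modules where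
  val := twistPresheaf N n
  isSheaf := twistPresheaf_isSheaf N n

theorem isLocallyTwistFraction_X (n : ℤ) (k : Fin (N + 1))
    {U : Opens (ProjectiveSpectrum.top (Homog N))} {f : ∀ x : U, Loc N x.1}
    (hf : (isLocallyTwistFraction n).pred f) :
    (isLocallyTwistFraction (n + 1)).pred
      fun x : U => algebraMap (Poly N) (Loc N x.1) (MvPolynomial.X k) * f x := by
  intro x
  obtain ⟨V, hV, iV, i, j, a, b, ha, hb, h, hbV, hfV⟩ := hf x
  refine ⟨V, hV, iV, 1 + i, j, MvPolynomial.X k * a, b,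
    SetLike.mul_mem_graded (MvPolynomial.isHomogeneous_X ℂ k) ha, hb, by push_cast; omega, hbV, ?_⟩
  intro y
  refine (congrArg (algebraMap (Poly N) (Loc N y.1) (MvPolynomial.X k) * ·) (hfV y)).trans ?_
  rw [← Localization.mk_one_eq_algebraMap, Localization.mk_mul, one_mul]

/-- Multiplication by the homogeneous coordinate `X_k`, as a morphism `O(n) → O(n + 1)`. -/
def mulX (N : ℕ) (n : ℤ) (k : Fin (N + 1)) : twistPresheaf N n ⟶ twistPresheaf N (n + 1) :=
  mkHom (R := (PN N).presheaf) (P := twistPresheaf N n) (Q := twistPresheaf N (n + 1))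
    (fun U =>
      { toFun := fun s : twistSections n U =>
          (⟨fun x => algebraMap (Poly N) (Loc N x.1) (MvPolynomial.X k) * s.1 x,
            isLocallyTwistFraction_X n k s.2⟩ : twistSections (n + 1) U)
        map_add' := fun _ _ => Subtype.ext (funext fun _ => mul_add _ _ _)
        map_smul' := fun _ _ => Subtype.ext (funext fun _ => mul_left_comm _ _ _) })
    (fun _ _ => rfl)

/-- Complex constants in the local ring of projective space at `x`. -/
def constLoc (x : ProjectiveSpectrum (Homog N)) :
    ℂ →+* HomogeneousLocalization.AtPrime (Homog N) x.asHomogeneousIdeal.toIdeal :=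
  (algebraMap (Homog N 0) _).comp (algebraMap ℂ (Homog N 0))

theorem constLoc_isLocallyFraction (c : ℂ) (U : Opens (ProjectiveSpectrum.top (Homog N))) :
    (ProjectiveSpectrum.StructureSheaf.isLocallyFraction (Homog N)).pred
      fun x : U => constLoc x.1 c := fun x =>
  ⟨U, x.2, 𝟙 U, 0, algebraMap ℂ (Homog N 0) c, 1,
    fun y h => y.1.isPrime.one_notMem h, fun _ => rfl⟩

/-- Complex constants as sections over `U` of the structure sheaf. -/
def constSec (U : (PN N).Opensᵒᵖ) : ℂ →+* (PN N).presheaf.obj U where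
  toFun c := ⟨fun x => constLoc x.1 c, constLoc_isLocallyFraction c U.unop⟩
  map_one' := Subtype.ext (funext fun x => map_one (constLoc x.1))
  map_mul' a b := Subtype.ext (funext fun x => map_mul (constLoc x.1) a b)
  map_zero' := Subtype.ext (funext fun x => map_zero (constLoc x.1))
  map_add' a b := Subtype.ext (funext fun x => map_add (constLoc x.1) a b)

/-- The structure of sheaf of `ℂ`-algebras on the structure sheaf of projective space. -/
def scalars (N : ℕ) : (Functor.const (PN N).Opensᵒᵖ).obj (CommRingCat.of ℂ) ⟶ (PN N).presheaf where
  app U := CommRingCat.ofHom (S := (PN N).presheaf.obj U) (constSec U)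
  naturality _ _ _ := rfl

/-- The partial derivative `∂/∂Y_k : ℂ[Y]_m → ℂ[Y]_{m-1}`. -/
def dY (N m : ℕ) (k : Fin (N + 1)) : Homog N m →ₗ[ℂ] Homog N (m - 1) :=
  ((MvPolynomial.pderiv k).toLinearMap.comp (Homog N m).subtype).codRestrict _
    fun P => MvPolynomial.IsHomogeneous.pderiv P.2

/-- The sheaf `S^m Ω (k) = S^m Ω ⊗ O(k)` on projective space. -/
def symCotangentTwist (N m : ℕ) (k : ℤ) : (PN N).Modules :=
  tensorSheaf (symSheaf (cotangentSheaf (scalars N)) m) (twist N k)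

/-- The sheaf `ℂ[Y]_m ⊗ O(n)` on projective space. -/
def polyTwist (N m : ℕ) (n : ℤ) : (PN N).Modules :=
  vecTensorSheaf (scalars N) (Homog N m) (twist N n)

/-- The operator `δ = ∑_k X_k ∂/∂Y_k` on sections: `s ⊗ P ↦ ∑_k X_k s ⊗ ∂P/∂Y_k`. -/
def deltaPresheaf (N m : ℕ) (n : ℤ) :
    vecPresheaf (scalars N) (twistPresheaf N n) (Homog N m) ⟶
      vecPresheaf (scalars N) (twistPresheaf N (n + 1)) (Homog N (m - 1)) :=
  ∑ k : Fin (N + 1), vecPresheafMap (scalars N) (mulX N n k) (dY N m k)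

/-- The morphism `δ = ∑_k X_k ∂/∂Y_k : ℂ[Y]_m ⊗ O(n) → ℂ[Y]_{m-1} ⊗ O(n + 1)`. -/
def delta (N m : ℕ) (n : ℤ) : polyTwist N m n ⟶ polyTwist N (m - 1) (n + 1) :=
  assocSheafMap (deltaPresheaf N m n)

end ProjectiveSpace

end
end GenEuler

/-!
All sheaves in the sequence are described by explicit families of polynomials. For a point `x` of
projective space let `L` be the localization of `ℂ[X]` at `x`. The sheaf `polySheaf Q n` has as
sections the families of polynomials in `L[Y]` which belong to a prescribed submodule `Q x` and
whose coefficients are sections of `O(n)`. For `Q = homogQ m`, the homogeneous polynomials of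
degree `m`, this is `ℂ[Y]_m ⊗ O(n)`, and `δ` becomes the derivation `∑ k, X k • ∂/∂Y k` of `L[Y]`
(`polyTwistIso`, `delta_polyTwistHom`). Let `kerQ m` be the kernel of `δ` in degree `m`.

The operator `δ` is locally surjective because where `X_i ≠ 0` the element `y = Y_i / X_i` satisfies
`δ y = 1`: the equation `δ f = g` is solved by integration by parts, which ends since `δ` lowers the
degree (`exists_dirDeriv_eq`). Hence `0 → kerQ m → homogQ m → homogQ (m - 1) → 0` gives a short
exact sequence of sheaves (`shortExact_kerIncl_polyDelta`).

It remains to identify the kernel with `S^m Ω (m + n)`. The total differential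
`g ↦ ∑ k, ∂g/∂X k • Y k` sends functions, which are fractions of degree `0`, to linear forms with
coefficients in `O(-1)`, and these are annihilated by `δ` by Euler's identity. By the universal
properties of differentials, symmetric algebras, tensor products and associated sheaves it induces
a morphism from `S^m Ω (m + n)` to the kernel (`symCotangentHom`). Where `X_i ≠ 0`, locally every
section of the source is a linear combination of the products
`X_i ^ (m + n) * ∏ j, d (X_j / X_i) ^ (s j)` with `s` of degree `m` and `s i = 0`
(`exists_eq_sum_frameGen`). Their images are a basis of the sections of the kernel
(`isFrame_kerFrame`): an element of the kernel is determined by its terms which do not involve `Y_i`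
(`eq_zero_of_dirDeriv_eq_zero`), and up to terms involving `Y_i` the image of
`X_i ^ (m + n) * ∏ j, d (X_j / X_i) ^ (s j)` is `X_i ^ n * Y ^ s`. So the morphism is an isomorphism
(`symCotangentIso`), and the kernel is a vector bundle.
-/

namespace GenEuler
noncomputable section

/-! ### Maps out of the associated sheaf of a presheaf of modules -/

section Sheafification
variable {X : Scheme.{0}}

/-- The canonical morphism from a presheaf of modules to its associated sheaf. -/
def toAssoc (P : X.PresheafOfModules) : P ⟶ (assocSheaf P).val :=
  PresheafOfModules.homMk (CategoryTheory.toSheafify _ P.presheaf)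
    (fun U r a => ((PresheafOfModules.toSheafify (𝟙 X.ringCatSheaf.obj)
      (CategoryTheory.toSheafify _ P.presheaf)).app U).hom.map_smul r a)

instance (P : X.PresheafOfModules) : PresheafOfModules.IsLocallySurjective
    (Opens.grothendieckTopology X) (toAssoc P) :=
  inferInstanceAs (Presheaf.IsLocallySurjective (Opens.grothendieckTopology X)
    (CategoryTheory.toSheafify (Opens.grothendieckTopology X) P.presheaf))

instance (P : X.PresheafOfModules) : PresheafOfModules.IsLocallyInjective
    (Opens.grothendieckTopology X) (toAssoc P) :=
  inferInstanceAs (Presheaf.IsLocallyInjective (Opens.grothendieckTopology X)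
    (CategoryTheory.toSheafify (Opens.grothendieckTopology X) P.presheaf))

/-- The universal property of the associated sheaf. -/
def assocHomEquiv (P : X.PresheafOfModules) (F : X.Modules) :
    ((assocSheaf P).val ⟶ F.val) ≃ (P ⟶ F.val) :=
  PresheafOfModules.homEquivOfIsLocallyBijective (J := Opens.grothendieckTopology X)
    (f := toAssoc P) F.isSheaf

/-- The morphism from the associated sheaf induced by a morphism from a presheaf to a sheaf. -/
def assocDesc {P : X.PresheafOfModules} {F : X.Modules} (ψ : P ⟶ F.val) : assocSheaf P ⟶ F :=
  ⟨(assocHomEquiv P F).symm ψ⟩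

theorem toAssoc_assocDesc {P : X.PresheafOfModules} {F : X.Modules} (ψ : P ⟶ F.val) :
    toAssoc P ≫ (assocDesc ψ).val = ψ :=
  (assocHomEquiv P F).apply_symm_apply ψ

theorem assocDesc_app_toAssoc {P : X.PresheafOfModules} {F : X.Modules} (ψ : P ⟶ F.val)
    (U : X.Opensᵒᵖ) (a : P.obj U) :
    (assocDesc ψ).val.app U ((toAssoc P).app U a) = ψ.app U a :=
  congrArg (fun φ : P ⟶ F.val => φ.app U a) (toAssoc_assocDesc ψ)

theorem assocSheaf_hom_ext {P : X.PresheafOfModules} {F : X.Modules} {φ φ' : assocSheaf P ⟶ F}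
    (h : toAssoc P ≫ φ.val = toAssoc P ≫ φ'.val) : φ = φ' :=
  SheafOfModules.hom_ext ((assocHomEquiv P F).injective h)

theorem toAssoc_naturality {P Q : X.PresheafOfModules} (f : P ⟶ Q) :
    toAssoc P ≫ (assocSheafMap f).val = f ≫ toAssoc Q := by
  apply (PresheafOfModules.toPresheaf _).map_injective
  exact (toSheafify_naturality (Opens.grothendieckTopology X)
    ((PresheafOfModules.toPresheaf _).map f)).symm

/-- A locally bijective morphism from a presheaf to a sheaf identifies the sheaf with the associated
sheaf of the presheaf. -/
theorem isIso_assocDesc {P : X.PresheafOfModules} {F : X.Modules} (ψ : P ⟶ F.val)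
    (_ : PresheafOfModules.IsLocallySurjective (Opens.grothendieckTopology X) ψ)
    (_ : PresheafOfModules.IsLocallyInjective (Opens.grothendieckTopology X) ψ) :
    IsIso (assocDesc ψ) := by
  let e := PresheafOfModules.homEquivOfIsLocallyBijective (J := Opens.grothendieckTopology X)
    (f := ψ) (N := (assocSheaf P).val) (assocSheaf P).isSheaf
  let e' := PresheafOfModules.homEquivOfIsLocallyBijective (J := Opens.grothendieckTopology X)
    (f := ψ) (N := F.val) F.isSheaf
  have he : ψ ≫ e.symm (toAssoc P) = toAssoc P := e.apply_symm_apply _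
  refine ⟨⟨⟨e.symm (toAssoc P)⟩, assocSheaf_hom_ext ?_, SheafOfModules.hom_ext (e'.injective ?_)⟩⟩
  · change toAssoc P ≫ (assocDesc ψ).val ≫ e.symm (toAssoc P) = toAssoc P ≫ 𝟙 _
    rw [← Category.assoc, toAssoc_assocDesc, he, Category.comp_id]
  · change ψ ≫ e.symm (toAssoc P) ≫ (assocDesc ψ).val = ψ ≫ 𝟙 _
    rw [← Category.assoc, he, toAssoc_assocDesc, Category.comp_id]

/-- A morphism of presheaves of modules is locally surjective if every section of the target lifts
after restriction to some neighbourhood of any given point. -/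
theorem isLocallySurjective_of_exists {P Q : X.PresheafOfModules} (ψ : P ⟶ Q)
    (h : ∀ (U : X.Opens) (s : Q.obj (op U)) (x : X), x ∈ U → ∃ (V : X.Opens) (i : V ⟶ U),
      x ∈ V ∧ ∃ t : P.obj (op V), ψ.app (op V) t = Q.map i.op s) :
    PresheafOfModules.IsLocallySurjective (Opens.grothendieckTopology X) ψ where
  imageSieve_mem {U} s := fun x hx => by
    obtain ⟨V, i, hV, t, ht⟩ := h U s x hx
    exact ⟨V, i, ⟨t, ht⟩, hV⟩

/-- A morphism of presheaves of modules is locally injective if every section which it annihilates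
vanishes near any given point. -/
theorem isLocallyInjective_of_exists {P Q : X.PresheafOfModules} (ψ : P ⟶ Q)
    (h : ∀ (U : X.Opens) (s : P.obj (op U)) (x : X), x ∈ U → ψ.app (op U) s = 0 →
      ∃ (V : X.Opens) (i : V ⟶ U), x ∈ V ∧ P.map i.op s = 0) :
    PresheafOfModules.IsLocallyInjective (Opens.grothendieckTopology X) ψ where
  equalizerSieve_mem {U} s t hst := fun x hx => by
    obtain ⟨V, i, hV, h0⟩ := h U.unop (s - t : P.obj U) x hx
      ((map_sub (ψ.app U).hom _ _).trans (sub_eq_zero.2 hst))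
    exact ⟨V, i, sub_eq_zero.1 ((map_sub (P.map i.op).hom _ _).symm.trans h0), hV⟩

/-- Locally, every section of the associated sheaf comes from the presheaf. -/
theorem exists_toAssoc_eq (P : X.PresheafOfModules) (U : X.Opens)
    (s : (assocSheaf P).val.obj (op U)) (x : X) (hx : x ∈ U) : ∃ (V : X.Opens) (i : V ⟶ U),
      x ∈ V ∧ ∃ t : P.obj (op V), (toAssoc P).app (op V) t = (assocSheaf P).val.map i.op s := by
  have h : Presheaf.IsLocallySurjective (Opens.grothendieckTopology X)
    ((PresheafOfModules.toPresheaf _).map (toAssoc P)) := inferInstance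
  obtain ⟨V, i, ⟨t, ht⟩, hV⟩ := h.imageSieve_mem (U := U) s x hx
  exact ⟨V, i, hV, t, ht⟩

end Sheafification

/-! ### Free sheaves of modules -/

section LocallyFree
variable {X : Scheme.{0}}

/-- A morphism of sheaves of modules, from its values on sections. -/
def homOfSections {F G : X.Modules} (φ : ∀ U : X.Opens, Γ(F, U) → Γ(G, U))
    (hadd : ∀ U a b, φ U (a + b) = φ U a + φ U b)
    (hsmul : ∀ (U : X.Opens) (q : Γ(X, U)) (a : Γ(F, U)), φ U (q • a) = q • φ U a)
    (hmap : ∀ {U V : X.Opens} (i : V ⟶ U) (a : Γ(F, U)),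
      φ V (F.presheaf.map i.op a) = G.presheaf.map i.op (φ U a)) : F ⟶ G :=
  ⟨mkHom (R := X.presheaf) (P := F.val) (Q := G.val)
    (fun U => { toFun := φ U.unop, map_add' := hadd U.unop, map_smul' := hsmul U.unop })
    (fun i a => hmap i.unop a)⟩

theorem IsVectorBundle.of_iso {F G : X.Modules} (e : F ≅ G) (h : IsVectorBundle F) :
    IsVectorBundle G := fun x => by
  obtain ⟨U, hx, r, ⟨φ⟩⟩ := h x
  exact ⟨U, hx, r, ⟨(Scheme.Modules.restrictFunctor U.ι).mapIso e.symm ≪≫ φ⟩⟩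

/-- In a preadditive category, an object with morphisms from and to `A` which satisfy the relations
of a finite direct sum is a coproduct of copies of `A`. -/
def isoOfBiproductRelations {C : Type*} [Category* C] [Preadditive C] {A M : C} {r : ℕ}
    {k : Limits.Cofan fun _ : Fin r => A} (hk : Limits.IsColimit k)
    (e : Fin r → (A ⟶ M)) (c : Fin r → (M ⟶ A)) (hce : ∀ i, e i ≫ c i = 𝟙 A)
    (hce' : ∀ i j, i ≠ j → e i ≫ c j = 0) (hec : ∑ i, c i ≫ e i = 𝟙 M) : M ≅ k.pt where
  hom := ∑ i, c i ≫ k.inj i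
  inv := Limits.Cofan.IsColimit.desc hk e
  hom_inv_id := by
    rw [← hec, Preadditive.sum_comp]
    refine Finset.sum_congr rfl fun i _ => ?_
    rw [Category.assoc, Limits.Cofan.IsColimit.fac]
  inv_hom_id := by
    refine Limits.Cofan.IsColimit.hom_ext hk _ _ fun i => ?_
    rw [Limits.Cofan.IsColimit.fac_assoc, Preadditive.comp_sum, Finset.sum_eq_single i]
    · rw [← Category.assoc, hce, Category.id_comp, Category.comp_id]
    · intro j _ hj
      rw [← Category.assoc, hce' i j hj.symm, Limits.zero_comp]
    · simp

/-- The value on sections of a sum of morphisms. -/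
theorem sum_app {F G : X.Modules} {ι : Type} (s : Finset ι) (φ : ι → (F ⟶ G)) (U : X.Opens)
    (a : Γ(F, U)) : (∑ i ∈ s, φ i).app U a = ∑ i ∈ s, (φ i).app U a := by
  classical
  induction s using Finset.induction_on with
  | empty => rfl
  | insert i s hi h =>
    rw [Finset.sum_insert hi, Finset.sum_insert hi, ← h]
    rfl

/-- The module structure on sections of the restriction to an open subscheme is the original one. -/
theorem restrict_smul (F : X.Modules) (U : X.Opens) (V : U.toScheme.Opens)
    (q : Γ(U.toScheme, V)) (a : Γ(F.restrict U.ι, V)) :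
    q • a = ((show Γ(X, U.ι ''ᵁ V) from q) • (show Γ(F, U.ι ''ᵁ V) from a) :
      Γ(F, U.ι ''ᵁ V)) := by
  have h := congrArg (fun φ => (φ.inv q : Γ(X, U.ι ''ᵁ V))) (Scheme.Opens.ι_appIso U V)
  exact congrArg (fun q' : Γ(X, U.ι ''ᵁ V) => (q' • (show Γ(F, U.ι ''ᵁ V) from a))) h

/-- A sheaf of modules is free on an open set `U` if it has sections over `U` whose restrictions
form a basis of the sections over every smaller open set. -/
theorem exists_iso_free (F : X.Modules) (U : X.Opens) {r : ℕ} (e : Fin r → Γ(F, U))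
    (he : ∀ (V : X.Opens) (i : V ⟶ U),
      LinearIndependent Γ(X, V) (fun s => F.presheaf.map i.op (e s)))
    (hs : ∀ (V : X.Opens) (i : V ⟶ U),
      ⊤ ≤ Submodule.span Γ(X, V) (Set.range fun s => F.presheaf.map i.op (e s))) :
    Nonempty ((Scheme.Modules.restrictFunctor U.ι).obj F ≅
      (SheafOfModules.free (Fin r) : SheafOfModules U.toScheme.ringCatSheaf)) := by
  have im (V : U.toScheme.Opens) : U.ι ''ᵁ V ⟶ U := homOfLE (U.ι_image_le V)
  let b (V : U.toScheme.Opens) : Module.Basis (Fin r) Γ(X, U.ι ''ᵁ V) Γ(F, U.ι ''ᵁ V) :=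
    Module.Basis.mk (he _ (im V)) (hs _ (im V))
  have hb (V s) : b V s = F.presheaf.map (im V).op (e s) := Module.Basis.mk_apply _ _ _
  have hbr {V W : U.toScheme.Opens} (i : V ⟶ W) (s) :
      F.presheaf.map (U.ι.opensFunctor.map i).op (b W s) = b V s := by
    rw [hb, hb, ← ConcreteCategory.comp_apply, ← Functor.map_comp]
    rfl
  have hrepr {V W : U.toScheme.Opens} (i : V ⟶ W) (s) (a : Γ(F, U.ι ''ᵁ W)) :
      (b V).repr (F.presheaf.map (U.ι.opensFunctor.map i).op a) s =
        X.presheaf.map (U.ι.opensFunctor.map i).op ((b W).repr a s) := by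
    have h := congrArg (F.presheaf.map (U.ι.opensFunctor.map i).op) ((b W).sum_repr a)
    simp only [map_sum, Scheme.Modules.map_smul, hbr] at h
    rw [← h]
    exact congrFun ((b V).repr_sum_self _) s
  let M : U.toScheme.Modules := F.restrict U.ι
  let 𝒪 : U.toScheme.Modules := SheafOfModules.unit U.toScheme.ringCatSheaf
  -- `c s` takes the coordinate of index `s`, and `ε s` multiplies the basis vector of index `s`.
  let c (s : Fin r) : M ⟶ 𝒪 := homOfSections (F := M) (G := 𝒪)
    (fun V a => (b V).repr a s)
    (fun V a a' => congrArg (· s) (map_add (b V).repr a a'))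
    (fun V q a => (congrArg (fun a' => (b V).repr a' s) (restrict_smul F U V q a)).trans
      (congrArg (· s) ((b V).repr.map_smul _ _)))
    (fun i a => hrepr i s a)
  let ε (s : Fin r) : 𝒪 ⟶ M := homOfSections (F := 𝒪) (G := M)
    (fun V q => (show Γ(X, U.ι ''ᵁ V) from q) • b V s)
    (fun V q q' => add_smul (show Γ(X, U.ι ''ᵁ V) from q) (show Γ(X, U.ι ''ᵁ V) from q') (b V s))
    (fun V q q' => by
      refine Eq.trans ?_ (restrict_smul F U V q _).symm
      rw [smul_smul]
      rfl)
    (fun {W V} i q => by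
      refine Eq.trans ?_ (Scheme.Modules.map_smul F (U.ι.opensFunctor.map i)
        (show Γ(X, U.ι ''ᵁ W) from q) (b W s)).symm
      rw [hbr]
      rfl)
  have h1 (s) : ε s ≫ c s = 𝟙 𝒪 := by
    refine Scheme.Modules.hom_ext _ _ fun V => ?_
    ext q
    change (b V).repr ((show Γ(X, U.ι ''ᵁ V) from q) • b V s) s = q
    rw [map_smul, (b V).repr_self, Finsupp.smul_single, Finsupp.single_eq_same]
    exact mul_one _
  have h2 (s t) (hst : s ≠ t) : ε s ≫ c t = 0 := by
    refine Scheme.Modules.hom_ext _ _ fun V => ?_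
    ext q
    change (b V).repr ((show Γ(X, U.ι ''ᵁ V) from q) • b V s) t = 0
    rw [map_smul, (b V).repr_self, Finsupp.smul_single, Finsupp.single_eq_of_ne hst.symm]
  have h3 : ∑ s, c s ≫ ε s = 𝟙 M := by
    refine Scheme.Modules.hom_ext _ _ fun V => ?_
    ext a
    refine (sum_app (F := M) (G := M) Finset.univ (fun s => c s ≫ ε s) V a).trans ?_
    exact (b V).sum_repr a
  exact ⟨isoOfBiproductRelations (C := SheafOfModules U.toScheme.ringCatSheaf)
    (A := SheafOfModules.unit U.toScheme.ringCatSheaf) (M := M)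
    (SheafOfModules.isColimitFreeCofan (Fin r)) ε c h1 h2 h3⟩

end LocallyFree

/-! ### Short exact sequences in terms of sections -/

section Exactness
variable {X : Scheme.{0}}

/-- A sequence of sheaves of modules is short exact if it is left exact on sections and its last map
is surjective locally on sections. -/
theorem shortExact_of_sections {F G H : X.Modules} (i : F ⟶ G) (d : G ⟶ H) (w : i ≫ d = 0)
    (hi : ∀ U : X.Opens, Function.Injective (i.app U))
    (hd : ∀ (U : X.Opens) (s : Γ(G, U)), d.app U s = 0 → ∃ t, i.app U t = s)
    (hs : ∀ (U : X.Opens) (s : Γ(H, U)) (x : X), x ∈ U → ∃ (V : X.Opens) (j : V ⟶ U),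
      x ∈ V ∧ ∃ t : Γ(G, V), d.app V t = H.presheaf.map j.op s) :
    (ShortComplex.mk i d w).ShortExact := by
  have : Mono i := by
    refine ⟨fun {Z} g h e => Scheme.Modules.hom_ext _ _ fun U => ?_⟩
    ext a
    exact hi U (congrArg (fun φ : Z ⟶ G => φ.app U a) e)
  have : Epi d := by
    refine ⟨fun {Z} g h e => Scheme.Modules.hom_ext _ _ fun U => ?_⟩
    ext a
    refine TopCat.Presheaf.section_ext (F := ⟨Z.presheaf, Z.isSheaf⟩) _ _ _ fun x hx => ?_
    obtain ⟨V, j, hV, t, ht⟩ := hs U a x hx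
    refine TopCat.Presheaf.germ_ext Z.presheaf V hV j j ?_
    have e1 (φ : H ⟶ Z) : Z.presheaf.map j.op (φ.app U a) = φ.app V (d.app V t) := by
      rw [ht]
      exact (congrArg (fun ψ => ψ a) (φ.mapPresheaf.naturality j.op)).symm
    rw [e1, e1]
    exact congrArg (fun φ : G ⟶ Z => φ.app V t) e
  have lift {Z : X.Modules} (k : Z ⟶ G) (hk : k ≫ d = 0) : ∃ l : Z ⟶ F, l ≫ i = k := by
    have hk' (U : X.Opens) (a : Γ(Z, U)) : d.app U (k.app U a) = 0 :=
      congrArg (fun φ : Z ⟶ H => φ.app U a) hk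
    choose l hl using fun U a => hd U _ (hk' U a)
    refine ⟨⟨mkHom (R := X.presheaf) (P := Z.val) (Q := F.val)
      (fun U =>
        { toFun := l U.unop
          map_add' := fun a b => hi U.unop ?_
          map_smul' := fun q a => hi U.unop ?_ })
      (fun {U V} f a => hi V.unop ?_)⟩, Scheme.Modules.hom_ext _ _ fun U => ?_⟩
    · exact (hl _ _).trans ((map_add (k.app U.unop).hom a b).trans
        ((map_add (i.app U.unop).hom _ _).trans (congrArg₂ _ (hl _ _) (hl _ _))).symm)
    · exact (hl _ _).trans ((k.app_smul q a).trans
        ((i.app_smul q _).trans (congrArg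
          (fun x : Γ(G, U.unop) => (show Γ(X, U.unop) from q) • x) (hl _ _))).symm)
    · refine (hl _ _).trans ((congrArg (fun ψ => ψ a) (k.mapPresheaf.naturality f)).trans
        (Eq.trans ?_ (congrArg (fun ψ => ψ (l U.unop a)) (i.mapPresheaf.naturality f)).symm))
      exact congrArg (G.presheaf.map f) (hl _ _).symm
    · ext a
      exact hl U a
  exact .mk (ShortComplex.exact_of_f_is_kernel _ (Limits.KernelFork.IsLimit.ofι _ _
    (fun k hk => (lift k hk).choose) (fun k hk => (lift k hk).choose_spec)
    (fun k hk l hl => (cancel_mono i).1 (hl.trans (lift k hk).choose_spec.symm))))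

end Exactness

/-! ### Derivatives with constant coefficients on polynomial rings -/

section DirectionalDerivative
variable {σ L : Type} [Fintype σ] [CommRing L] (ξ : σ → L)

/-- The derivation `∑ k, ξ k • ∂/∂Y k` of the polynomial ring `L[Y]`. -/
def dirDeriv : Derivation L (MvPolynomial σ L) (MvPolynomial σ L) :=
  ∑ k, ξ k • MvPolynomial.pderiv k

theorem dirDeriv_apply (f : MvPolynomial σ L) :
    dirDeriv ξ f = ∑ k, MvPolynomial.C (ξ k) * MvPolynomial.pderiv k f := by
  refine (congrFun (map_sum (Derivation.coeFnAddMonoidHom (R := L) (A := MvPolynomial σ L)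
    (M := MvPolynomial σ L)) _ Finset.univ) f).trans ?_
  rw [Finset.sum_apply]
  exact Finset.sum_congr rfl fun k _ => MvPolynomial.smul_eq_C_mul _ _

theorem dirDeriv_X (k : σ) : dirDeriv ξ (MvPolynomial.X k) = MvPolynomial.C (ξ k) := by
  classical
  rw [dirDeriv_apply, Finset.sum_eq_single k]
  · simp
  · intro j _ hj
    rw [MvPolynomial.pderiv_X_of_ne hj.symm, mul_zero]
  · simp

theorem coeff_dirDeriv (f : MvPolynomial σ L) (s : σ →₀ ℕ) :
    (dirDeriv ξ f).coeff s = ∑ k, ξ k * (f.coeff (s + Finsupp.single k 1) * (s k + 1)) := by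
  simp only [dirDeriv_apply, MvPolynomial.coeff_sum, MvPolynomial.coeff_C_mul,
    MvPolynomial.coeff_pderiv]

theorem isHomogeneous_dirDeriv {f : MvPolynomial σ L} {m : ℕ} (hf : f.IsHomogeneous m) :
    (dirDeriv ξ f).IsHomogeneous (m - 1) := by
  rw [dirDeriv_apply]
  exact MvPolynomial.IsHomogeneous.sum _ _ _ fun k _ => hf.pderiv.C_mul _

theorem dirDeriv_eq_zero_of_isHomogeneous_zero {f : MvPolynomial σ L} (hf : f.IsHomogeneous 0) :
    dirDeriv ξ f = 0 := by
  rw [← MvPolynomial.totalDegree_zero_iff_isHomogeneous,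
    MvPolynomial.totalDegree_eq_zero_iff_eq_C] at hf
  rw [hf]
  exact (dirDeriv ξ).map_algebraMap _

/-- A polynomial annihilated by `∑ k, ξ k • ∂/∂Y k`, where `ξ i` is invertible, is determined by
its terms which do not involve `Y i`: comparing coefficients, each term with a positive power of
`Y i` is expressed by terms with a smaller power of `Y i`. -/
theorem eq_zero_of_dirDeriv_eq_zero [Algebra ℚ L] {i : σ} (hi : IsUnit (ξ i))
    {f : MvPolynomial σ L} (hf : dirDeriv ξ f = 0) (h0 : ∀ s, s i = 0 → f.coeff s = 0) : f = 0 := by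
  classical
  suffices h : ∀ (j : ℕ) (s : σ →₀ ℕ), s i = j → f.coeff s = 0 from
    MvPolynomial.ext _ _ fun s => h _ s rfl
  intro j
  induction j with
  | zero => exact h0
  | succ j ih =>
    intro s hs
    obtain ⟨t, rfl⟩ : ∃ t, s = t + Finsupp.single i 1 := by
      refine ⟨s - Finsupp.single i 1, (tsub_add_cancel_of_le ?_).symm⟩
      rw [Finsupp.single_le_iff]
      omega
    have ht : t i = j := by simpa using hs
    have h := congrArg (MvPolynomial.coeff t) hf
    rw [coeff_dirDeriv, Finset.sum_eq_single i, MvPolynomial.coeff_zero] at h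
    · have hu : IsUnit ((t i : L) + 1) := by
        have := (Nat.cast_ne_zero (R := ℚ)).2 (Nat.succ_ne_zero (t i))
        simpa using (IsUnit.mk0 _ this).map (algebraMap ℚ L)
      exact hu.mul_left_eq_zero.1 (hi.mul_right_eq_zero.1 h)
    · intro k _ hk
      rw [ih _ (by simp [ht, hk.symm]), zero_mul, mul_zero]
    · simp

end DirectionalDerivative

/-! ### The total differential on a localization of a polynomial ring -/

section LocalizationDerivation
variable {σ L : Type} [Fintype σ] [CommRing L]
  [Algebra (MvPolynomial σ ℂ) L] [Algebra ℂ L] [IsScalarTower ℂ (MvPolynomial σ ℂ) L]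
  (M : Submonoid (MvPolynomial σ ℂ)) [IsLocalization M L]

/-- The total differential `P ↦ ∑ k, ∂P/∂X k • Y k` on a localization `L` of `ℂ[X]`, with values in
the linear forms of `L[Y]`. -/
def totalDiff : Derivation ℂ L (MvPolynomial σ L) :=
  haveI := Algebra.FormallyEtale.of_isLocalization (Rₘ := L) M
  (LinearMap.comp (LinearMap.liftBaseChange L
    (MvPolynomial.mkDerivation ℂ
      (fun k : σ => (MvPolynomial.X k : MvPolynomial σ L))).liftKaehlerDifferential)
    (KaehlerDifferential.tensorKaehlerEquivOfFormallyEtale ℂ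
      (MvPolynomial σ ℂ) L).symm.toLinearMap).compDer (KaehlerDifferential.D ℂ L)

theorem totalDiff_algebraMap (P : MvPolynomial σ ℂ) :
    totalDiff M (algebraMap _ L P) = ∑ k, MvPolynomial.C
      (algebraMap (MvPolynomial σ ℂ) L (MvPolynomial.pderiv k P)) * MvPolynomial.X k := by
  have := Algebra.FormallyEtale.of_isLocalization (Rₘ := L) M
  have h : totalDiff M (algebraMap _ L P) = MvPolynomial.mkDerivation ℂ
      (fun k : σ => (MvPolynomial.X k : MvPolynomial σ L)) P := by
    simp [totalDiff, KaehlerDifferential.tensorKaehlerEquivOfFormallyEtale_symm_D_algebraMap]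
  rw [h]
  clear h
  induction P using MvPolynomial.induction_on with
  | C a => simp
  | add p q hp hq => simp [hp, hq, add_mul, Finset.sum_add_distrib]
  | mul_X p i hp =>
    classical
    have hsmul (q : MvPolynomial σ ℂ) (f : MvPolynomial σ L) :
        q • f = MvPolynomial.C (algebraMap _ L q) * f := by
      rw [← IsScalarTower.algebraMap_smul L q f, MvPolynomial.smul_eq_C_mul]
    rw [Derivation.leibniz, hp, MvPolynomial.mkDerivation_X, hsmul, hsmul, Finset.mul_sum]
    simp only [MvPolynomial.pderiv_mul, map_add, map_mul, add_mul, Finset.sum_add_distrib]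
    rw [add_comm]
    congr 1
    · exact Finset.sum_congr rfl fun k _ => by ring
    · rw [Finset.sum_eq_single i]
      · simp
      · intro j _ hj
        simp [MvPolynomial.pderiv_X_of_ne hj.symm]
      · simp

/-- The quotient rule. -/
theorem totalDiff_fraction {a b : MvPolynomial σ ℂ} {f : L}
    (h : f * algebraMap _ L b = algebraMap _ L a) :
    MvPolynomial.C (algebraMap _ L b * algebraMap _ L b) * totalDiff M f =
      ∑ k, MvPolynomial.C (algebraMap (MvPolynomial σ ℂ) L
        (b * MvPolynomial.pderiv k a - a * MvPolynomial.pderiv k b)) * MvPolynomial.X k := by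
  have h1 := congrArg (totalDiff M) h
  rw [Derivation.leibniz] at h1
  have h2 : MvPolynomial.C (algebraMap _ L b) * totalDiff M f =
      totalDiff M (algebraMap _ L a) - MvPolynomial.C f * totalDiff M (algebraMap _ L b) := by
    rw [← h1, MvPolynomial.smul_eq_C_mul, MvPolynomial.smul_eq_C_mul]
    ring
  have h3 := congrArg (MvPolynomial.C (σ := σ)) h
  rw [map_mul] at h3
  calc _ = MvPolynomial.C (algebraMap _ L b) * totalDiff M (algebraMap _ L a) -
        MvPolynomial.C (algebraMap _ L a) * totalDiff M (algebraMap _ L b) := by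
        rw [map_mul, mul_assoc, h2, ← h3]
        ring
    _ = _ := by
        rw [totalDiff_algebraMap, totalDiff_algebraMap, Finset.mul_sum, Finset.mul_sum,
          ← Finset.sum_sub_distrib]
        refine Finset.sum_congr rfl fun k _ => ?_
        rw [map_sub, map_mul, map_mul, map_sub, map_mul, map_mul]
        ring

/-- By Euler's identity, the derivative of a quotient of homogeneous polynomials of the same degree
in the direction `X` vanishes. -/
theorem dirDeriv_totalDiff {a b : MvPolynomial σ ℂ} {d : ℕ} (ha : a.IsHomogeneous d)
    (hb : b.IsHomogeneous d) {f : L} (h : f * algebraMap _ L b = algebraMap _ L a)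
    (hu : IsUnit (algebraMap _ L b)) :
    dirDeriv (fun k => algebraMap _ L (MvPolynomial.X k : MvPolynomial σ ℂ)) (totalDiff M f) =
      0 := by
  have h1 := congrArg (dirDeriv fun k => algebraMap _ L (MvPolynomial.X k : MvPolynomial σ ℂ))
    (totalDiff_fraction M h)
  have h2 : ∑ k : σ, (b * MvPolynomial.pderiv k a - a * MvPolynomial.pderiv k b) *
      MvPolynomial.X k = 0 := by
    have e : ∀ k : σ, (b * MvPolynomial.pderiv k a - a * MvPolynomial.pderiv k b) *
        MvPolynomial.X k = b * (MvPolynomial.X k * MvPolynomial.pderiv k a) -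
          a * (MvPolynomial.X k * MvPolynomial.pderiv k b) := fun k => by ring
    simp only [e, Finset.sum_sub_distrib, ← Finset.mul_sum, ha.sum_X_mul_pderiv,
      hb.sum_X_mul_pderiv, mul_smul_comm, mul_comm a b, sub_self]
  rw [MvPolynomial.C_mul', Derivation.map_smul, map_sum] at h1
  simp only [MvPolynomial.C_mul', Derivation.map_smul, dirDeriv_X] at h1
  simp only [MvPolynomial.smul_eq_C_mul, ← map_mul, ← map_sum, h2, map_zero] at h1
  have hu2 := ((hu.mul hu).map (MvPolynomial.C (σ := σ)))
  rw [← map_mul] at hu2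
  exact hu2.mul_right_eq_zero.1 h1

/-- The quotient rule for `f = X_j / X_i`, with `v` for `X_i⁻²`. -/
theorem totalDiff_X_div_X {i j : σ} {f v : L}
    (h : f * algebraMap (MvPolynomial σ ℂ) L (.X i) = algebraMap (MvPolynomial σ ℂ) L (.X j))
    (hv : v * (algebraMap (MvPolynomial σ ℂ) L (.X i) * algebraMap (MvPolynomial σ ℂ) L (.X i)) =
      1) :
    totalDiff M f =
      MvPolynomial.C (v * algebraMap (MvPolynomial σ ℂ) L (.X i)) * MvPolynomial.X j -
        MvPolynomial.C (v * algebraMap (MvPolynomial σ ℂ) L (.X j)) * MvPolynomial.X i := by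
  classical
  have h1 := congrArg (MvPolynomial.C v * ·) (totalDiff_fraction M h)
  beta_reduce at h1
  rw [← mul_assoc, ← map_mul, hv, map_one, one_mul] at h1
  rw [h1]
  simp only [MvPolynomial.pderiv_X, Pi.single_apply, map_sub, map_mul, sub_mul,
    Finset.sum_sub_distrib, mul_sub]
  simp [mul_assoc]

end LocalizationDerivation

/-! ### Local fractions of homogeneous polynomials -/

section TwistFractions
variable {N : ℕ} {U : Opens (ProjectiveSpectrum.top (Homog N))}

theorem isLocallyTwistFraction_mul {n n' : ℤ} {f g : ∀ x : U, Loc N x.1}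
    (hf : (isLocallyTwistFraction n).pred f) (hg : (isLocallyTwistFraction n').pred g) :
    (isLocallyTwistFraction (n + n')).pred (f * g) := by
  intro x
  obtain ⟨V, hV, iV, i, j, a, b, ha, hb, h, hbV, hfV⟩ := hf x
  obtain ⟨W, hW, iW, i', j', a', b', ha', hb', h', hbW, hgW⟩ := hg x
  refine ⟨V ⊓ W, ⟨hV, hW⟩, Opens.infLELeft _ _ ≫ iV, i + i', j + j', a * a', b * b',
    SetLike.mul_mem_graded ha ha', SetLike.mul_mem_graded hb hb', by push_cast; omega,
    fun y hy => (y.1.isPrime.mem_or_mem hy).elim (hbV ⟨y.1, y.2.1⟩) (hbW ⟨y.1, y.2.2⟩), ?_⟩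
  intro y
  exact (congrArg₂ (· * ·) (hfV ⟨y.1, y.2.1⟩) (hgW ⟨y.1, y.2.2⟩)).trans
    (Localization.mk_mul _ _ _ _)

theorem isLocallyTwistFraction_sum {ι : Type*} (t : Finset ι) {n : ℤ}
    {f : ι → ∀ x : U, Loc N x.1} (hf : ∀ i ∈ t, (isLocallyTwistFraction n).pred (f i)) :
    (isLocallyTwistFraction n).pred (∑ i ∈ t, f i) := by
  classical
  induction t using Finset.induction_on with
  | empty => exact isLocallyTwistFraction_zero n U
  | insert i t hi h =>
    rw [Finset.sum_insert hi]
    exact isLocallyTwistFraction_add n (hf i (Finset.mem_insert_self _ _))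
      (h fun j hj => hf j (Finset.mem_insert_of_mem hj))

/-- A fraction of homogeneous polynomials with nowhere vanishing denominator. -/
theorem isLocallyTwistFraction_of_fraction {n : ℤ} {f : ∀ x : U, Loc N x.1} {i j : ℕ}
    {a b : Poly N} (ha : a ∈ Homog N i) (hb : b ∈ Homog N j) (h : (i : ℤ) = j + n)
    (hbU : ∀ x : U, b ∉ x.1.asHomogeneousIdeal.toIdeal)
    (hf : ∀ x : U, f x * algebraMap (Poly N) (Loc N x.1) b = algebraMap (Poly N) (Loc N x.1) a) :
    (isLocallyTwistFraction n).pred f := fun x =>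
  ⟨U, x.2, 𝟙 _, i, j, a, b, ha, hb, h, hbU, fun y => by
    rw [Localization.mk_eq_mk', IsLocalization.eq_mk'_iff_mul_eq]
    exact hf y⟩

theorem isLocallyTwistFraction_constant (c : ℂ) :
    (isLocallyTwistFraction (N := N) 0).pred
      fun x : U => algebraMap (Poly N) (Loc N x.1) (MvPolynomial.C c) :=
  isLocallyTwistFraction_of_fraction (i := 0) (j := 0) (a := MvPolynomial.C c) (b := 1)
    (MvPolynomial.isHomogeneous_C _ c) (MvPolynomial.isHomogeneous_one _ _) rfl
    (fun x h => x.1.isPrime.one_notMem h) (fun x => by simp)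

end TwistFractions

/-! ### Sheaves of polynomials with coefficients in `O(n)` -/

section GermPolynomials
variable {N : ℕ}

/-- Polynomials in `Y 0, …, Y N` over the localization of `ℂ[X]` at `x`. -/
abbrev LocPoly (x : ProjectiveSpectrum (Homog N)) : Type :=
  MvPolynomial (Fin (N + 1)) (Loc N x)

/-- All coefficients of the family `f` of polynomials over the localizations are locally fractions
of degree `n`. -/
def HasTwistCoeffs (n : ℤ) {U : Opens (ProjectiveSpectrum.top (Homog N))}
    (f : ∀ x : U, LocPoly x.1) : Prop :=
  ∀ s : Fin (N + 1) →₀ ℕ, (isLocallyTwistFraction n).pred fun x : U => (f x).coeff s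

section
variable {U : Opens (ProjectiveSpectrum.top (Homog N))}

theorem HasTwistCoeffs.zero (n : ℤ) : HasTwistCoeffs n (0 : ∀ x : U, LocPoly x.1) :=
  fun _ => isLocallyTwistFraction_zero n U

theorem HasTwistCoeffs.add {n : ℤ} {f g : ∀ x : U, LocPoly x.1} (hf : HasTwistCoeffs n f)
    (hg : HasTwistCoeffs n g) : HasTwistCoeffs n (f + g) :=
  fun s => isLocallyTwistFraction_add n (hf s) (hg s)

theorem HasTwistCoeffs.mul {n n' : ℤ} {f g : ∀ x : U, LocPoly x.1} (hf : HasTwistCoeffs n f)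
    (hg : HasTwistCoeffs n' g) : HasTwistCoeffs (n + n') (f * g) := by
  classical
  intro s
  have h := isLocallyTwistFraction_sum (Finset.HasAntidiagonal.antidiagonal s)
    fun (p : (Fin (N + 1) →₀ ℕ) × (Fin (N + 1) →₀ ℕ)) _ =>
      isLocallyTwistFraction_mul (hf p.1) (hg p.2)
  convert! h using 2
  rw [Finset.sum_apply]
  exact MvPolynomial.coeff_mul _ _ _

theorem HasTwistCoeffs.C {n : ℤ} {f : ∀ x : U, Loc N x.1}
    (hf : (isLocallyTwistFraction n).pred f) :
    HasTwistCoeffs n fun x : U => (MvPolynomial.C (f x) : LocPoly x.1) := by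
  classical
  intro s
  by_cases hs : 0 = s
  · simpa [MvPolynomial.coeff_C, hs] using hf
  · simpa [MvPolynomial.coeff_C, hs] using! isLocallyTwistFraction_zero n U

theorem HasTwistCoeffs.map (P : MvPolynomial (Fin (N + 1)) ℂ) :
    HasTwistCoeffs 0 fun x : U =>
      (MvPolynomial.map ((algebraMap (Poly N) (Loc N x.1)).comp MvPolynomial.C) P :
        LocPoly x.1) := by
  intro s
  simpa [MvPolynomial.coeff_map] using isLocallyTwistFraction_constant (U := U) (P.coeff s)

theorem HasTwistCoeffs.X (k : Fin (N + 1)) :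
    HasTwistCoeffs 0 fun x : U => (MvPolynomial.X k : LocPoly x.1) := by
  simpa using HasTwistCoeffs.map (U := U) (MvPolynomial.X k)

end

/-- The germs of the homogeneous coordinates. -/
def germX (x : ProjectiveSpectrum (Homog N)) (k : Fin (N + 1)) : Loc N x :=
  algebraMap (Poly N) (Loc N x) (MvPolynomial.X k)

theorem HasTwistCoeffs.dirDeriv {n : ℤ} {U : Opens (ProjectiveSpectrum.top (Homog N))}
    {f : ∀ x : U, LocPoly x.1} (hf : HasTwistCoeffs n f) :
    HasTwistCoeffs (n + 1) fun x : U => GenEuler.dirDeriv (germX x.1) (f x) := by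
  intro s
  have h := isLocallyTwistFraction_sum (Finset.univ : Finset (Fin (N + 1))) fun k _ =>
    isLocallyTwistFraction_X (n + 0) k (isLocallyTwistFraction_mul (hf (s + Finsupp.single k 1))
      (isLocallyTwistFraction_constant (s k + 1 : ℂ)))
  rw [add_zero] at h
  convert! h using 2 with x
  rw [coeff_dirDeriv, Finset.sum_apply]
  simp [germX]

variable (Q : ∀ x : ProjectiveSpectrum (Homog N), Submodule (Loc N x) (LocPoly x)) (n : ℤ)

/-- Families of polynomials over the localizations which belong to `Q` and have coefficients in
`O(n)`. -/
def isPolySection :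
    TopCat.LocalPredicate (X := ProjectiveSpectrum.top (Homog N)) fun x => LocPoly x where
  pred {U} f := (∀ x : U, f x ∈ Q x.1) ∧ HasTwistCoeffs n f
  res := fun i f h => ⟨fun x => h.1 (i x), fun s => (isLocallyTwistFraction n).res i _ (h.2 s)⟩
  locality := fun {U} f h => by
    refine ⟨fun x => ?_, fun s => (isLocallyTwistFraction n).locality _ fun x => ?_⟩
    · obtain ⟨V, hV, i, h1, h2⟩ := h x
      exact h1 ⟨x.1, hV⟩
    · obtain ⟨V, hV, i, h1, h2⟩ := h x
      exact ⟨V, hV, i, h2 s⟩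

/-- Families of polynomials over the localizations at the points of `U`. -/
def PolyGerms (U : (PN N).Opensᵒᵖ) : Type := ∀ x : U.unop, LocPoly x.1

instance (U : (PN N).Opensᵒᵖ) : CommRing (PolyGerms U) :=
  inferInstanceAs (CommRing (∀ x : U.unop, LocPoly x.1))

/-- Sections of the structure sheaf as families of constant polynomials. -/
def polyValHom (U : (PN N).Opensᵒᵖ) : (PN N).presheaf.obj U →+* PolyGerms U :=
  (RingHom.pi fun x : U.unop => MvPolynomial.C.comp (Pi.evalRingHom _ x)).comp (secValHom U)

/-- A section of the structure sheaf acts on families of polynomials pointwise. -/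
instance (U : (PN N).Opensᵒᵖ) : Algebra ((PN N).presheaf.obj U) (PolyGerms U) :=
  (polyValHom U).toAlgebra

theorem isLocallyTwistFraction_secVal {U : (PN N).Opensᵒᵖ} (q : (PN N).presheaf.obj U) :
    (isLocallyTwistFraction 0).pred (secVal q) := by
  simpa using isLocallyTwistFraction_smul 0 q (f := 1)
    (by simpa using! isLocallyTwistFraction_constant (U := U.unop) 1)

/-- Sections over `U` of the sheaf of polynomials belonging to `Q` with coefficients in `O(n)`. -/
def polySections (U : (PN N).Opensᵒᵖ) :
    Submodule ((PN N).presheaf.obj U) (PolyGerms U) where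
  carrier := {f | (isPolySection Q n).pred f}
  zero_mem' := ⟨fun x => zero_mem _, .zero n⟩
  add_mem' h h' := ⟨fun x => add_mem (h.1 x) (h'.1 x), h.2.add h'.2⟩
  smul_mem' q f h := ⟨fun x => by
      have h1 := Submodule.smul_mem (Q x.1) (secVal q x) (h.1 x)
      rwa [MvPolynomial.smul_eq_C_mul] at h1,
    by simpa using! (HasTwistCoeffs.C (isLocallyTwistFraction_secVal q)).mul h.2⟩

/-- Restriction of sections. -/
def polyRes {U V : (PN N).Opensᵒᵖ} (f : U ⟶ V) :
    polySections Q n U →ₛₗ[((PN N).presheaf.map f).hom] polySections Q n V where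
  toFun s := ⟨fun x => s.1 (f.unop x), (isPolySection Q n).res f.unop s.1 s.2⟩
  map_add' _ _ := rfl
  map_smul' _ _ := rfl

/-- The presheaf of polynomials belonging to `Q` with coefficients in `O(n)`. -/
def polyPresheaf : PresheafOfModules.{0} ((PN N).presheaf ⋙ forget₂ CommRingCat RingCat) :=
  mkPresheaf (R := (PN N).presheaf)
    (fun U => ModuleCat.of ((PN N).presheaf.obj U) (polySections Q n U))
    (fun f => polyRes Q n f) (fun _ _ => rfl) (fun _ _ _ => rfl)

theorem polyPresheaf_isSheaf : TopCat.Presheaf.IsSheaf (polyPresheaf Q n).presheaf := by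
  refine (TopCat.Presheaf.isSheaf_iff_isSheaf_comp (forget Ab) _).2 ?_
  exact TopCat.Presheaf.isSheaf_of_iso (NatIso.ofComponents (fun U => Iso.refl _) (fun f => rfl))
    (TopCat.subsheafToTypes (isPolySection Q n)).property

/-- The sheaf of polynomials belonging to `Q` with coefficients in `O(n)`. -/
def polySheaf : (PN N).Modules where
  val := polyPresheaf Q n
  isSheaf := polyPresheaf_isSheaf Q n

end GermPolynomials

/-! ### The sheaf `ℂ[Y]_m ⊗ O(n)` and the operator `δ` in terms of polynomials -/

section PolynomialSheaves
variable {N : ℕ}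

/-- The homogeneous polynomials of degree `m` over the localizations. -/
def homogQ (m : ℕ) (x : ProjectiveSpectrum (Homog N)) : Submodule (Loc N x) (LocPoly x) :=
  MvPolynomial.homogeneousSubmodule (Fin (N + 1)) (Loc N x) m

/-- The homogeneous polynomials of degree `m` over the localizations which are annihilated
by `∑ k, X k • ∂/∂Y k`. -/
def kerQ (m : ℕ) (x : ProjectiveSpectrum (Homog N)) : Submodule (Loc N x) (LocPoly x) :=
  homogQ m x ⊓ LinearMap.ker (dirDeriv (germX x)).toLinearMap

variable (N)

/-- The operator `∑ k, X k • ∂/∂Y k` on sheaves of polynomials. -/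
def polyDelta (m : ℕ) (n : ℤ) :
    polySheaf (N := N) (homogQ m) n ⟶ polySheaf (homogQ (m - 1)) (n + 1) :=
  ⟨mkHom (R := (PN N).presheaf) (P := polyPresheaf (homogQ m) n)
    (Q := polyPresheaf (homogQ (m - 1)) (n + 1))
    (fun U =>
      { toFun := fun f : polySections (homogQ m) n U =>
          (⟨fun x => dirDeriv (germX x.1) (f.1 x), fun x => isHomogeneous_dirDeriv _ (f.2.1 x),
            HasTwistCoeffs.dirDeriv f.2.2⟩ : polySections (homogQ (m - 1)) (n + 1) U)
        map_add' := fun _ _ => Subtype.ext (funext fun _ => map_add _ _ _)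
        map_smul' := fun q f => Subtype.ext (funext fun x => by
          refine (congrArg (dirDeriv (germX x.1))
            (MvPolynomial.smul_eq_C_mul (f.1 x) (secVal q x)).symm).trans ?_
          exact ((dirDeriv (germX x.1)).map_smul _ _).trans (MvPolynomial.smul_eq_C_mul _ _)) })
    (fun _ _ => rfl)⟩

/-- The inclusion of the kernel of `∑ k, X k • ∂/∂Y k`. -/
def kerIncl (m : ℕ) (n : ℤ) : polySheaf (N := N) (kerQ m) n ⟶ polySheaf (homogQ m) n :=
  ⟨mkHom (R := (PN N).presheaf) (P := polyPresheaf (kerQ m) n) (Q := polyPresheaf (homogQ m) n)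
    (fun U =>
      { toFun := fun f : polySections (kerQ m) n U =>
          (⟨f.1, fun x => (f.2.1 x).1, f.2.2⟩ : polySections (homogQ m) n U)
        map_add' := fun _ _ => rfl
        map_smul' := fun _ _ => rfl })
    (fun _ _ => rfl)⟩

theorem kerIncl_polyDelta (m : ℕ) (n : ℤ) : kerIncl N m n ≫ polyDelta N m n = 0 := by
  refine Scheme.Modules.hom_ext _ _ fun U => ?_
  ext f
  exact Subtype.ext (funext fun x => (f.2.1 x).2)

variable {N}

/-- The family of polynomials `s • P`, for a section `s` of `O(n)` and a polynomial `P` with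
constant coefficients. -/
def polyOf {m : ℕ} {n : ℤ} {U : (PN N).Opensᵒᵖ} (s : twistSections n U) (P : Homog N m) :
    polySections (N := N) (homogQ m) n U :=
  ⟨fun x => MvPolynomial.C (s.1 x) *
      MvPolynomial.map ((algebraMap (Poly N) (Loc N x.1)).comp MvPolynomial.C) P.1,
    fun _ => (MvPolynomial.IsHomogeneous.map P.2 _).C_mul _,
    by simpa using! (HasTwistCoeffs.C s.2).mul (HasTwistCoeffs.map P.1)⟩

theorem constSec_val {U : (PN N).Opensᵒᵖ} (c : ℂ) (x : U.unop) :
    secVal (constSec U c) x = algebraMap (Poly N) (Loc N x.1) (MvPolynomial.C c) := by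
  refine Eq.trans ?_ (Localization.mk_one_eq_algebraMap _)
  rfl

/-- The family of coefficients of a fixed monomial. -/
def coeffSec {m : ℕ} {n : ℤ} {U : (PN N).Opensᵒᵖ} (t : Fin (N + 1) →₀ ℕ)
    (f : polySections (N := N) (homogQ m) n U) : twistSections n U :=
  ⟨fun x => (f.1 x).coeff t, f.2.2 t⟩

/-- The map `s ⊗ P ↦ s • P`. -/
def polyOfTensor (m : ℕ) (n : ℤ) (U : (PN N).Opensᵒᵖ) :
    Res (constSec U) (twistSections n U) ⊗[ℂ] Homog N m →+ polySections (N := N) (homogQ m) n U :=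
  TensorProduct.liftAddHom
    { toFun := fun s =>
        { toFun := fun P => polyOf s P
          map_zero' := Subtype.ext (funext fun x =>
            (congrArg (_ * ·) (map_zero (MvPolynomial.map _))).trans (mul_zero _))
          map_add' := fun P P' => Subtype.ext (funext fun x =>
            (congrArg (_ * ·) (map_add (MvPolynomial.map _) P.1 P'.1)).trans (mul_add _ _ _)) }
      map_zero' := AddMonoidHom.ext fun P => Subtype.ext (funext fun x =>
        (congrArg (· * _) (map_zero MvPolynomial.C)).trans (zero_mul _))
      map_add' := fun s s' => AddMonoidHom.ext fun P => Subtype.ext (funext fun x =>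
        (congrArg (· * _) (map_add MvPolynomial.C (s.1 x) (s'.1 x))).trans (add_mul _ _ _)) }
    (fun c s P => Subtype.ext (funext fun x => by
      change MvPolynomial.C (secVal (constSec U c) x * s.1 x) * _ =
        MvPolynomial.C (s.1 x) * MvPolynomial.map _ (c • P.1)
      rw [constSec_val, MvPolynomial.smul_eq_C_mul, map_mul, map_mul, MvPolynomial.map_C,
        RingHom.comp_apply]
      ring))

theorem polyOfTensor_tmul (m : ℕ) (n : ℤ) (U : (PN N).Opensᵒᵖ)
    (s : Res (constSec U) (twistSections n U)) (P : Homog N m) :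
    polyOfTensor m n U (s ⊗ₜ P) = polyOf s P := rfl

/-- The monomials of degree `m`. -/
def monoms (N m : ℕ) : Finset (Fin (N + 1) →₀ ℕ) := Finset.finsuppAntidiag Finset.univ m

theorem mem_monoms {m : ℕ} {t : Fin (N + 1) →₀ ℕ} : t ∈ monoms N m ↔ t.degree = m := by
  simp [monoms, Finset.mem_finsuppAntidiag, Finsupp.degree_eq_sum]

theorem sum_monoms {L : Type} [CommRing L] {m : ℕ} {f : MvPolynomial (Fin (N + 1)) L}
    (hf : f.IsHomogeneous m) : ∑ t ∈ monoms N m, MvPolynomial.monomial t (f.coeff t) = f := by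
  conv_rhs => rw [f.as_sum]
  refine (Finset.sum_subset (fun t ht => mem_monoms.2 ?_) fun t _ ht => ?_).symm
  · exact hf.degree_eq_sum_deg_support ht |>.symm
  · rw [MvPolynomial.notMem_support_iff.1 ht, map_zero]

/-- The value of a section at a point. -/
def polyEval {Q : ∀ x : ProjectiveSpectrum (Homog N), Submodule (Loc N x) (LocPoly x)} {n : ℤ}
    {U : (PN N).Opensᵒᵖ} (x : U.unop) : polySections Q n U →+ LocPoly x.1 where
  toFun f := f.1 x
  map_zero' := rfl
  map_add' _ _ := rfl

theorem polyOfTensor_bijective (m : ℕ) (n : ℤ) (U : (PN N).Opensᵒᵖ) :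
    Function.Bijective (polyOfTensor (N := N) m n U) := by
  let Ym (t : Fin (N + 1) →₀ ℕ) : Homog N m :=
    if h : t.degree = m then ⟨MvPolynomial.monomial t 1, MvPolynomial.isHomogeneous_monomial _ h⟩
      else 0
  let ψ : polySections (N := N) (homogQ m) n U →
      Res (constSec U) (twistSections n U) ⊗[ℂ] Homog N m :=
    fun f => ∑ t ∈ monoms N m, (show Res (constSec U) (twistSections n U) from coeffSec t f) ⊗ₜ Ym t
  -- The inverse takes a polynomial apart into its terms.
  refine Function.bijective_iff_has_inverse.2 ⟨ψ, fun a => ?_, fun f => ?_⟩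
  · have hadd (f g) : ψ (f + g) = ψ f + ψ g := by
      refine (Finset.sum_congr rfl fun t _ => ?_).trans Finset.sum_add_distrib
      exact TensorProduct.add_tmul (show Res (constSec U) (twistSections n U) from coeffSec t f)
        (coeffSec t g) (Ym t)
    induction a using TensorProduct.induction_on with
    | zero =>
      have h := hadd 0 0
      rw [add_zero, left_eq_add] at h
      rw [map_zero, h]
    | tmul s P =>
      rw [polyOfTensor_tmul]
      have hc (t : Fin (N + 1) →₀ ℕ) :
          (show Res (constSec U) (twistSections n U) from coeffSec t (polyOf s P)) =
            P.1.coeff t • s := Subtype.ext (funext fun x => by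
        refine Eq.trans ?_ (congrArg (· * s.1 x) (constSec_val (P.1.coeff t) x).symm)
        refine (MvPolynomial.coeff_C_mul _ _ _).trans ?_
        rw [MvPolynomial.coeff_map, mul_comm]
        rfl)
      simp only [ψ, hc, TensorProduct.smul_tmul, ← TensorProduct.tmul_sum]
      congr 1
      refine Subtype.ext ?_
      conv_rhs => rw [← sum_monoms P.2]
      rw [AddSubmonoidClass.coe_finsetSum]
      refine Finset.sum_congr rfl fun t ht => ?_
      simp [Ym, mem_monoms.1 ht, MvPolynomial.smul_monomial]
    | add a b ha hb => rw [map_add, hadd, ha, hb]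
  · refine Subtype.ext (funext fun x => ?_)
    refine (map_sum ((polyEval x).comp (polyOfTensor m n U)) _ _).trans ?_
    conv_rhs => rw [← sum_monoms (f.2.1 x)]
    refine Finset.sum_congr rfl fun t ht => ?_
    change MvPolynomial.C ((f.1 x).coeff t) * MvPolynomial.map _ (Ym t).1 = _
    simp [Ym, mem_monoms.1 ht, MvPolynomial.C_mul_monomial]

theorem polyOfTensor_smul (m : ℕ) (n : ℤ) (U : (PN N).Opensᵒᵖ) (q : (PN N).presheaf.obj U)
    (a : Res (constSec U) (twistSections n U) ⊗[ℂ] Homog N m) :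
    polyOfTensor m n U (q • a) = q • polyOfTensor m n U a := by
  induction a using TensorProduct.induction_on with
  | zero => rw [smul_zero, map_zero, smul_zero]
  | tmul s P =>
    refine Subtype.ext (funext fun x => ?_)
    exact (congrArg (· * _) (map_mul MvPolynomial.C _ _)).trans (mul_assoc _ _ _)
  | add a b ha hb => rw [smul_add, map_add, map_add, smul_add, ha, hb]

/-- The map `s ⊗ P ↦ s • P` as a morphism of presheaves. -/
def polyOfTensorHom (m : ℕ) (n : ℤ) :
    vecPresheaf (scalars N) (twistPresheaf N n) (Homog N m) ⟶ polyPresheaf (homogQ m) n :=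
  mkHom (R := (PN N).presheaf)
    (P := vecPresheaf (scalars N) (twistPresheaf N n) (Homog N m))
    (Q := polyPresheaf (homogQ m) n)
    (fun U =>
      { toFun := polyOfTensor m n U
        map_add' := map_add (polyOfTensor m n U)
        map_smul' := polyOfTensor_smul m n U })
    (fun {U V} f a => by
      induction a using TensorProduct.induction_on with
      | zero => rfl
      | tmul s P => rfl
      | add a b ha hb =>
        refine (congrArg (polyOfTensor m n V) (map_add _ a b)).trans
          ((map_add (polyOfTensor m n V) _ _).trans ((congrArg₂ _ ha hb).trans ?_))
        exact (map_add (polyRes (homogQ m) n f) (polyOfTensor m n U a)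
          (polyOfTensor m n U b)).symm.trans
            (congrArg (polyRes (homogQ m) n f) (map_add (polyOfTensor m n U) a b).symm))

theorem polyOfTensorHom_bijective (m : ℕ) (n : ℤ) (U : (PN N).Opensᵒᵖ) :
    Function.Bijective ((polyOfTensorHom (N := N) m n).app U) :=
  polyOfTensor_bijective m n U

/-- The morphism from `ℂ[Y]_m ⊗ O(n)` to the sheaf of homogeneous polynomials with coefficients in
`O(n)`. -/
def polyTwistHom (m : ℕ) (n : ℤ) : polyTwist N m n ⟶ polySheaf (homogQ m) n :=
  assocDesc (F := polySheaf (homogQ m) n) (polyOfTensorHom m n)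

theorem isIso_polyTwistHom (m : ℕ) (n : ℤ) : IsIso (polyTwistHom (N := N) m n) :=
  isIso_assocDesc (F := polySheaf (homogQ m) n) (polyOfTensorHom (N := N) m n)
    (isLocallySurjective_of_exists _ fun U s x hx =>
      ⟨U, 𝟙 U, hx, (polyOfTensorHom_bijective m n (op U)).2 s⟩)
    (isLocallyInjective_of_exists _ fun U s x hx hs => ⟨U, 𝟙 U, hx, by
      have h := (polyOfTensorHom_bijective m n (op U)).1 (hs.trans (map_zero _).symm)
      rw [h]
      exact map_zero _⟩)

theorem deltaPresheaf_tmul (m : ℕ) (n : ℤ) (U : (PN N).Opensᵒᵖ)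
    (s : Res (constSec U) (twistSections n U)) (P : Homog N m) :
    polyOfTensor (m - 1) (n + 1) U ((deltaPresheaf N m n).app U (s ⊗ₜ P)) =
      ∑ k, polyOf ((mulX N n k).app U s) (dY N m k P) := by
  have h (t : Finset (Fin (N + 1))) :
      polyOfTensor (m - 1) (n + 1) U
        ((∑ k ∈ t, vecPresheafMap (scalars N) (mulX N n k) (dY N m k)).app U (s ⊗ₜ P)) =
      ∑ k ∈ t, polyOf ((mulX N n k).app U s) (dY N m k P) := by
    classical
    induction t using Finset.induction_on with
    | empty => rfl
    | insert k t hk ih =>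
      rw [Finset.sum_insert hk, Finset.sum_insert hk, ← ih]
      exact map_add (polyOfTensor (m - 1) (n + 1) U) _ _
  exact h _

theorem deltaPresheaf_polyOfTensorHom (m : ℕ) (n : ℤ) :
    deltaPresheaf N m n ≫ polyOfTensorHom (m - 1) (n + 1) =
      polyOfTensorHom m n ≫ (polyDelta N m n).val := by
  refine PresheafOfModules.hom_ext fun U => ModuleCat.hom_ext (LinearMap.ext fun a => ?_)
  change (polyOfTensorHom (m - 1) (n + 1)).app U ((deltaPresheaf N m n).app U a) =
    (polyDelta N m n).val.app U ((polyOfTensorHom m n).app U a)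
  let L1 := ((deltaPresheaf N m n ≫ polyOfTensorHom (m - 1) (n + 1)).app U).hom
  let L2 := ((polyOfTensorHom m n ≫ (polyDelta N m n).val).app U).hom
  induction a using TensorProduct.induction_on with
  | zero => exact (map_zero L1).trans (map_zero L2).symm
  | add a b ha hb => exact (map_add L1 a b).trans ((congrArg₂ _ ha hb).trans (map_add L2 a b).symm)
  | tmul s P =>
    refine (deltaPresheaf_tmul m n U s P).trans (Subtype.ext (funext fun x => ?_))
    refine (map_sum (polyEval x) _ _).trans ?_
    change ∑ k, MvPolynomial.C (germX x.1 k * s.1 x) * MvPolynomial.map _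
      (MvPolynomial.pderiv k P.1) = dirDeriv (germX x.1) (MvPolynomial.C (s.1 x) *
        MvPolynomial.map _ P.1)
    rw [← MvPolynomial.smul_eq_C_mul, Derivation.map_smul, dirDeriv_apply, Finset.smul_sum]
    refine Finset.sum_congr rfl fun k _ => ?_
    rw [MvPolynomial.pderiv_map, MvPolynomial.smul_eq_C_mul, map_mul]
    ring

theorem delta_polyTwistHom (m : ℕ) (n : ℤ) :
    delta N m n ≫ polyTwistHom (m - 1) (n + 1) = polyTwistHom m n ≫ polyDelta N m n := by
  refine assocSheaf_hom_ext ?_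
  have h1 : toAssoc _ ≫ (polyTwistHom m n).val = polyOfTensorHom (N := N) m n :=
    toAssoc_assocDesc (F := polySheaf (homogQ m) n) _
  have h2 : toAssoc _ ≫ (polyTwistHom (m - 1) (n + 1)).val =
    polyOfTensorHom (N := N) (m - 1) (n + 1) :=
    toAssoc_assocDesc (F := polySheaf (homogQ (m - 1)) (n + 1)) _
  refine (congrArg (· ≫ (polyTwistHom (m - 1) (n + 1)).val)
    (toAssoc_naturality (deltaPresheaf N m n))).trans ?_
  refine Eq.trans ?_ (congrArg (· ≫ (polyDelta N m n).val) h1.symm)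
  refine Eq.trans ?_ (deltaPresheaf_polyOfTensorHom m n)
  exact congrArg (deltaPresheaf N m n ≫ ·) h2

end PolynomialSheaves

/-! ### The open sets `X_i ≠ 0` -/

section StandardOpens
variable {N : ℕ}

/-- The open set `X_i ≠ 0`. -/
def basicOpenX (i : Fin (N + 1)) : Opens (ProjectiveSpectrum.top (Homog N)) :=
  ProjectiveSpectrum.basicOpen (Homog N) (MvPolynomial.X i)

theorem exists_mem_basicOpenX (x : PN N) : ∃ i, x ∈ basicOpenX i := by
  obtain ⟨d, b, hd, hb, hbx⟩ := exists_notMem x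
  by_contra! h
  refine hbx (Ideal.span_le.2 ?_ (MvPolynomial.mem_ideal_span_X_image (s := Set.univ).2
    fun t ht => ?_))
  · rintro _ ⟨i, _, rfl⟩
    by_contra hi
    exact h i hi
  · have h1 := hb.degree_eq_sum_deg_support ht
    by_contra! h2
    have h3 : t = 0 := Finsupp.ext fun i => h2 i (Set.mem_univ i)
    rw [h3] at h1
    simp at h1
    omega

/-- The germ of `X_i` at a point of the open set `X_i ≠ 0`, as a unit. -/
def unitX (i : Fin (N + 1)) (x : ProjectiveSpectrum (Homog N)) (h : x ∈ basicOpenX i) :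
    (Loc N x)ˣ :=
  (IsLocalization.map_units (Loc N x)
    (⟨MvPolynomial.X i, h⟩ : x.asHomogeneousIdeal.toIdeal.primeCompl)).unit

theorem val_unitX (i : Fin (N + 1)) (x : ProjectiveSpectrum (Homog N)) (h : x ∈ basicOpenX i) :
    (unitX i x h : Loc N x) = germX x i := rfl

theorem unitX_zpow_natCast (i : Fin (N + 1)) (x : ProjectiveSpectrum (Homog N))
    (h : x ∈ basicOpenX i) (j : ℕ) : ((unitX i x h ^ (j : ℤ) : (Loc N x)ˣ) : Loc N x) *
      algebraMap (Poly N) (Loc N x) 1 = algebraMap (Poly N) (Loc N x) (MvPolynomial.X i ^ j) := by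
  rw [zpow_natCast, Units.val_pow_eq_pow_val, val_unitX, map_one, mul_one, map_pow, germX]

theorem unitX_zpow_neg_natCast (i : Fin (N + 1)) (x : ProjectiveSpectrum (Homog N))
    (h : x ∈ basicOpenX i) (j : ℕ) : ((unitX i x h ^ (-j : ℤ) : (Loc N x)ˣ) : Loc N x) *
      algebraMap (Poly N) (Loc N x) (MvPolynomial.X i ^ j) = algebraMap (Poly N) (Loc N x) 1 := by
  rw [← unitX_zpow_natCast i x h, map_one, mul_one, zpow_neg, Units.inv_mul]

theorem isLocallyTwistFraction_unitX {U : Opens (ProjectiveSpectrum.top (Homog N))}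
    {i : Fin (N + 1)} (hU : U ≤ basicOpenX i)
    (k : ℤ) : (isLocallyTwistFraction k).pred
      fun x : U => ((unitX i x.1 (hU x.2) ^ k : (Loc N x.1)ˣ) : Loc N x.1) := by
  have hX (j : ℕ) : (MvPolynomial.X i : Poly N) ^ j ∈ Homog N j :=
    MvPolynomial.isHomogeneous_X_pow i j
  have h1 : (1 : Poly N) ∈ Homog N 0 := MvPolynomial.isHomogeneous_one _ _
  obtain ⟨j, rfl | rfl⟩ := k.eq_nat_or_neg
  · exact isLocallyTwistFraction_of_fraction (hX j) h1 (by simp)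
      (fun x h => x.1.isPrime.one_notMem h) fun x => unitX_zpow_natCast i x.1 (hU x.2) j
  · exact isLocallyTwistFraction_of_fraction h1 (hX j) (by simp)
      (fun x h => hU x.2 (x.1.isPrime.mem_of_pow_mem _ h))
      fun x => unitX_zpow_neg_natCast i x.1 (hU x.2) j

theorem secVal_injective {U : (PN N).Opensᵒᵖ} : Function.Injective (secVal (N := N) (U := U)) :=
  fun _ _ h => Subtype.ext (funext fun x =>
    HomogeneousLocalization.val_injective _ (congrFun h x))

/-- The stalk of the structure sheaf at `x`: fractions of degree `0`. -/
abbrev LocDegZero (x : ProjectiveSpectrum (Homog N)) : Type :=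
  HomogeneousLocalization.AtPrime (Homog N) x.asHomogeneousIdeal.toIdeal

theorem exists_val_eq_mk (x : ProjectiveSpectrum (Homog N)) {i : ℕ} {a b : Poly N}
    (ha : a ∈ Homog N i) (hb : b ∈ Homog N i) (hx : b ∉ x.asHomogeneousIdeal.toIdeal) :
    ∃ q : LocDegZero x, HomogeneousLocalization.val q = Localization.mk a ⟨b, hx⟩ :=
  ⟨.mk ⟨i, ⟨a, ha⟩, ⟨b, hb⟩, hx⟩, rfl⟩

/-- Sections of `O(0)` are sections of the structure sheaf. -/
theorem exists_secVal_eq {U : (PN N).Opensᵒᵖ} {f : ∀ x : U.unop, Loc N x.1}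
    (hf : (isLocallyTwistFraction 0).pred f) : ∃ q : (PN N).presheaf.obj U, secVal q = f := by
  have h (x : U.unop) : ∃ q : LocDegZero x.1, HomogeneousLocalization.val q = f x := by
    obtain ⟨V, hV, iV, i, j, a, b, ha, hb, hij, hbV, hfV⟩ := hf x
    obtain rfl : i = j := by omega
    obtain ⟨q, hq⟩ := exists_val_eq_mk x.1 ha hb (hbV ⟨x.1, hV⟩)
    exact ⟨q, hq.trans (hfV ⟨x.1, hV⟩).symm⟩
  choose q hq using h
  refine ⟨⟨q, fun x => ?_⟩, funext hq⟩
  obtain ⟨V, hV, iV, i, j, a, b, ha, hb, hij, hbV, hfV⟩ := hf x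
  obtain rfl : i = j := by omega
  refine ⟨V, hV, iV, i, ⟨a, ha⟩, ⟨b, hb⟩, fun y => hbV y, fun y => ?_⟩
  exact HomogeneousLocalization.val_injective _ ((hq _).trans (hfV y))

end StandardOpens

/-! ### Surjectivity of `δ` -/

section Surjectivity
variable {N : ℕ}

theorem HasTwistCoeffs.pow {n : ℤ} {U : Opens (ProjectiveSpectrum.top (Homog N))}
    {f : ∀ x : U, LocPoly x.1}
    (hf : HasTwistCoeffs n f) (j : ℕ) : HasTwistCoeffs (j * n) (f ^ j) := by
  induction j with
  | zero => simpa using! HasTwistCoeffs.map (U := U) 1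
  | succ j ih =>
    have h := ih.mul hf
    rw [pow_succ, Nat.cast_succ, add_mul, one_mul]
    exact h

theorem HasTwistCoeffs.constant_mul {n : ℤ} {U : Opens (ProjectiveSpectrum.top (Homog N))}
    {f : ∀ x : U, LocPoly x.1}
    (hf : HasTwistCoeffs n f) (c : ℂ) :
    HasTwistCoeffs n fun x : U =>
      (MvPolynomial.C (algebraMap (Poly N) (Loc N x.1) (MvPolynomial.C c)) * f x :
        LocPoly x.1) := by
  simpa using! (HasTwistCoeffs.C (isLocallyTwistFraction_constant c)).mul hf

theorem HasTwistCoeffs.sub {n : ℤ} {U : Opens (ProjectiveSpectrum.top (Homog N))}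
    {f g : ∀ x : U, LocPoly x.1} (hf : HasTwistCoeffs n f) (hg : HasTwistCoeffs n g) :
    HasTwistCoeffs n fun x => f x - g x := by
  have h := hf.add (hg.constant_mul (-1))
  have e (x : ProjectiveSpectrum (Homog N)) (f g : LocPoly x) :
      f - g = f + MvPolynomial.C (algebraMap (Poly N) (Loc N x) (MvPolynomial.C (-1))) * g := by
    rw [map_neg, map_neg, map_neg, map_one, map_one, map_one]
    ring
  exact (funext fun x : U => e x.1 (f x) (g x)).symm ▸ h

/-- The polynomial `Y_i / X_i`, on which `∑ k, X k • ∂/∂Y k` takes the value `1`. -/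
def slice (i : Fin (N + 1)) (x : ProjectiveSpectrum (Homog N)) (h : x ∈ basicOpenX i) : LocPoly x :=
  MvPolynomial.C ((unitX i x h ^ (-1 : ℤ) : (Loc N x)ˣ) : Loc N x) * MvPolynomial.X i

theorem dirDeriv_slice (i : Fin (N + 1)) (x : ProjectiveSpectrum (Homog N))
    (h : x ∈ basicOpenX i) : dirDeriv (germX x) (slice i x h) = 1 := by
  rw [slice, ← MvPolynomial.smul_eq_C_mul, Derivation.map_smul, dirDeriv_X,
    MvPolynomial.smul_eq_C_mul, ← map_mul, ← val_unitX i x h, zpow_neg_one, Units.inv_mul, map_one]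

theorem isHomogeneous_slice (i : Fin (N + 1)) (x : ProjectiveSpectrum (Homog N))
    (h : x ∈ basicOpenX i) : (slice i x h).IsHomogeneous 1 :=
  (MvPolynomial.isHomogeneous_X _ i).C_mul _

theorem hasTwistCoeffs_slice {U : Opens (ProjectiveSpectrum.top (Homog N))}
    {i : Fin (N + 1)} (hU : U ≤ basicOpenX i) :
    HasTwistCoeffs (-1) fun x : U => slice i x.1 (hU x.2) := by
  have h := (HasTwistCoeffs.C (isLocallyTwistFraction_unitX hU (-1))).mul
    (HasTwistCoeffs.X (U := U) i)
  rwa [add_zero] at h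

/-- As `δ = ∑ k, X k • ∂/∂Y k` takes the value `1` on `y = Y_i / X_i`, the polynomial
`y ^ (j + 1) / (j + 1) * g` solves the equation `δ f = y ^ j * g` up to a term involving `δ g`. -/
theorem dirDeriv_slice_pow_mul {i : Fin (N + 1)} {x : ProjectiveSpectrum (Homog N)}
    (h : x ∈ basicOpenX i) (j : ℕ) (g : LocPoly x) :
    dirDeriv (germX x) (MvPolynomial.C (algebraMap (Poly N) (Loc N x)
      (MvPolynomial.C ((j + 1 : ℂ)⁻¹))) * (slice i x h ^ (j + 1) * g)) =
      slice i x h ^ j * g + slice i x h ^ (j + 1) * (MvPolynomial.C (algebraMap (Poly N) (Loc N x)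
        (MvPolynomial.C ((j + 1 : ℂ)⁻¹))) * dirDeriv (germX x) g) := by
  have h1 : (MvPolynomial.C (algebraMap (Poly N) (Loc N x) (MvPolynomial.C ((j + 1 : ℂ)⁻¹))) *
      (j + 1 : LocPoly x)) = 1 := by
    have h2 : (j + 1 : LocPoly x) =
        MvPolynomial.C (algebraMap (Poly N) (Loc N x) (MvPolynomial.C (j + 1 : ℂ))) := by simp
    rw [h2, ← map_mul, ← map_mul, ← map_mul, inv_mul_cancel₀ (by exact_mod_cast j.succ_ne_zero),
      map_one, map_one, map_one]
  rw [← MvPolynomial.smul_eq_C_mul, Derivation.map_smul, Derivation.leibniz,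
    Derivation.leibniz_pow, dirDeriv_slice, MvPolynomial.smul_eq_C_mul]
  simp only [smul_eq_mul, nsmul_eq_mul, mul_one, Nat.add_sub_cancel]
  push_cast
  linear_combination (slice i x h ^ j * g) * h1

/-- The equation `δ f = y ^ j * g` has a solution: after one integration by parts the remaining
right hand side involves `δ g`, which has smaller degree. The exponent `j` is needed for the
induction. -/
theorem exists_dirDeriv_eq {U : Opens (ProjectiveSpectrum.top (Homog N))}
    {i : Fin (N + 1)} (hU : U ≤ basicOpenX i) (d : ℕ) :
    ∀ (j : ℕ) (n : ℤ) (g : ∀ x : U, LocPoly x.1), (∀ x, (g x).IsHomogeneous d) →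
      HasTwistCoeffs n g → ∃ f : ∀ x : U, LocPoly x.1, (∀ x, (f x).IsHomogeneous (d + j + 1)) ∧
        HasTwistCoeffs (n - j - 1) f ∧
        ∀ x, dirDeriv (germX x.1) (f x) = slice i x.1 (hU x.2) ^ j * g x := by
  have hdeg (d j : ℕ) (g : ∀ x : U, LocPoly x.1) (hg : ∀ x, (g x).IsHomogeneous d) (c : ℂ) (x : U) :
      (MvPolynomial.C (algebraMap (Poly N) (Loc N x.1) (MvPolynomial.C c)) *
        (slice i x.1 (hU x.2) ^ (j + 1) * g x)).IsHomogeneous (d + j + 1) := by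
    have h := (((isHomogeneous_slice i x.1 (hU x.2)).pow (j + 1)).mul (hg x)).C_mul
      (algebraMap (Poly N) (Loc N x.1) (MvPolynomial.C c))
    convert h using 1
    ring
  have hcoe (j : ℕ) (n : ℤ) (g : ∀ x : U, LocPoly x.1) (hn : HasTwistCoeffs n g) (c : ℂ) :
      HasTwistCoeffs (n - j - 1) fun x : U =>
        MvPolynomial.C (algebraMap (Poly N) (Loc N x.1) (MvPolynomial.C c)) *
          (slice i x.1 (hU x.2) ^ (j + 1) * g x) := by
    have h := (((hasTwistCoeffs_slice hU).pow (j + 1)).mul hn).constant_mul c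
    have e : ((j + 1 : ℕ) : ℤ) * (-1) + n = n - j - 1 := by
      push_cast
      ring
    rwa [e] at h
  induction d with
  | zero =>
    intro j n g hg hn
    refine ⟨_, hdeg 0 j g hg _, hcoe j n g hn _, fun x => (dirDeriv_slice_pow_mul _ j _).trans ?_⟩
    rw [dirDeriv_eq_zero_of_isHomogeneous_zero _ (hg x), mul_zero, mul_zero, add_zero]
  | succ d ih =>
    intro j n g hg hn
    obtain ⟨f, hf1, hf2, hf⟩ := ih (j + 1) (n + 1) _
      (fun x => (isHomogeneous_dirDeriv _ (hg x)).C_mul _) (hn.dirDeriv.constant_mul (j + 1 : ℂ)⁻¹)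
    refine ⟨_, fun x => (hdeg _ j g hg (j + 1 : ℂ)⁻¹ x).sub ?_,
      (hcoe j n g hn (j + 1 : ℂ)⁻¹).sub ?_, fun x => ((dirDeriv _).map_sub _ (f x)).trans ?_⟩
    · have h := hf1 x
      rwa [show d + (j + 1) + 1 = d + 1 + j + 1 by ring] at h
    · convert hf2 using 1
      push_cast
      ring
    · exact sub_eq_of_eq_add ((dirDeriv_slice_pow_mul _ j _).trans (congrArg _ (hf x).symm))

theorem shortExact_kerIncl_polyDelta {m : ℕ} (hm : 1 ≤ m) (n : ℤ) :
    (ShortComplex.mk (kerIncl N m n) (polyDelta N m n) (kerIncl_polyDelta N m n)).ShortExact := by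
  refine shortExact_of_sections _ _ _ (fun U f g h => ?_) (fun U f hf => ?_) fun U g x hx => ?_
  · exact Subtype.ext (congrArg (fun f : polySections (homogQ m) n (op U) => f.1) h)
  · exact ⟨⟨f.1, fun x => ⟨f.2.1 x, congrFun (congrArg
      (fun f : polySections (homogQ (m - 1)) (n + 1) (op U) => f.1) hf) x⟩, f.2.2⟩, rfl⟩
  · obtain ⟨i, hi⟩ := exists_mem_basicOpenX x
    let V : (PN N).Opens := U ⊓ basicOpenX i
    let j : V ⟶ U := homOfLE inf_le_left
    let g' : polySections (homogQ (m - 1)) (n + 1) (op V) := polyRes _ _ j.op g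
    obtain ⟨f, hf1, hf2, hf⟩ := exists_dirDeriv_eq (U := V) inf_le_right (m - 1) 0 (n + 1) g'.1
      g'.2.1 g'.2.2
    refine ⟨V, j, ⟨hx, hi⟩, (⟨f, fun x => ?_, by simpa using hf2⟩ :
      polySections (homogQ m) n (op V)), Subtype.ext (funext fun x => ?_)⟩
    · have h := hf1 x
      rwa [add_zero, Nat.sub_add_cancel hm] at h
    · exact (hf x).trans (by rw [pow_zero, one_mul]; rfl)

end Surjectivity

/-! ### Polynomials modulo one variable -/

section Coefficients
variable {σ L : Type*} [Fintype σ] [CommRing L]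

/-- Modulo the variable `X i`, the linear forms `b * X j - c j * X i` are monomials. -/
theorem coeff_C_mul_prod_sub_pow (a b : L) (c : σ → L) (i : σ) (s t : σ →₀ ℕ) (ht : t i = 0)
    [Decidable (s = t)] : (MvPolynomial.C a * ∏ j, (MvPolynomial.C b * MvPolynomial.X j -
        MvPolynomial.C (c j) * MvPolynomial.X i) ^ s j).coeff t =
      if s = t then a * b ^ s.degree else 0 := by
  classical
  set J : Ideal (MvPolynomial σ L) := Ideal.span (MvPolynomial.X '' {i}) with hJ
  have h1 (j : σ) : Ideal.Quotient.mk J (MvPolynomial.C b * MvPolynomial.X j -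
        MvPolynomial.C (c j) * MvPolynomial.X i) =
      Ideal.Quotient.mk J (MvPolynomial.C b * MvPolynomial.X j) := by
    rw [Ideal.Quotient.eq, sub_sub_cancel_left]
    exact neg_mem (Ideal.mul_mem_left _ _ (Ideal.subset_span ⟨i, rfl, rfl⟩))
  have e : MvPolynomial.monomial s (a * b ^ s.degree) =
      MvPolynomial.C a * ∏ j, (MvPolynomial.C b * MvPolynomial.X j) ^ s j := by
    rw [MvPolynomial.monomial_eq, Finsupp.prod_fintype _ _ (fun _ => pow_zero _)]
    simp only [mul_pow, Finset.prod_mul_distrib, Finset.prod_pow_eq_pow_sum,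
      ← Finsupp.degree_eq_sum, MvPolynomial.C_mul, MvPolynomial.C_pow, mul_assoc]
  have h2 := congrArg (Ideal.Quotient.mk J) e
  rw [map_mul (Ideal.Quotient.mk J), map_prod] at h2
  simp only [map_pow, ← h1] at h2
  simp only [← map_pow, ← map_prod, ← map_mul] at h2
  rw [Ideal.Quotient.eq, hJ, MvPolynomial.mem_ideal_span_X_image] at h2
  refine Eq.trans ?_ ((MvPolynomial.coeff_monomial t s (a * b ^ s.degree)).trans (by congr))
  by_contra hne
  obtain ⟨j, rfl, hj⟩ := h2 t (by
    rw [MvPolynomial.mem_support_iff, MvPolynomial.coeff_sub]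
    exact sub_ne_zero.2 (Ne.symm hne))
  exact hj ht

theorem eq_of_coeff_eq_of_mem {σ L : Type*} [CommRing L] (P : Submodule L (MvPolynomial σ L))
    {I : Finset (σ →₀ ℕ)} (h0 : ∀ f ∈ P, (∀ t ∈ I, f.coeff t = 0) → f = 0) {f g : MvPolynomial σ L}
    (hf : f ∈ P) (hg : g ∈ P) (h : ∀ t ∈ I, f.coeff t = g.coeff t) : f = g :=
  sub_eq_zero.1 (h0 _ (P.sub_mem hf hg) fun t ht => by
    rw [MvPolynomial.coeff_sub, h t ht, sub_self])

end Coefficients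

/-! ### Local freeness of sheaves of polynomials -/

section Frames
variable {N : ℕ}

/-- The powers of `X_i`, with exponents in `ℤ`, at a point of the open set `X_i ≠ 0`. -/
def powX (i : Fin (N + 1)) (k : ℤ) (x : ProjectiveSpectrum (Homog N)) (h : x ∈ basicOpenX i) :
    Loc N x :=
  ((unitX i x h ^ k : (Loc N x)ˣ) : Loc N x)

section
variable (i : Fin (N + 1)) {x : ProjectiveSpectrum (Homog N)} (h : x ∈ basicOpenX i)

theorem powX_mul_powX (k l : ℤ) : powX i k x h * powX i l x h = powX i (k + l) x h := by
  rw [powX, powX, powX, zpow_add, Units.val_mul]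

theorem powX_zero : powX i 0 x h = 1 := by
  rw [powX, zpow_zero, Units.val_one]

theorem powX_one : powX i 1 x h = germX x i := by
  rw [powX, zpow_one, val_unitX]

theorem powX_pow (k : ℤ) (j : ℕ) : powX i k x h ^ j = powX i (k * j) x h := by
  rw [powX, powX, ← Units.val_pow_eq_pow_val, zpow_mul, zpow_natCast]

end

variable {Q : ∀ x : ProjectiveSpectrum (Homog N), Submodule (Loc N x) (LocPoly x)} {n : ℤ}
  {i : Fin (N + 1)} {I : Finset (Fin (N + 1) →₀ ℕ)}

/-- Sections `e s` on `X_i ≠ 0`, indexed by a finite set `I` of monomials, such that the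
coefficients at `I` determine the polynomials in `Q` and such that `e s` has only one nonzero
coefficient at `I`, namely `X_i ^ n` at `s`. -/
structure IsFrame (e : I → polySections Q n (op (basicOpenX i))) : Prop where
  coeff_eq (s t : I) (x : basicOpenX (N := N) i) :
    ((e s).1 x).coeff t.1 = if s = t then powX i n x.1 x.2 else 0
  eq_zero (x : ProjectiveSpectrum (Homog N)) (hx : x ∈ basicOpenX i) (f : LocPoly x) (hf : f ∈ Q x)
    (h : ∀ t ∈ I, f.coeff t = 0) : f = 0

variable {e : I → polySections Q n (op (basicOpenX i))} {V : (PN N).Opens}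

theorem polyEval_smul (q : (PN N).presheaf.obj (op V)) (f : polySections Q n (op V)) (x : V) :
    polyEval (U := op V) x (q • f) =
      MvPolynomial.C (secVal (U := op V) q x) * polyEval (U := op V) x f := rfl

theorem IsFrame.eq_of_coeff_eq (he : IsFrame e) {x : ProjectiveSpectrum (Homog N)}
    (hx : x ∈ basicOpenX i) {f g : LocPoly x} (hf : f ∈ Q x) (hg : g ∈ Q x)
    (h : ∀ t ∈ I, f.coeff t = g.coeff t) : f = g :=
  eq_of_coeff_eq_of_mem (Q x) (he.eq_zero x hx) hf hg h

theorem powX_neg_mul_mul_powX {x : ProjectiveSpectrum (Homog N)} (hx : x ∈ basicOpenX i) (n : ℤ)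
    (a : Loc N x) : powX i (-n) x hx * a * powX i n x hx = a := by
  rw [mul_right_comm, powX_mul_powX, neg_add_cancel, powX_zero, one_mul]

theorem IsFrame.coeff_sum (he : IsFrame e) (j : V ⟶ basicOpenX i)
    (q : I → (PN N).presheaf.obj (op V)) (t : I) (x : V) :
    (polyEval (U := op V) x (∑ s, q s • polyRes Q n j.op (e s))).coeff t.1 =
      secVal (U := op V) (q t) x * powX i n x.1 (j.le x.2) := by
  rw [map_sum, MvPolynomial.coeff_sum, Finset.sum_eq_single t]
  · rw [polyEval_smul, MvPolynomial.coeff_C_mul]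
    refine congrArg (_ * ·) ((he.coeff_eq t t ⟨x.1, j.le x.2⟩).trans (if_pos rfl))
  · intro s _ hs
    rw [polyEval_smul, MvPolynomial.coeff_C_mul]
    exact (congrArg (_ * ·) ((he.coeff_eq s t ⟨x.1, j.le x.2⟩).trans (if_neg hs))).trans
      (mul_zero _)
  · simp

theorem IsFrame.linearIndependent (he : IsFrame e) (j : V ⟶ basicOpenX i) :
    LinearIndependent ((PN N).presheaf.obj (op V)) fun s => polyRes Q n j.op (e s) := by
  refine Fintype.linearIndependent_iff.2 fun q hq t => ?_
  refine secVal_injective (funext fun x => ?_)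
  have h := he.coeff_sum j q t x
  rw [hq, map_zero, MvPolynomial.coeff_zero] at h
  exact ((Units.mul_left_eq_zero _).1 h.symm).trans (congrFun (map_zero (secValHom (op V))) x).symm

theorem IsFrame.exists_eq_sum (he : IsFrame e) (j : V ⟶ basicOpenX i)
    (f : polySections Q n (op V)) : ∃ q : I → (PN N).presheaf.obj (op V),
      f = ∑ s, q s • polyRes Q n j.op (e s) := by
  have h (t : I) : ∃ q : (PN N).presheaf.obj (op V), secVal (U := op V) q =
      (fun x : V => powX i (-n) x.1 (j.le x.2)) * fun x : V => (f.1 x).coeff t.1 := by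
    refine exists_secVal_eq (U := op V) ?_
    have h1 := isLocallyTwistFraction_mul (isLocallyTwistFraction_unitX j.le (-n)) (f.2.2 t.1)
    rwa [neg_add_cancel] at h1
  choose q hq using h
  refine ⟨q, Subtype.ext (funext fun x => he.eq_of_coeff_eq (j.le x.2) (f.2.1 x)
    ((∑ s, q s • polyRes Q n j.op (e s)).2.1 x) fun t ht => ?_)⟩
  refine Eq.symm ((he.coeff_sum j q ⟨t, ht⟩ x).trans ?_)
  exact (congrArg (· * _) (congrFun (hq ⟨t, ht⟩) x)).trans (powX_neg_mul_mul_powX (j.le x.2) n _)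

theorem IsFrame.top_le_span (he : IsFrame e) (j : V ⟶ basicOpenX i) :
    ⊤ ≤ Submodule.span ((PN N).presheaf.obj (op V))
      (Set.range fun s => polyRes Q n j.op (e s)) := by
  rintro f -
  obtain ⟨q, rfl⟩ := he.exists_eq_sum j f
  exact sum_mem fun s _ => Submodule.smul_mem _ _ (Submodule.subset_span ⟨s, rfl⟩)

theorem IsVectorBundle.of_frames {I : Fin (N + 1) → Finset (Fin (N + 1) →₀ ℕ)}
    {e : ∀ i, I i → polySections Q n (op (basicOpenX i))} (he : ∀ i, IsFrame (e i)) :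
    IsVectorBundle (polySheaf Q n) := fun x => by
  obtain ⟨i, hi⟩ := exists_mem_basicOpenX x
  refine ⟨basicOpenX i, hi, (I i).card, exists_iso_free (polySheaf Q n) (basicOpenX i)
    (fun s => e i ((I i).equivFin.symm s)) (fun V j => ?_) fun V j => ?_⟩
  · exact ((he i).linearIndependent j).comp _ (I i).equivFin.symm.injective
  · refine ((he i).top_le_span j).trans (le_of_eq (congrArg _ ?_))
    exact ((I i).equivFin.symm.surjective.range_comp fun s => polyRes Q n j.op (e i s)).symm

end Frames

/-! ### A frame of the sheaf of homogeneous polynomials -/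

section HomogeneousFrame
variable {N : ℕ}

/-- The section `X_i ^ n * Y ^ s`. -/
def monomSec (i : Fin (N + 1)) (m : ℕ) (n : ℤ) (s : monoms N m) :
    polySections (N := N) (homogQ m) n (op (basicOpenX i)) :=
  ⟨fun x => MvPolynomial.C (powX i n x.1 x.2) * MvPolynomial.map
      ((algebraMap (Poly N) (Loc N x.1)).comp MvPolynomial.C) (MvPolynomial.monomial s.1 1),
    fun _ => (MvPolynomial.IsHomogeneous.map
      (MvPolynomial.isHomogeneous_monomial _ (mem_monoms.1 s.2)) _).C_mul _,
    by
      simpa using! (HasTwistCoeffs.C (isLocallyTwistFraction_unitX le_rfl n)).mul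
        (HasTwistCoeffs.map (MvPolynomial.monomial s.1 1))⟩

theorem isFrame_monomSec (i : Fin (N + 1)) (m : ℕ) (n : ℤ) : IsFrame (monomSec i m n) where
  coeff_eq s t x := by
    classical
    refine (MvPolynomial.coeff_C_mul _ _ _).trans ?_
    rw [MvPolynomial.coeff_map, MvPolynomial.coeff_monomial]
    by_cases h : s = t
    · subst h
      simp
    · rw [if_neg h, if_neg fun h' => h (Subtype.ext h'), map_zero, mul_zero]
  eq_zero x hx f hf h := by
    rw [← sum_monoms hf]
    exact Finset.sum_eq_zero fun t ht => by rw [h t ht, map_zero]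

theorem isVectorBundle_homogQ (m : ℕ) (n : ℤ) :
    IsVectorBundle (polySheaf (N := N) (homogQ m) n) :=
  .of_frames fun i => isFrame_monomSec i m n

end HomogeneousFrame

/-! ### A frame of the kernel of `δ` -/

section KernelFrame
variable {N : ℕ}

/-- The linear form `d (X_j / X_i)`, with `Y_k` for `d X_k`. -/
def diffForm (i : Fin (N + 1)) (j : Fin (N + 1)) (x : ProjectiveSpectrum (Homog N))
    (h : x ∈ basicOpenX i) : LocPoly x :=
  MvPolynomial.C (powX i (-1) x h) * MvPolynomial.X j -
    MvPolynomial.C (germX x j * powX i (-2) x h) * MvPolynomial.X i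

theorem diffForm_mem (i : Fin (N + 1)) (j : Fin (N + 1)) (x : ProjectiveSpectrum (Homog N))
    (h : x ∈ basicOpenX i) : diffForm i j x h ∈ kerQ 1 x := by
  refine ⟨((MvPolynomial.isHomogeneous_X _ j).C_mul _).sub
    ((MvPolynomial.isHomogeneous_X _ i).C_mul _), ?_⟩
  change dirDeriv (germX x) _ = 0
  rw [diffForm, map_sub, ← MvPolynomial.smul_eq_C_mul, ← MvPolynomial.smul_eq_C_mul,
    Derivation.map_smul, Derivation.map_smul, dirDeriv_X, dirDeriv_X, MvPolynomial.smul_eq_C_mul,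
    MvPolynomial.smul_eq_C_mul, ← map_mul, ← map_mul, mul_assoc, ← powX_one i h,
    powX_mul_powX, mul_comm (powX i (-1) x h)]
  exact sub_self _

theorem hasTwistCoeffs_diffForm (i j : Fin (N + 1)) :
    HasTwistCoeffs (-1) fun x : basicOpenX i => diffForm i j x.1 x.2 := by
  have h1 := (HasTwistCoeffs.C (isLocallyTwistFraction_unitX (le_refl (basicOpenX i)) (-1))).mul
    (HasTwistCoeffs.X j)
  have h2 := (HasTwistCoeffs.C (isLocallyTwistFraction_X (-2) j
    (isLocallyTwistFraction_unitX (le_refl (basicOpenX i)) (-2)))).mul (HasTwistCoeffs.X i)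
  rw [add_zero] at h1 h2
  exact h1.sub h2

theorem kerQ_mul {x : ProjectiveSpectrum (Homog N)} {a b : ℕ} {f g : LocPoly x}
    (hf : f ∈ kerQ a x) (hg : g ∈ kerQ b x) : f * g ∈ kerQ (a + b) x := by
  refine ⟨hf.1.mul hg.1, ?_⟩
  change dirDeriv (germX x) _ = 0
  rw [Derivation.leibniz, show dirDeriv (germX x) f = 0 from hf.2,
    show dirDeriv (germX x) g = 0 from hg.2, smul_zero, smul_zero, add_zero]

theorem kerQ_one (x : ProjectiveSpectrum (Homog N)) : 1 ∈ kerQ 0 x :=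
  ⟨MvPolynomial.isHomogeneous_one _ _, (dirDeriv (germX x)).map_one_eq_zero⟩

theorem kerQ_pow {x : ProjectiveSpectrum (Homog N)} {f : LocPoly x} (hf : f ∈ kerQ 1 x) (k : ℕ) :
    f ^ k ∈ kerQ k x := by
  induction k with
  | zero => simpa using kerQ_one x
  | succ k ih => exact pow_succ f k ▸ kerQ_mul ih hf

theorem kerQ_prod {x : ProjectiveSpectrum (Homog N)} {ι : Type*} (t : Finset ι) (a : ι → ℕ)
    (f : ι → LocPoly x) (h : ∀ j, f j ∈ kerQ (a j) x) :
    ∏ j ∈ t, f j ∈ kerQ (∑ j ∈ t, a j) x := by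
  classical
  induction t using Finset.induction_on with
  | empty => exact kerQ_one x
  | insert j t hj ih =>
    rw [Finset.prod_insert hj, Finset.sum_insert hj]
    exact kerQ_mul (h j) ih

theorem HasTwistCoeffs.prod {U : Opens (ProjectiveSpectrum.top (Homog N))} {ι : Type*}
    (t : Finset ι) (a : ι → ℤ) (f : ι → ∀ x : U, LocPoly x.1)
    (h : ∀ j, HasTwistCoeffs (a j) (f j)) :
    HasTwistCoeffs (∑ j ∈ t, a j) (∏ j ∈ t, f j) := by
  classical
  induction t using Finset.induction_on with
  | empty => simpa using! HasTwistCoeffs.map (U := U) 1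
  | insert j t hj ih =>
    rw [Finset.prod_insert hj, Finset.sum_insert hj]
    exact (h j).mul ih

/-- The product of the differentials `d (X_j / X_i)` with exponents `s j`, multiplied by a power
of `X_i`. -/
def diffMonom (i : Fin (N + 1)) (k : ℤ) (s : Fin (N + 1) →₀ ℕ)
    (x : ProjectiveSpectrum (Homog N)) (h : x ∈ basicOpenX i) : LocPoly x :=
  MvPolynomial.C (powX i k x h) * ∏ j, diffForm i j x h ^ s j

theorem diffMonom_mem (i : Fin (N + 1)) (k : ℤ) (s : Fin (N + 1) →₀ ℕ)
    (x : ProjectiveSpectrum (Homog N)) (h : x ∈ basicOpenX i) :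
    diffMonom i k s x h ∈ kerQ s.degree x := by
  have h1 := kerQ_prod Finset.univ s _ fun j => kerQ_pow (diffForm_mem i j x h) (s j)
  rw [← Finsupp.degree_eq_sum] at h1
  rw [diffMonom, ← MvPolynomial.smul_eq_C_mul]
  exact Submodule.smul_mem _ _ h1

theorem hasTwistCoeffs_diffMonom (i : Fin (N + 1)) (k : ℤ) (s : Fin (N + 1) →₀ ℕ) :
    HasTwistCoeffs (k - s.degree) fun x : basicOpenX i => diffMonom i k s x.1 x.2 := by
  have h1 := HasTwistCoeffs.prod (U := basicOpenX i) Finset.univ (fun j => (s j : ℤ) * (-1))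
    (fun j => (fun x : basicOpenX i => diffForm i j x.1 x.2) ^ s j)
    fun j => (hasTwistCoeffs_diffForm i j).pow (s j)
  have h := (HasTwistCoeffs.C (isLocallyTwistFraction_unitX (le_refl (basicOpenX i)) k)).mul h1
  rw [← Finset.sum_mul, ← Nat.cast_sum, ← Finsupp.degree_eq_sum, mul_neg_one,
    ← sub_eq_add_neg] at h
  have e : (fun x : basicOpenX i => diffMonom i k s x.1 x.2) =
      (fun x : basicOpenX i => MvPolynomial.C (powX i k x.1 x.2)) *
        ∏ j, (fun x : basicOpenX i => diffForm i j x.1 x.2) ^ s j := by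
    refine funext fun x => congrArg (MvPolynomial.C (powX i k x.1 x.2) * ·) ?_
    exact (Finset.prod_apply x Finset.univ
      fun j => (fun x : basicOpenX i => diffForm i j x.1 x.2) ^ s j).symm
  exact e ▸ h

/-- The products of `m` differentials `d (X_j / X_i)` with `X_i ^ (m + n)` as sections over
`X_i ≠ 0`. As the differentials have coefficients in `O(-1)`, the coefficients lie in `O(n)`. -/
def diffMonomSec (i : Fin (N + 1)) (m : ℕ) (n : ℤ) (s : Fin (N + 1) →₀ ℕ) (hs : s.degree = m) :
    polySections (N := N) (kerQ m) n (op (basicOpenX i)) :=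
  ⟨fun x => diffMonom i (m + n) s x.1 x.2, fun x => hs ▸ diffMonom_mem i _ s x.1 x.2, by
    have h := hasTwistCoeffs_diffMonom i (m + n) s
    rwa [hs, add_sub_cancel_left] at h⟩

/-- Up to terms involving `Y_i`, the differential `d (X_j / X_i)` is `X_i⁻¹ * Y_j`, so that a
product of differentials is a monomial. -/
theorem coeff_diffMonom (i : Fin (N + 1)) (k : ℤ) (s t : Fin (N + 1) →₀ ℕ) (ht : t i = 0)
    (x : ProjectiveSpectrum (Homog N)) (h : x ∈ basicOpenX i) :
    (diffMonom i k s x h).coeff t =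
      if s = t then powX i (k - s.degree) x h else 0 := by
  refine (coeff_C_mul_prod_sub_pow _ _ _ i s t ht).trans ?_
  rw [powX_pow, powX_mul_powX, neg_one_mul, ← sub_eq_add_neg]

/-- The monomials of degree `m` not involving the variable of index `i`. -/
def monomsAway (N m : ℕ) (i : Fin (N + 1)) : Finset (Fin (N + 1) →₀ ℕ) :=
  (monoms N m).filter fun s => s i = 0

/-- The products of `m` differentials `d (X_j / X_i)` for `j ≠ i` with `X_i ^ (m + n)`. -/
def kerFrame (i : Fin (N + 1)) (m : ℕ) (n : ℤ) (s : monomsAway N m i) :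
    polySections (N := N) (kerQ m) n (op (basicOpenX i)) :=
  diffMonomSec i m n s.1 (mem_monoms.1 (Finset.mem_filter.1 s.2).1)

theorem isFrame_kerFrame (i : Fin (N + 1)) (m : ℕ) (n : ℤ) : IsFrame (kerFrame i m n) where
  coeff_eq s t x := by
    refine (coeff_diffMonom i _ s.1 t.1 (Finset.mem_filter.1 t.2).2 x.1 x.2).trans ?_
    by_cases h : s = t
    · subst h
      rw [if_pos rfl, if_pos rfl, mem_monoms.1 (Finset.mem_filter.1 s.2).1, add_sub_cancel_left]
    · rw [if_neg h, if_neg fun h' => h (Subtype.ext h')]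
  eq_zero x hx f hf h := by
    refine eq_zero_of_dirDeriv_eq_zero (ξ := germX x) (unitX i x hx).isUnit hf.2 fun t ht => ?_
    by_cases h' : t.degree = m
    · exact h t (Finset.mem_filter.2 ⟨mem_monoms.2 h', ht⟩)
    · exact hf.1.coeff_eq_zero h'

theorem isVectorBundle_kerQ (m : ℕ) (n : ℤ) :
    IsVectorBundle (polySheaf (N := N) (kerQ m) n) :=
  .of_frames fun i => isFrame_kerFrame i m n

end KernelFrame

/-! ### Differentials as linear forms -/

section Differential
variable {N : ℕ}

/-- The total differential of germs, `f ↦ ∑ k, ∂f/∂X_k * Y_k`. -/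
def germDiff (x : ProjectiveSpectrum (Homog N)) : Derivation ℂ (Loc N x) (LocPoly x) :=
  totalDiff x.asHomogeneousIdeal.toIdeal.primeCompl

theorem eq_mk_iff_mul_eq {x : ProjectiveSpectrum (Homog N)} {f : Loc N x} {a b : Poly N}
    {hb : b ∉ x.asHomogeneousIdeal.toIdeal} : f = Localization.mk a ⟨b, hb⟩ ↔
      f * algebraMap (Poly N) (Loc N x) b = algebraMap (Poly N) (Loc N x) a := by
  rw [Localization.mk_eq_mk', IsLocalization.eq_mk'_iff_mul_eq]

/-- A section of the structure sheaf is locally a fraction of homogeneous polynomials of the same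
degree. -/
theorem exists_fraction_secVal {U : (PN N).Opens} (g : (PN N).presheaf.obj (op U)) (x : U) :
    ∃ (V : (PN N).Opens) (j : V ⟶ U) (d : ℕ) (a b : Poly N), x.1 ∈ V ∧ a ∈ Homog N d ∧
      b ∈ Homog N d ∧ (∀ y : V, b ∉ y.1.asHomogeneousIdeal.toIdeal) ∧
      ∀ y : V, secVal (U := op U) g (j y) * algebraMap (Poly N) (Loc N y.1) b =
        algebraMap (Poly N) (Loc N y.1) a := by
  obtain ⟨V, hV, j, d, p, q, hq, hs⟩ := g.2 x
  refine ⟨V, j, d, p.1, q.1, hV, p.2, q.2, hq, fun y => ?_⟩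
  exact eq_mk_iff_mul_eq.1 (congrArg HomogeneousLocalization.val (hs y))

section
variable {x : ProjectiveSpectrum (Homog N)} {d : ℕ} {a b : Poly N} {f : Loc N x}

theorem isUnit_algebraMap_of_notMem (hbx : b ∉ x.asHomogeneousIdeal.toIdeal) :
    IsUnit (algebraMap (Poly N) (Loc N x) b) :=
  IsLocalization.map_units (Loc N x) (⟨b, hbx⟩ : x.asHomogeneousIdeal.toIdeal.primeCompl)

theorem germDiff_mem (ha : a ∈ Homog N d) (hb : b ∈ Homog N d)
    (hbx : b ∉ x.asHomogeneousIdeal.toIdeal)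
    (h : f * algebraMap (Poly N) (Loc N x) b = algebraMap (Poly N) (Loc N x) a) :
    germDiff x f ∈ kerQ 1 x := by
  have hu := isUnit_algebraMap_of_notMem hbx
  refine ⟨?_, dirDeriv_totalDiff x.asHomogeneousIdeal.toIdeal.primeCompl ha hb h hu⟩
  have h1 := totalDiff_fraction x.asHomogeneousIdeal.toIdeal.primeCompl h
  obtain ⟨v, hv⟩ := hu.mul hu
  rw [← hv] at h1
  have h2 : germDiff x f = MvPolynomial.C (↑v⁻¹ : Loc N x) *
      (MvPolynomial.C (v : Loc N x) * germDiff x f) := by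
    rw [← mul_assoc, ← map_mul, Units.inv_mul, map_one, one_mul]
  rw [h2]
  refine MvPolynomial.IsHomogeneous.C_mul ?_ _
  rw [germDiff, h1]
  exact MvPolynomial.IsHomogeneous.sum _ _ _ fun k _ => (MvPolynomial.isHomogeneous_X _ k).C_mul _

theorem coeff_germDiff_mul
    (h : f * algebraMap (Poly N) (Loc N x) b = algebraMap (Poly N) (Loc N x) a)
    (t : Fin (N + 1) →₀ ℕ) :
    (germDiff x f).coeff t * algebraMap (Poly N) (Loc N x) (b * b) =
      algebraMap (Poly N) (Loc N x) (∑ k, MvPolynomial.C ((MvPolynomial.X k : Poly N).coeff t) *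
        (b * MvPolynomial.pderiv k a - a * MvPolynomial.pderiv k b)) := by
  have h1 := congrArg (MvPolynomial.coeff t)
    (totalDiff_fraction x.asHomogeneousIdeal.toIdeal.primeCompl h)
  rw [MvPolynomial.coeff_C_mul, MvPolynomial.coeff_sum] at h1
  rw [map_mul, mul_comm, map_sum]
  refine h1.trans (Finset.sum_congr rfl fun k _ => ?_)
  classical
  rw [MvPolynomial.coeff_C_mul, map_mul, MvPolynomial.coeff_X, MvPolynomial.coeff_X, mul_comm]
  split <;> simp

end

theorem pderiv_combination_mem {d : ℕ} {a b : Poly N} (ha : a ∈ Homog N (d + 1))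
    (hb : b ∈ Homog N (d + 1)) (t : Fin (N + 1) →₀ ℕ) :
    (∑ k, MvPolynomial.C ((MvPolynomial.X k : Poly N).coeff t) *
      (b * MvPolynomial.pderiv k a - a * MvPolynomial.pderiv k b)) ∈ Homog N (d + 1 + d) := by
  refine sum_mem fun k _ => MvPolynomial.IsHomogeneous.C_mul ?_ _
  exact (MvPolynomial.IsHomogeneous.mul hb (MvPolynomial.IsHomogeneous.pderiv ha)).sub
    (MvPolynomial.IsHomogeneous.mul ha (MvPolynomial.IsHomogeneous.pderiv hb))

theorem hasTwistCoeffs_germDiff {U : (PN N).Opens} (g : (PN N).presheaf.obj (op U)) :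
    HasTwistCoeffs (-1) fun x : U => germDiff x.1 (secVal (U := op U) g x) := by
  intro t
  refine (isLocallyTwistFraction (-1)).locality _ fun x => ?_
  obtain ⟨V, j, d, a, b, hx, ha, hb, hbV, h⟩ := exists_fraction_secVal g x
  refine ⟨V, hx, j, ?_⟩
  have hc (y : V) := coeff_germDiff_mul (h y) t
  cases d with
  | succ d =>
    exact isLocallyTwistFraction_of_fraction (pderiv_combination_mem ha hb t)
      (SetLike.mul_mem_graded hb hb) (by push_cast; ring)
      (fun y hy => (y.1.isPrime.mem_or_mem hy).elim (hbV y) (hbV y)) hc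
  | zero =>
    -- Fractions of polynomials of degree `0` are constant.
    have hp (k : Fin (N + 1)) {a : Poly N} (ha : a ∈ Homog N 0) : MvPolynomial.pderiv k a = 0 := by
      have ha' : a.IsHomogeneous 0 := ha
      rw [← MvPolynomial.totalDegree_zero_iff_isHomogeneous,
        MvPolynomial.totalDegree_eq_zero_iff_eq_C] at ha'
      rw [ha', MvPolynomial.pderiv_C]
    simp only [hp _ ha, hp _ hb, mul_zero, sub_zero, Finset.sum_const_zero, map_zero] at hc
    have h0 (y : V) : (germDiff y.1 (secVal (U := op U) g (j y))).coeff t = 0 := by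
      have hu := isUnit_algebraMap_of_notMem (hbV y)
      exact ((hu.mul hu).mul_left_eq_zero).1 ((congrArg (_ * ·) (map_mul _ b b).symm).trans (hc y))
    exact (funext h0).symm ▸ isLocallyTwistFraction_zero (-1) V

/-- The differential of a section of the structure sheaf. -/
def diffSec {U : (PN N).Opensᵒᵖ} (g : (PN N).presheaf.obj U) :
    polySections (N := N) (kerQ 1) (-1) U :=
  ⟨fun x => germDiff x.1 (secVal g x), fun x => by
    obtain ⟨V, j, d, a, b, hx, ha, hb, hbV, h⟩ := exists_fraction_secVal g x
    exact germDiff_mem ha hb (hbV ⟨x.1, hx⟩) (h ⟨x.1, hx⟩), hasTwistCoeffs_germDiff g⟩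

theorem diffSec_add {U : (PN N).Opensᵒᵖ} (g g' : (PN N).presheaf.obj U) :
    diffSec (g + g') = diffSec g + diffSec g' :=
  Subtype.ext (funext fun x => (congrArg (germDiff x.1)
    (congrFun (map_add (secValHom U) g g') x)).trans (map_add (germDiff x.1) _ _))

theorem diffSec_mul {U : (PN N).Opensᵒᵖ} (g g' : (PN N).presheaf.obj U) :
    diffSec (g * g') = g • diffSec g' + g' • diffSec g :=
  Subtype.ext (funext fun x => (congrArg (germDiff x.1)
    (congrFun (map_mul (secValHom U) g g') x)).trans
      (((germDiff x.1).leibniz _ _).trans (congrArg₂ (· + ·)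
        (MvPolynomial.smul_eq_C_mul _ _) (MvPolynomial.smul_eq_C_mul _ _))))

theorem diffSec_const {U : (PN N).Opensᵒᵖ} (c : ℂ) : diffSec (constSec U c) = 0 :=
  Subtype.ext (funext fun x => (congrArg (germDiff x.1) (constSec_val c x)).trans
    ((germDiff x.1).map_algebraMap c))

/-- The morphism `d g ↦ ∑ k, ∂g/∂X_k * Y_k` on the presheaf of Kähler differentials. -/
def kaehlerHom (N : ℕ) : PresheafOfModules.DifferentialsConstruction.relativeDifferentials'
    (scalars N) ⟶ polyPresheaf (kerQ 1) (-1) :=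
  (PresheafOfModules.DifferentialsConstruction.isUniversal' (scalars N)).desc
    (M' := polyPresheaf (kerQ 1) (-1))
    (PresheafOfModules.Derivation'.mk
      (fun U => ModuleCat.Derivation.mk (M := (polyPresheaf (kerQ 1) (-1)).obj U)
        (f := (scalars N).app U) (fun g => diffSec g) diffSec_add diffSec_mul diffSec_const)
      fun _ _ _ _ => rfl)

theorem kaehlerHom_d {U : (PN N).Opensᵒᵖ} (g : (PN N).presheaf.obj U) :
    (kaehlerHom N).app U (CommRingCat.KaehlerDifferential.d (f := (scalars N).app U) g) =
      diffSec g :=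
  ModuleCat.Derivation.desc_d _ g

/-- The morphism `d g ↦ ∑ k, ∂g/∂X_k * Y_k` on the cotangent sheaf. -/
def cotangentHom (N : ℕ) : cotangentSheaf (scalars N) ⟶ polySheaf (kerQ 1) (-1) :=
  assocDesc (F := polySheaf (kerQ 1) (-1)) (kaehlerHom N)

end Differential

/-! ### Symmetric powers -/

section SymmetricPowers
variable {N : ℕ}

/-- Restriction of families of polynomials. -/
def germsRes {U V : (PN N).Opensᵒᵖ} (f : U ⟶ V) : PolyGerms U →+* PolyGerms V where
  toFun s x := s (f.unop x)
  map_one' := rfl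
  map_mul' _ _ := rfl
  map_zero' := rfl
  map_add' _ _ := rfl

variable {P : PresheafOfModules.{0} ((PN N).presheaf ⋙ forget₂ CommRingCat RingCat)}
  (φ : P ⟶ polyPresheaf (kerQ 1) (-1))

/-- The extension of a morphism with values in linear forms to the symmetric algebra. -/
def symGerms (U : (PN N).Opensᵒᵖ) :
    SymmetricAlgebra ((PN N).presheaf.obj U) (P.obj U) →ₐ[(PN N).presheaf.obj U] PolyGerms U :=
  SymmetricAlgebra.lift ((polySections (kerQ 1) (-1) U).subtype ∘ₗ
    ((φ.app U).hom : P.obj U →ₗ[(PN N).presheaf.obj U] polySections (kerQ 1) (-1) U))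

theorem symGerms_ι (U : (PN N).Opensᵒᵖ) (a : P.obj U) :
    symGerms φ U (SymmetricAlgebra.ι _ _ a) =
      (show polySections (kerQ 1) (-1) U from φ.app U a).1 :=
  SymmetricAlgebra.lift_ι_apply _ a

theorem polySections_kerQ_mul {U : (PN N).Opensᵒᵖ} {a b : ℕ} {n k : ℤ} {f g : PolyGerms U}
    (hf : f ∈ polySections (kerQ a) n U) (hg : g ∈ polySections (kerQ b) k U) :
    f * g ∈ polySections (kerQ (a + b)) (n + k) U :=
  ⟨fun x => kerQ_mul (hf.1 x) (hg.1 x), hf.2.mul hg.2⟩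

/-- A product of `m` linear forms annihilated by `δ` with coefficients in `O(-1)` is a form of
degree `m` annihilated by `δ` with coefficients in `O(-m)`. -/
theorem symGerms_mem (U : (PN N).Opensᵒᵖ) (m : ℕ)
    {a : SymmetricAlgebra ((PN N).presheaf.obj U) (P.obj U)} (ha : a ∈ symPow _ _ m) :
    symGerms φ U a ∈ polySections (kerQ m) (-m) U := by
  have h0 : (1 : PolyGerms U) ∈ polySections (N := N) (kerQ 0) (-(0 : ℕ)) U :=
    ⟨fun x => kerQ_one x.1, by simpa using! HasTwistCoeffs.map (U := U.unop) 1⟩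
  refine Submodule.pow_induction_on_left' (LinearMap.range (SymmetricAlgebra.ι
      ((PN N).presheaf.obj U) (P.obj U)))
    (C := fun k x _ => symGerms φ U x ∈ polySections (kerQ k) (-k) U) ?_ ?_ ?_ ha
  · intro r
    rw [AlgHom.commutes, Algebra.algebraMap_eq_smul_one]
    exact Submodule.smul_mem _ _ h0
  · intro x y i hx hy h1 h2
    rw [map_add]
    exact add_mem h1 h2
  · rintro _ ⟨x, rfl⟩ i y hy h
    rw [map_mul, symGerms_ι]
    have h1 := polySections_kerQ_mul
      (show polySections (kerQ 1) (-1) U from φ.app U x).2 h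
    have e : -1 + -(i : ℤ) = -(i.succ : ℤ) := by
      push_cast
      ring
    rwa [e, add_comm 1 i] at h1

theorem symGerms_naturality {U V : (PN N).Opensᵒᵖ} (f : U ⟶ V)
    (a : SymmetricAlgebra ((PN N).presheaf.obj U) (P.obj U)) :
    symGerms φ V (symAlgMap (σ := ((PN N).presheaf.map f).hom) (P.restrictₛₗ f) a) =
      germsRes f (symGerms φ U a) := by
  induction a using SymmetricAlgebra.induction with
  | algebraMap r =>
    rw [symAlgMap_algebraMap, AlgHom.commutes, AlgHom.commutes]
    rfl
  | ι x =>
    rw [symAlgMap_ι, symGerms_ι, symGerms_ι]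
    exact congrArg Subtype.val (PresheafOfModules.naturality_apply φ f x)
  | mul a b ha hb => rw [map_mul, map_mul, map_mul, map_mul, ha, hb]
  | add a b ha hb => rw [map_add, map_add, map_add, map_add, ha, hb]

/-- A morphism with values in linear forms induces a morphism from the symmetric powers to forms of
higher degree. -/
def symHom (m : ℕ) : symPresheaf (R := (PN N).presheaf) P m ⟶ polyPresheaf (kerQ m) (-m) :=
  mkHom (R := (PN N).presheaf) (P := symPresheaf (R := (PN N).presheaf) P m)
    (Q := polyPresheaf (kerQ m) (-m))
    (fun U => ((symGerms φ U).toLinearMap.restrict fun _ ha => symGerms_mem φ U m ha :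
      symPow ((PN N).presheaf.obj U) (P.obj U) m →ₗ[(PN N).presheaf.obj U]
        polySections (kerQ m) (-m) U))
    (fun f a => Subtype.ext (symGerms_naturality φ f a.1))

/-- The morphism induced on the symmetric power of a sheaf. -/
def symSheafHom {F : (PN N).Modules} (φ : F ⟶ polySheaf (kerQ 1) (-1)) (m : ℕ) :
    symSheaf F m ⟶ polySheaf (kerQ m) (-m) :=
  assocDesc (F := polySheaf (kerQ m) (-m)) (symHom φ.val m)

end SymmetricPowers

/-! ### Serre twists -/

section Twist
variable {N : ℕ} {Q : ∀ x : ProjectiveSpectrum (Homog N), Submodule (Loc N x) (LocPoly x)}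
  {k l n : ℤ}

theorem twist_mul_mem (h : k + l = n) {U : (PN N).Opensᵒᵖ} (f : polySections Q l U)
    (s : twistSections k U) :
    (fun x => MvPolynomial.C (s.1 x) * f.1 x : PolyGerms U) ∈ polySections Q n U :=
  ⟨fun x => by
    have h1 := (Q x.1).smul_mem (s.1 x) (f.2.1 x)
    rwa [MvPolynomial.smul_eq_C_mul] at h1, h ▸ (HasTwistCoeffs.C s.2).mul f.2.2⟩

variable (h : k + l = n)

/-- Multiplication of polynomials with sections of `O(k)`. -/
def twistMul (U : (PN N).Opensᵒᵖ) : polySections Q l U →ₗ[(PN N).presheaf.obj U]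
    twistSections k U →ₗ[(PN N).presheaf.obj U] polySections Q n U :=
  LinearMap.mk₂ _ (fun f s => ⟨_, twist_mul_mem h f s⟩)
    (fun _ _ _ => Subtype.ext (funext fun _ => mul_add _ _ _))
    (fun _ _ _ => Subtype.ext (funext fun _ => mul_left_comm _ _ _))
    (fun _ _ _ => Subtype.ext (funext fun _ =>
      (congrArg (· * _) (map_add MvPolynomial.C _ _)).trans (add_mul _ _ _)))
    (fun _ _ _ => Subtype.ext (funext fun _ =>
      (congrArg (· * _) (map_mul MvPolynomial.C _ _)).trans (mul_assoc _ _ _)))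

variable {P : PresheafOfModules.{0} ((PN N).presheaf ⋙ forget₂ CommRingCat RingCat)}
  (φ : P ⟶ polyPresheaf Q l)

/-- A morphism `P ⟶ polyPresheaf Q l` induces a morphism from `P ⊗ O(k)`. -/
def twistHom : PresheafOfModules.Monoidal.tensorObj (R := (PN N).presheaf) P (twistPresheaf N k) ⟶
    polyPresheaf Q n :=
  mkHom (R := (PN N).presheaf)
    (P := PresheafOfModules.Monoidal.tensorObj (R := (PN N).presheaf) P (twistPresheaf N k))
    (Q := polyPresheaf Q n)
    (fun U => TensorProduct.lift ((twistMul h U).comp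
      ((φ.app U).hom : P.obj U →ₗ[(PN N).presheaf.obj U] polySections Q l U)))
    (fun {U V} f a => by
      induction a using TensorProduct.induction_on with
      | zero => exact (congrArg _ (map_zero _)).trans ((map_zero _).trans
          ((congrArg _ (map_zero _)).trans (map_zero _)).symm)
      | tmul s t =>
        exact Subtype.ext (funext fun x => congrArg (_ * ·) (congrFun (congrArg Subtype.val
          (PresheafOfModules.naturality_apply φ f s)) x))
      | add a b h1 h2 => exact (congrArg _ (map_add _ a b)).trans ((map_add _ _ _).trans
          ((congrArg₂ _ h1 h2).trans ((congrArg _ (map_add _ a b)).trans (map_add _ _ _)).symm)))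

end Twist

/-- The morphism `d g₁ ⋯ d g_m ⊗ s ↦ s * ∏ l, ∑ k, ∂g_l/∂X_k * Y_k`, on the presheaf level. -/
def symCotangentHom (N m : ℕ) (n : ℤ) :
    PresheafOfModules.Monoidal.tensorObj (R := (PN N).presheaf)
      (symSheaf (cotangentSheaf (scalars N)) m).val (twist N (m + n)).val ⟶
      polyPresheaf (kerQ m) n :=
  twistHom (Q := kerQ m) (k := m + n) (l := -m) (n := n) (by ring)
    (P := (symSheaf (cotangentSheaf (scalars N)) m).val) (symSheafHom (cotangentHom N) m).val

/-! ### Local generation of presheaves of modules -/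

section LocalGeneration
variable {X : Scheme.{0}} {P Q T : PresheafOfModules.{0} (X.presheaf ⋙ forget₂ CommRingCat RingCat)}
  {ι ι' ι'' : Type} {U₀ : X.Opens} (e : ι → P.obj (op U₀)) (e' : ι' → Q.obj (op U₀))

/-- The module generated by the restrictions of the sections `e` to a smaller open set. -/
def genSpan {V : X.Opens} (j : V ⟶ U₀) : Submodule (X.presheaf.obj (op V)) (P.obj (op V)) :=
  Submodule.span _ (Set.range fun t => P.restrictₛₗ j.op (e t))

theorem restrict_mem_genSpan {V W : X.Opens} (j : V ⟶ U₀) (k : W ⟶ V) {a : P.obj (op V)}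
    (ha : a ∈ genSpan e j) : P.restrictₛₗ k.op a ∈ genSpan e (k ≫ j) := by
  induction ha using Submodule.span_induction with
  | mem a ha =>
    obtain ⟨t, rfl⟩ := ha
    refine Submodule.subset_span ⟨t, ?_⟩
    exact restr_comp P j.op k.op (e t)
  | zero => rw [map_zero]; exact zero_mem _
  | add a b _ _ ha hb => rw [map_add]; exact add_mem ha hb
  | smul r a _ ha =>
    rw [(P.restrictₛₗ k.op).map_smulₛₗ]
    exact Submodule.smul_mem _ _ ha

/-- The sections which near `x` are linear combinations of the sections `e`. -/
def locSpan {U : X.Opens} (j : U ⟶ U₀) (x : U) :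
    Submodule (X.presheaf.obj (op U)) (P.obj (op U)) where
  carrier := {a | ∃ (V : X.Opens) (k : V ⟶ U), x.1 ∈ V ∧ P.restrictₛₗ k.op a ∈ genSpan e (k ≫ j)}
  zero_mem' := ⟨U, 𝟙 U, x.2, by rw [map_zero]; exact zero_mem _⟩
  add_mem' {a b} ha hb := by
    obtain ⟨V, k, hV, ha⟩ := ha
    obtain ⟨W, l, hW, hb⟩ := hb
    refine ⟨V ⊓ W, homOfLE inf_le_left ≫ k, ⟨hV, hW⟩, ?_⟩
    have ha' := restrict_mem_genSpan e _ (homOfLE (inf_le_left : V ⊓ W ≤ V)) ha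
    have hb' := restrict_mem_genSpan e _ (homOfLE (inf_le_right : V ⊓ W ≤ W)) hb
    rw [← restr_comp] at ha' hb'
    rw [map_add]
    exact add_mem ha' hb'
  smul_mem' r a ha := by
    obtain ⟨V, k, hV, ha⟩ := ha
    refine ⟨V, k, hV, ?_⟩
    rw [(P.restrictₛₗ k.op).map_smulₛₗ]
    exact Submodule.smul_mem _ _ ha

/-- The sections `e` generate `P` locally on `U₀`. -/
def LocallyGenerates : Prop := ∀ ⦃U : X.Opens⦄ (j : U ⟶ U₀) (x : U), locSpan e j x = ⊤

variable {e e'}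

theorem LocallyGenerates.mem (h : LocallyGenerates e) {U : X.Opens} (j : U ⟶ U₀) (x : U)
    (a : P.obj (op U)) : a ∈ locSpan e j x :=
  h j x ▸ Submodule.mem_top

/-- A bilinear map sends local combinations of sections `e` and `e'` to local combinations of
their products. -/
theorem bilinear_mem_locSpan {e'' : ι'' → T.obj (op U₀)}
    (B : ∀ U : X.Opens, P.obj (op U) →ₗ[X.presheaf.obj (op U)] Q.obj (op U)
      →ₗ[X.presheaf.obj (op U)] T.obj (op U))
    (hB : ∀ {U V : X.Opens} (k : V ⟶ U) (p : P.obj (op U)) (q : Q.obj (op U)),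
      T.restrictₛₗ k.op (B U p q) = B V (P.restrictₛₗ k.op p) (Q.restrictₛₗ k.op q))
    (hBe : ∀ t t', ∃ t'', e'' t'' = B U₀ (e t) (e' t')) {U : X.Opens} (j : U ⟶ U₀) (x : U)
    {p : P.obj (op U)} (hp : p ∈ locSpan e j x) {q : Q.obj (op U)} (hq : q ∈ locSpan e' j x) :
    B U p q ∈ locSpan e'' j x := by
  obtain ⟨V, k, hV, hp⟩ := hp
  obtain ⟨W, l, hW, hq⟩ := hq
  refine ⟨V ⊓ W, homOfLE inf_le_left ≫ k, ⟨hV, hW⟩, ?_⟩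
  have hp' := restrict_mem_genSpan e _ (homOfLE (inf_le_left : V ⊓ W ≤ V)) hp
  have hq' := restrict_mem_genSpan e' _ (homOfLE (inf_le_right : V ⊓ W ≤ W)) hq
  rw [← restr_comp] at hp' hq'
  rw [hB]
  have h := Submodule.apply_mem_map₂ (B _) hp' hq'
  rw [genSpan, genSpan, Submodule.map₂_span_span] at h
  refine Submodule.span_mono ?_ h
  rintro _ ⟨_, ⟨t, rfl⟩, _, ⟨t', rfl⟩, rfl⟩
  obtain ⟨t'', h⟩ := hBe t t'
  refine ⟨t'', ?_⟩
  change T.restrictₛₗ _ (e'' t'') = _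
  rw [h, hB]
  rfl

theorem map_mem_genSpan (φ : P ⟶ Q) {V : X.Opens} {j : V ⟶ U₀} {a : P.obj (op V)}
    (ha : a ∈ genSpan e j) : φ.app (op V) a ∈ genSpan (fun t => φ.app (op U₀) (e t)) j := by
  let L : P.obj (op V) →ₗ[X.presheaf.obj (op V)] Q.obj (op V) := (φ.app (op V)).hom
  have h := Submodule.mem_map_of_mem (f := L) ha
  rw [genSpan, Submodule.map_span] at h
  refine Submodule.span_mono ?_ h
  rintro _ ⟨_, ⟨t, rfl⟩, rfl⟩
  exact ⟨t, (PresheafOfModules.naturality_apply φ j.op (e t)).symm⟩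

/-- Generators of a presheaf generate its associated sheaf. -/
theorem LocallyGenerates.toAssoc {P : X.PresheafOfModules} {e : ι → P.obj (op U₀)}
    (h : LocallyGenerates (P := P) e) :
    LocallyGenerates (P := (assocSheaf P).val) fun t => (GenEuler.toAssoc P).app (op U₀) (e t) := by
  refine fun U j x => eq_top_iff.2 fun s _ => ?_
  obtain ⟨V, k, hV, t, ht⟩ := exists_toAssoc_eq P U s x.1 x.2
  obtain ⟨W, l, hW, hl⟩ := h.mem (k ≫ j) ⟨x.1, hV⟩ t
  refine ⟨W, l ≫ k, hW, ?_⟩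
  have h1 : (assocSheaf P).val.restrictₛₗ (l ≫ k).op s =
      (GenEuler.toAssoc P).app (op W) (PresheafOfModules.restrictₛₗ P l.op t) := by
    refine (restr_comp (assocSheaf P).val k.op l.op s).trans ?_
    refine (congrArg _ ht.symm).trans ?_
    exact (PresheafOfModules.naturality_apply (GenEuler.toAssoc P) l.op t).symm
  refine (congrArg (· ∈ genSpan (P := (assocSheaf P).val) _ _) h1).mpr ?_
  exact map_mem_genSpan (Q := (assocSheaf P).val) (GenEuler.toAssoc P) hl

/-- Multiplication with an element of `M`, from `S^k M` to `S^(k+1) M`. -/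
def symMul (R M : Type) [CommRing R] [AddCommGroup M] [Module R M] (k : ℕ) :
    M →ₗ[R] symPow R M k →ₗ[R] symPow R M (k + 1) :=
  LinearMap.mk₂ R (fun p y => ⟨SymmetricAlgebra.ι R M p * y.1, by
      rw [symPow, pow_succ']
      exact Submodule.mul_mem_mul ⟨p, rfl⟩ y.2⟩)
    (fun p p' y => Subtype.ext (by simp [add_mul])) (fun c p y => Subtype.ext (by simp))
    (fun p y y' => Subtype.ext (mul_add _ _ _)) (fun c p y => Subtype.ext (by simp))

theorem restrict_mem_locSpan {U : X.Opens} (j : U ⟶ U₀) (x : U) (t : ι) :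
    P.restrictₛₗ j.op (e t) ∈ locSpan e j x := by
  refine ⟨U, 𝟙 U, x.2, ?_⟩
  exact restrict_mem_genSpan e j (𝟙 U) (Submodule.subset_span ⟨t, rfl⟩)

/-- The product `∏ t, (e t) ^ (s t)` in a symmetric power. -/
def symMonom {R M : Type} [CommRing R] [AddCommGroup M] [Module R M] [Fintype ι] (e : ι → M)
    (m : ℕ) (s : {s : ι →₀ ℕ // s.degree = m}) : symPow R M m :=
  ⟨∏ t, SymmetricAlgebra.ι R M (e t) ^ s.1 t, by
    have h (A : Finset ι) : ∏ t ∈ A, SymmetricAlgebra.ι R M (e t) ^ s.1 t ∈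
        LinearMap.range (SymmetricAlgebra.ι R M) ^ (∑ t ∈ A, s.1 t) := by
      classical
      induction A using Finset.induction_on with
      | empty =>
        rw [Finset.prod_empty, Finset.sum_empty, pow_zero]
        exact Submodule.one_le.1 le_rfl
      | insert t A ht ih =>
        rw [Finset.prod_insert ht, Finset.sum_insert ht, pow_add]
        exact Submodule.mul_mem_mul (Submodule.pow_mem_pow _ (LinearMap.mem_range_self _ _) _) ih
    have h1 := h Finset.univ
    rwa [← Finsupp.degree_eq_sum, s.2] at h1⟩

/-- Products of generators generate the symmetric powers. -/
theorem LocallyGenerates.symPresheaf [Fintype ι] (h : LocallyGenerates e) (m : ℕ) :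
    LocallyGenerates (P := GenEuler.symPresheaf (R := X.presheaf) P m) (symMonom e m) := by
  classical
  refine fun U j x => eq_top_iff.2 fun a _ => ?_
  have key : ∀ {k : ℕ} {y : SymmetricAlgebra (X.presheaf.obj (op U)) (P.obj (op U))}
      (hy : y ∈ LinearMap.range (SymmetricAlgebra.ι (X.presheaf.obj (op U)) (P.obj (op U))) ^ k),
      (⟨y, hy⟩ : symPow (X.presheaf.obj (op U)) (P.obj (op U)) k) ∈
        locSpan (P := GenEuler.symPresheaf (R := X.presheaf) P k) (symMonom e k) j x := by
    intro k y hy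
    refine Submodule.pow_induction_on_left' (LinearMap.range (SymmetricAlgebra.ι
        (X.presheaf.obj (op U)) (P.obj (op U))))
      (C := fun k y hy => (⟨y, hy⟩ : symPow (X.presheaf.obj (op U)) (P.obj (op U)) k) ∈
        locSpan (P := GenEuler.symPresheaf (R := X.presheaf) P k) (symMonom e k) j x) ?_ ?_ ?_ hy
    · intro r
      have h1 := Submodule.smul_mem _ r (restrict_mem_locSpan
        (P := GenEuler.symPresheaf (R := X.presheaf) P 0) (e := symMonom e 0) j x
        ⟨0, map_zero _⟩)
      refine (congrArg (· ∈ locSpan _ j x) (Subtype.ext ?_)).mp h1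
      change r • symAlgMap _ (∏ t, _ ^ 0) = _
      simp [Algebra.algebraMap_eq_smul_one]
    · intro y z k hy hz h1 h2
      exact add_mem h1 h2
    · rintro _ ⟨p, rfl⟩ k y hy h1
      refine bilinear_mem_locSpan (P := P) (Q := GenEuler.symPresheaf (R := X.presheaf) P k)
        (T := GenEuler.symPresheaf (R := X.presheaf) P (k + 1)) (e := e) (e' := symMonom e k)
        (fun U => symMul (X.presheaf.obj (op U)) (P.obj (op U)) k) (fun l p q => ?_)
        (fun t s => ?_) j x (h.mem j x p) h1
      · refine Subtype.ext ((map_mul (symAlgMap _) _ _).trans (congrArg (· * _) ?_))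
        exact symAlgMap_ι _ _
      · refine ⟨⟨s.1 + Finsupp.single t 1, by rw [map_add, s.2, Finsupp.degree_single]⟩,
          Subtype.ext ?_⟩
        let ε (t : ι) := SymmetricAlgebra.ι (X.presheaf.obj (op U₀)) (P.obj (op U₀)) (e t)
        change ∏ t' : ι, ε t' ^ (s.1 + Finsupp.single t 1 : ι →₀ ℕ) t' = ε t * ∏ t', ε t' ^ s.1 t'
        simp only [Finsupp.add_apply, pow_add, Finset.prod_mul_distrib]
        rw [mul_comm, Finset.prod_eq_single t]
        · rw [Finsupp.single_eq_same, pow_one]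
        · intro t' _ ht'
          rw [Finsupp.single_eq_of_ne ht', pow_zero]
        · simp
  exact key a.2

/-- Generators of `P` and one generator of `Q` give generators of `P ⊗ Q`. -/
theorem LocallyGenerates.tensor (h : LocallyGenerates e) {τ : Q.obj (op U₀)}
    (hτ : LocallyGenerates fun _ : Unit => τ) :
    LocallyGenerates (P := PresheafOfModules.Monoidal.tensorObj (R := X.presheaf) P Q)
      fun t => (e t ⊗ₜ[X.presheaf.obj (op U₀)] τ :
        TensorProduct (X.presheaf.obj (op U₀)) (P.obj (op U₀)) (Q.obj (op U₀))) := by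
  refine fun U j x => eq_top_iff.2 fun a _ => ?_
  induction a using TensorProduct.induction_on with
  | zero => exact zero_mem _
  | add a b ha hb => exact add_mem (ha trivial) (hb trivial)
  | tmul p q =>
    exact bilinear_mem_locSpan (P := P) (Q := Q)
      (T := PresheafOfModules.Monoidal.tensorObj (R := X.presheaf) P Q) (e := e)
      (fun U => TensorProduct.mk (X.presheaf.obj (op U)) (P.obj (op U)) (Q.obj (op U)))
      (fun _ _ _ => rfl) (fun t _ => ⟨t, rfl⟩) j x (h.mem j x p) (hτ.mem j x q)

end LocalGeneration

/-! ### Local generators of the Kähler differentials -/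

section Kaehler

theorem mem_span_range_d {A B : CommRingCat.{0}} (f : A ⟶ B)
    (ω : CommRingCat.KaehlerDifferential f) :
    ω ∈ Submodule.span B (Set.range fun b : B => CommRingCat.KaehlerDifferential.d (f := f) b) := by
  let := f.hom.toAlgebra
  have h := (KaehlerDifferential.span_range_derivation A B).ge (Submodule.mem_top (x := ω))
  exact h

theorem d_eval₂_mem {A B : CommRingCat.{0}} {f : A ⟶ B} {M : ModuleCat.{0} B}
    (D : M.Derivation f) {σ : Type} (x : σ → B) (p : MvPolynomial σ A) :
    D.d (p.eval₂ f.hom x) ∈ Submodule.span B (Set.range fun j => D.d (x j)) := by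
  induction p using MvPolynomial.induction_on with
  | C a =>
    rw [MvPolynomial.eval₂_C]
    exact (congrArg (· ∈ _) (D.d_map a)).mpr (zero_mem _)
  | add p q hp hq =>
    rw [MvPolynomial.eval₂_add, D.d_add]
    exact add_mem hp hq
  | mul_X p j hp =>
    rw [MvPolynomial.eval₂_mul, MvPolynomial.eval₂_X, D.d_mul]
    exact add_mem (Submodule.smul_mem _ _ (Submodule.subset_span ⟨j, rfl⟩))
      (Submodule.smul_mem _ _ hp)

theorem eval₂_mul_right_of_isHomogeneous {R S σ : Type*} [CommRing R] [CommRing S] [Fintype σ]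
    (f : R →+* S) (x : σ → S) (c : S) {p : MvPolynomial σ R} {d : ℕ} (hp : p.IsHomogeneous d) :
    p.eval₂ f (fun j => x j * c) = p.eval₂ f x * c ^ d := by
  rw [MvPolynomial.eval₂_eq', MvPolynomial.eval₂_eq', Finset.sum_mul]
  refine Finset.sum_congr rfl fun s hs => ?_
  simp only [mul_pow, Finset.prod_mul_distrib, Finset.prod_pow_eq_pow_sum]
  rw [← Finsupp.degree_eq_sum, show s.degree = d from (hp.degree_eq_sum_deg_support hs).symm,
    mul_assoc]

variable {N : ℕ}

/-- The coordinate `X_j / X_i`. -/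
def coordSec (i j : Fin (N + 1)) : (PN N).presheaf.obj (op (basicOpenX i)) :=
  (exists_secVal_eq (U := op (basicOpenX i)) (isLocallyTwistFraction_X (-1) j
    (isLocallyTwistFraction_unitX (le_refl (basicOpenX i)) (-1)))).choose

theorem secVal_coordSec (i j : Fin (N + 1)) (x : basicOpenX (N := N) i) :
    secVal (U := op (basicOpenX i)) (coordSec i j) x = germX x.1 j * powX i (-1) x.1 x.2 :=
  congrFun (exists_secVal_eq (U := op (basicOpenX i)) (isLocallyTwistFraction_X (-1) j
    (isLocallyTwistFraction_unitX (le_refl (basicOpenX i)) (-1)))).choose_spec x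

/-- The germ of a section at a point, as a ring homomorphism. -/
def germAt {V : (PN N).Opens} (x : V) : (PN N).presheaf.obj (op V) →+* Loc N x.1 :=
  (Pi.evalRingHom _ x).comp (secValHom (op V))

theorem eval₂_germX_mul_powX (i : Fin (N + 1)) (x : ProjectiveSpectrum (Homog N))
    (hx : x ∈ basicOpenX i) {d : ℕ} {a : Poly N} (ha : a ∈ Homog N d) :
    a.eval₂ ((algebraMap (Poly N) (Loc N x)).comp MvPolynomial.C)
      (fun j => germX x j * powX i (-1) x hx) =
        algebraMap (Poly N) (Loc N x) a * powX i (-d) x hx := by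
  rw [eval₂_mul_right_of_isHomogeneous _ _ _ ha, powX_pow, neg_one_mul]
  congr 1
  exact (MvPolynomial.eval₂_comp_left (algebraMap (Poly N) (Loc N x)) MvPolynomial.C
    MvPolynomial.X a).symm.trans (congrArg _ (MvPolynomial.eval₂_eta a))

/-- A homogeneous polynomial of degree `d` evaluated at the coordinates is its quotient by
`X_i ^ d`. -/
theorem germAt_eval₂_coordSec {i : Fin (N + 1)} {V : (PN N).Opens} (k : V ⟶ basicOpenX i) {d : ℕ}
    {a : Poly N} (ha : a ∈ Homog N d) (y : V) :
    germAt y (a.eval₂ (constSec (op V)) fun j => ((PN N).presheaf.map k.op).hom (coordSec i j)) =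
      algebraMap (Poly N) (Loc N y.1) a * powX i (-d) y.1 (k.le y.2) := by
  have h0 : (germAt y).comp (constSec (op V)) =
      (algebraMap (Poly N) (Loc N y.1)).comp MvPolynomial.C :=
    RingHom.ext fun c => constSec_val (U := op V) c y
  have h1 (j : Fin (N + 1)) : germAt y (((PN N).presheaf.map k.op).hom (coordSec i j)) =
      germX y.1 j * powX i (-1) y.1 (k.le y.2) :=
    secVal_coordSec i j ⟨y.1, k.le y.2⟩
  rw [MvPolynomial.hom_eval₂, h0]
  exact (congrArg (fun v => MvPolynomial.eval₂ _ v a) (funext h1)).trans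
    (eval₂_germX_mul_powX i y.1 (k.le y.2) ha)

theorem eq_of_germAt {V : (PN N).Opens} {f g : (PN N).presheaf.obj (op V)}
    (h : ∀ y : V, germAt y f = germAt y g) : f = g :=
  secVal_injective (funext h)

/-- The differentials of the coordinates `X_j / X_i` generate the Kähler differentials: locally
every function is a quotient of two polynomials in these coordinates. -/
theorem locallyGenerates_d_coordSec (i : Fin (N + 1)) : LocallyGenerates
    (P := PresheafOfModules.DifferentialsConstruction.relativeDifferentials' (scalars N))
    (U₀ := basicOpenX i) fun j => CommRingCat.KaehlerDifferential.d
      (f := (scalars N).app (op (basicOpenX i))) (coordSec i j) := by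
  refine fun U k x => eq_top_iff.2 fun ω _ => ?_
  refine Submodule.span_le.2 ?_ (mem_span_range_d ((scalars N).app (op U)) ω)
  rintro _ ⟨g, rfl⟩
  obtain ⟨V, l, d, a, b, hx, ha, hb, hbV, h⟩ := exists_fraction_secVal g x
  refine ⟨V, l, hx, ?_⟩
  let x (j : Fin (N + 1)) : (PN N).presheaf.obj (op V) :=
    ((PN N).presheaf.map (l ≫ k).op).hom (coordSec i j)
  -- Near the given point `g = a / b = α / β`, and `γ = X_i ^ d / b` is an inverse of `β`.
  let α := a.eval₂ (constSec (op V)) x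
  let β := b.eval₂ (constSec (op V)) x
  let g' : (PN N).presheaf.obj (op V) := ((PN N).presheaf.map l.op).hom g
  have hα := germAt_eval₂_coordSec (l ≫ k) ha
  have hβ := germAt_eval₂_coordSec (l ≫ k) hb
  obtain ⟨γ, hγ⟩ := exists_secVal_eq (U := op V) (f := fun y : V =>
    Localization.mk (MvPolynomial.X i ^ d : Poly N) ⟨b, hbV y⟩) (isLocallyTwistFraction_of_fraction
      (MvPolynomial.isHomogeneous_X_pow i d) hb (by simp) hbV fun y => eq_mk_iff_mul_eq.1 rfl)
  have h1 : γ * β = 1 := eq_of_germAt fun y => by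
    have h2 : germAt y γ * algebraMap (Poly N) (Loc N y.1) b =
        algebraMap (Poly N) (Loc N y.1) (MvPolynomial.X i ^ d) :=
      eq_mk_iff_mul_eq.1 (congrFun hγ y)
    rw [map_mul, hβ y, ← mul_assoc, h2, ← unitX_zpow_natCast i y.1 ((l ≫ k).le y.2), map_one,
      mul_one, map_one]
    exact (powX_mul_powX i _ _ _).trans
      ((congrArg (fun e => powX i e y.1 _) (add_neg_cancel _)).trans (powX_zero i _))
  have h2 : g' * β = α := eq_of_germAt fun y => by
    rw [map_mul, hβ y, hα y, ← h y, mul_assoc]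
    rfl
  -- Hence `d g = γ * (d α - g * d β)`, and `α` and `β` are polynomials in the coordinates.
  let D := CommRingCat.KaehlerDifferential.D ((scalars N).app (op V))
  have h3 : D.d α = g' • D.d β + β • D.d g' := h2 ▸ D.d_mul g' β
  have h4 : D.d g' = γ • (D.d α - g' • D.d β) := by
    rw [h3, add_sub_cancel_left, smul_smul, h1, one_smul]
  have hspan (p : Poly N) : D.d (p.eval₂ (constSec (op V)) x) ∈
      Submodule.span ((PN N).presheaf.obj (op V)) (Set.range fun j => D.d (x j)) :=
    d_eval₂_mem D x p
  have h5 : D.d g' ∈ Submodule.span ((PN N).presheaf.obj (op V)) (Set.range fun j => D.d (x j)) :=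
    h4 ▸ Submodule.smul_mem _ γ (sub_mem (hspan a) (Submodule.smul_mem _ g' (hspan b)))
  have hres {W W' : (PN N).Opens} (r : W ⟶ W') (q : (PN N).presheaf.obj (op W')) :=
    PresheafOfModules.DifferentialsConstruction.relativeDifferentials'_map_d (scalars N) r.op q
  refine (congrArg₂ (· ∈ ·) (hres l g).symm ?_).mp h5
  exact congrArg (fun v => Submodule.span _ (Set.range v)) (funext fun j => (hres (l ≫ k) _).symm)

end Kaehler

/-! ### The kernel of `δ` as a symmetric power of the cotangent sheaf -/

section Comparison
variable {N : ℕ}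

/-- The section `X_i ^ k` of `O(k)`. -/
def powSec (i : Fin (N + 1)) (k : ℤ) : twistSections (N := N) k (op (basicOpenX i)) :=
  ⟨fun x => powX i k x.1 x.2, isLocallyTwistFraction_unitX (le_refl (basicOpenX i)) k⟩

theorem locallyGenerates_powSec (i : Fin (N + 1)) (k : ℤ) :
    LocallyGenerates (P := twistPresheaf N k) (U₀ := basicOpenX i)
      fun _ : Unit => powSec i k := by
  refine fun U j x => eq_top_iff.2 fun s _ => ?_
  let s' : twistSections k (op U) := s
  have h1 := isLocallyTwistFraction_mul (isLocallyTwistFraction_unitX j.le (-k)) s'.2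
  rw [neg_add_cancel] at h1
  obtain ⟨q, hq⟩ := exists_secVal_eq (U := op U) h1
  have h2 : s = q • (twistPresheaf N k).restrictₛₗ j.op (powSec i k) := by
    refine Subtype.ext (funext fun y => ?_)
    exact ((congrArg (· * _) (congrFun hq y)).trans
      (powX_neg_mul_mul_powX (j.le y.2) k (s'.1 y))).symm
  rw [h2]
  exact Submodule.smul_mem _ _ (restrict_mem_locSpan (P := twistPresheaf N k) j x ())

/-- The cotangent sheaf as a presheaf of modules. -/
def cotangentPresheaf (N : ℕ) :
    PresheafOfModules.{0} ((PN N).presheaf ⋙ forget₂ CommRingCat RingCat) :=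
  (cotangentSheaf (scalars N)).val

/-- The symmetric powers of the cotangent sheaf as presheaves of modules. -/
def symCotangentPresheaf (N m : ℕ) :
    PresheafOfModules.{0} ((PN N).presheaf ⋙ forget₂ CommRingCat RingCat) :=
  (symSheaf (cotangentSheaf (scalars N)) m).val

/-- The tensor products of the symmetric powers of the cotangent sheaf with the Serre twists, as
presheaves of modules. -/
def symCotangentTensor (N m : ℕ) (k : ℤ) :
    PresheafOfModules.{0} ((PN N).presheaf ⋙ forget₂ CommRingCat RingCat) :=
  PresheafOfModules.Monoidal.tensorObj (R := (PN N).presheaf) (symCotangentPresheaf N m)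
    (twistPresheaf N k)

/-- The section `d (X_j / X_i)` of the cotangent sheaf. -/
def cotangentGen (i j : Fin (N + 1)) :
    (cotangentPresheaf N).obj (op (basicOpenX i)) :=
  (toAssoc (PresheafOfModules.DifferentialsConstruction.relativeDifferentials' (scalars N))).app _
    (CommRingCat.KaehlerDifferential.d (f := (scalars N).app (op (basicOpenX i))) (coordSec i j))

theorem cotangentGen_self (i : Fin (N + 1)) : cotangentGen i i = 0 := by
  have h1 : coordSec i i = 1 := eq_of_germAt fun y => by
    refine (secVal_coordSec i i y).trans (Eq.trans ?_ (map_one _).symm)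
    exact powX_one i y.2 ▸ (powX_mul_powX i y.2 1 (-1)).trans (powX_zero i y.2)
  have h2 : CommRingCat.KaehlerDifferential.d (f := (scalars N).app (op (basicOpenX i)))
      (coordSec i i) = 0 := by
    rw [h1, ← map_one ((scalars N).app (op (basicOpenX i))).hom]
    exact ModuleCat.Derivation.d_map _ _
  exact (congrArg _ h2).trans (map_zero _)

/-- The product of the sections `d (X_j / X_i)` with exponents `s j`. -/
def symGen (i : Fin (N + 1)) (m : ℕ) (s : {s : Fin (N + 1) →₀ ℕ // s.degree = m}) :
    (symCotangentPresheaf N m).obj (op (basicOpenX i)) :=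
  (toAssoc (symPresheaf (R := (PN N).presheaf) (cotangentPresheaf N) m)).app
    (op (basicOpenX i)) (symMonom (R := (PN N).presheaf.obj (op (basicOpenX i)))
      (M := (cotangentPresheaf N).obj (op (basicOpenX i))) (cotangentGen i) m s)

/-- The product of the sections `d (X_j / X_i)` with exponents `s j`, multiplied by `X_i ^ k`. -/
def tensorGen (i : Fin (N + 1)) (m : ℕ) (k : ℤ) (s : {s : Fin (N + 1) →₀ ℕ // s.degree = m}) :
    (symCotangentTensor N m k).obj (op (basicOpenX i)) :=
  (symGen i m s ⊗ₜ[(PN N).presheaf.obj (op (basicOpenX i))] powSec i k :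
    TensorProduct ((PN N).presheaf.obj (op (basicOpenX i)))
      ((symCotangentPresheaf N m).obj (op (basicOpenX i))) (twistSections k (op (basicOpenX i))))

theorem locallyGenerates_tensorGen (i : Fin (N + 1)) (m : ℕ) (k : ℤ) :
    LocallyGenerates (P := symCotangentTensor N m k) (tensorGen i m k) :=
  LocallyGenerates.tensor (P := symCotangentPresheaf N m) (Q := twistPresheaf N k)
    (LocallyGenerates.toAssoc (LocallyGenerates.symPresheaf (P := cotangentPresheaf N)
      (LocallyGenerates.toAssoc (locallyGenerates_d_coordSec i)) m))
    (locallyGenerates_powSec i k)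

theorem tensorGen_eq_zero (i : Fin (N + 1)) (m : ℕ) (k : ℤ)
    (s : {s : Fin (N + 1) →₀ ℕ // s.degree = m}) (hs : s.1 i ≠ 0) : tensorGen i m k s = 0 := by
  have h1 : symMonom (R := (PN N).presheaf.obj (op (basicOpenX i)))
      (M := (cotangentPresheaf N).obj (op (basicOpenX i))) (cotangentGen i) m s = 0 := by
    refine Subtype.ext (Finset.prod_eq_zero (Finset.mem_univ i) ?_)
    rw [cotangentGen_self, map_zero, zero_pow hs]
  have h2 : symGen i m s = 0 := (congrArg _ h1).trans (map_zero _)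
  exact (congrArg (· ⊗ₜ[(PN N).presheaf.obj (op (basicOpenX i))] powSec i k) h2).trans
    (TensorProduct.zero_tmul _ _)

theorem germDiff_coord (i j : Fin (N + 1)) (x : ProjectiveSpectrum (Homog N))
    (hx : x ∈ basicOpenX i) : germDiff x (germX x j * powX i (-1) x hx) = diffForm i j x hx := by
  have h1 : germX x j * powX i (-1) x hx * algebraMap (Poly N) (Loc N x) (MvPolynomial.X i) =
      algebraMap (Poly N) (Loc N x) (MvPolynomial.X j) := by
    rw [← germX, ← germX, mul_assoc, ← powX_one i hx, powX_mul_powX, neg_add_cancel, powX_zero,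
      mul_one]
  have h2 : powX i (-2) x hx * (germX x i * germX x i) = 1 := by
    rw [← powX_one i hx, powX_mul_powX, powX_mul_powX]
    exact powX_zero i hx
  have h3 := totalDiff_X_div_X x.asHomogeneousIdeal.toIdeal.primeCompl h1 h2
  refine h3.trans ?_
  rw [← germX, ← germX, ← powX_one i hx, powX_mul_powX, mul_comm (powX i (-2) x hx)]
  rfl

theorem cotangentHom_cotangentGen (i j : Fin (N + 1)) (x : basicOpenX (N := N) i) :
    (show polySections (kerQ 1) (-1) (op (basicOpenX i)) from
      (cotangentHom N).val.app (op (basicOpenX i)) (cotangentGen i j)).1 x =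
        diffForm i j x.1 x.2 := by
  have h1 := assocDesc_app_toAssoc (F := polySheaf (kerQ 1) (-1)) (kaehlerHom N)
    (op (basicOpenX i)) (CommRingCat.KaehlerDifferential.d
      (f := (scalars N).app (op (basicOpenX i))) (coordSec i j))
  have h2 : (cotangentHom N).val.app (op (basicOpenX i)) (cotangentGen i j) =
      diffSec (coordSec i j) := h1.trans (kaehlerHom_d _)
  exact (congrFun (congrArg Subtype.val h2) x).trans ((congrArg (germDiff x.1)
    (secVal_coordSec i j x)).trans (germDiff_coord i j x.1 x.2))

/-- On the generators the comparison morphism takes the values `diffMonom`. -/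
theorem symCotangentHom_tensorGen (i : Fin (N + 1)) (m : ℕ) (n : ℤ)
    (s : {s : Fin (N + 1) →₀ ℕ // s.degree = m}) :
    (symCotangentHom N m n).app (op (basicOpenX i)) (tensorGen i m (m + n) s) =
      diffMonomSec i m n s.1 s.2 := by
  have h1 := assocDesc_app_toAssoc (F := polySheaf (kerQ m) (-m)) (symHom (cotangentHom N).val m)
    (op (basicOpenX i)) (symMonom (R := (PN N).presheaf.obj (op (basicOpenX i)))
      (M := (cotangentPresheaf N).obj (op (basicOpenX i))) (cotangentGen i) m s)
  refine Subtype.ext (funext fun x => congrArg (MvPolynomial.C (powX i (m + n) x.1 x.2) * ·) ?_)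
  refine (congrFun (congrArg Subtype.val h1) x).trans ?_
  let G : SymmetricAlgebra ((PN N).presheaf.obj (op (basicOpenX i)))
      ((cotangentPresheaf N).obj (op (basicOpenX i))) →+* LocPoly x.1 :=
    (Pi.evalRingHom (fun y : basicOpenX (N := N) i => LocPoly y.1) x).comp
      (symGerms (P := cotangentPresheaf N) (cotangentHom N).val (op (basicOpenX i))).toRingHom
  refine (show _ = G (∏ j, SymmetricAlgebra.ι _ _ (cotangentGen i j) ^ s.1 j) from rfl).trans ?_
  refine (map_prod G _ _).trans (Finset.prod_congr rfl fun j _ => ?_)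
  refine (map_pow G _ _).trans (congrArg (· ^ s.1 j) ?_)
  refine (congrFun (symGerms_ι (P := cotangentPresheaf N) (cotangentHom N).val (op (basicOpenX i))
    (cotangentGen i j)) x).trans ?_
  exact cotangentHom_cotangentGen i j x

/-- The sections `tensorGen` for monomials not involving the variable of index `i`. The others
vanish as `X_i / X_i` is constant. -/
def frameGen (i : Fin (N + 1)) (m : ℕ) (k : ℤ) (s : monomsAway N m i) :
    (symCotangentTensor N m k).obj (op (basicOpenX i)) :=
  tensorGen i m k ⟨s.1, mem_monoms.1 (Finset.mem_filter.1 s.2).1⟩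

theorem symCotangentHom_frameGen {i : Fin (N + 1)} {m : ℕ} {n : ℤ} {V : (PN N).Opens}
    (j : V ⟶ basicOpenX i) (q : monomsAway N m i → (PN N).presheaf.obj (op V)) :
    (symCotangentHom N m n).app (op V) (∑ s, q s •
      (symCotangentTensor N m (m + n)).restrictₛₗ j.op (frameGen i m (m + n) s) :
        (symCotangentTensor N m (m + n)).obj (op V)) =
      ∑ s, q s • polyRes (kerQ m) n j.op (kerFrame i m n s) := by
  let L : (symCotangentTensor N m (m + n)).obj (op V) →ₗ[(PN N).presheaf.obj (op V)]
    polySections (kerQ m) n (op V) := ((symCotangentHom N m n).app (op V)).hom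
  refine (map_sum L _ _).trans (Finset.sum_congr rfl fun s _ => ?_)
  refine (L.map_smul _ _).trans (congrArg (q s • ·) ?_)
  refine (PresheafOfModules.naturality_apply (symCotangentHom N m n) j.op _).trans ?_
  exact congrArg (polyRes (kerQ m) n j.op) (symCotangentHom_tensorGen i m n _)

/-- Every section is locally a linear combination of the sections `frameGen`. -/
theorem exists_eq_sum_frameGen {i : Fin (N + 1)} {m : ℕ} {k : ℤ} {U : (PN N).Opens}
    (a : (symCotangentTensor N m k).obj (op U)) (x : PN N) (hx : x ∈ U) (hi : x ∈ basicOpenX i) :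
    ∃ (V : (PN N).Opens) (l : V ⟶ U) (j : V ⟶ basicOpenX i)
      (q : monomsAway N m i → (PN N).presheaf.obj (op V)), x ∈ V ∧
      (symCotangentTensor N m k).restrictₛₗ l.op a =
        ∑ s, q s • (symCotangentTensor N m k).restrictₛₗ j.op (frameGen i m k s) := by
  let U' : (PN N).Opens := U ⊓ basicOpenX i
  let l' : U' ⟶ U := homOfLE inf_le_left
  let j' : U' ⟶ basicOpenX i := homOfLE inf_le_right
  obtain ⟨V, l, hV, h⟩ := (locallyGenerates_tensorGen i m k).mem j' ⟨x, hx, hi⟩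
    ((symCotangentTensor N m k).restrictₛₗ l'.op a)
  have h1 : (symCotangentTensor N m k).restrictₛₗ (l ≫ l').op a ∈ Submodule.span
      ((PN N).presheaf.obj (op V)) (Set.range fun s : monomsAway N m i =>
        (symCotangentTensor N m k).restrictₛₗ (l ≫ j').op (frameGen i m k s)) := by
    refine Submodule.span_le.2 ?_ (restr_comp (symCotangentTensor N m k) l'.op l.op a ▸ h)
    rintro _ ⟨s, rfl⟩
    by_cases hs : s.1 i = 0
    · exact Submodule.subset_span
        ⟨⟨s.1, Finset.mem_filter.2 ⟨mem_monoms.2 s.2, hs⟩⟩, rfl⟩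
    · have h2 : (symCotangentTensor N m k).restrictₛₗ (l ≫ j').op (tensorGen i m k s) = 0 := by
        rw [tensorGen_eq_zero i m k s hs, map_zero]
      exact (congrArg (· ∈ _) h2).mpr (zero_mem _)
  obtain ⟨q, hq⟩ := (Submodule.mem_span_range_iff_exists_fun _).1 h1
  exact ⟨V, l ≫ l', l ≫ j', q, hV, hq.symm⟩

theorem isLocallySurjective_symCotangentHom (m : ℕ) (n : ℤ) :
    PresheafOfModules.IsLocallySurjective (Opens.grothendieckTopology (PN N))
      (symCotangentHom N m n) :=
  isLocallySurjective_of_exists _ fun U f x hx => by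
    obtain ⟨i, hi⟩ := exists_mem_basicOpenX x
    let V : (PN N).Opens := U ⊓ basicOpenX i
    let l : V ⟶ U := homOfLE inf_le_left
    let j : V ⟶ basicOpenX i := homOfLE inf_le_right
    obtain ⟨q, hq⟩ := (isFrame_kerFrame i m n).exists_eq_sum j (polyRes (kerQ m) n l.op f)
    exact ⟨V, l, ⟨hx, hi⟩, _, (symCotangentHom_frameGen j q).trans hq.symm⟩

theorem isLocallyInjective_symCotangentHom (m : ℕ) (n : ℤ) :
    PresheafOfModules.IsLocallyInjective (Opens.grothendieckTopology (PN N))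
      (symCotangentHom N m n) :=
  isLocallyInjective_of_exists _ fun U a x hx ha => by
    obtain ⟨i, hi⟩ := exists_mem_basicOpenX x
    obtain ⟨V, l, j, q, hV, hq⟩ := exists_eq_sum_frameGen (i := i) a x hx hi
    refine ⟨V, l, hV, hq.trans ?_⟩
    have h1 : ∑ s, q s • polyRes (kerQ m) n j.op (kerFrame i m n s) = 0 := by
      refine (symCotangentHom_frameGen j q).symm.trans ((congrArg _ hq.symm).trans ?_)
      refine (PresheafOfModules.naturality_apply (symCotangentHom N m n) l.op a).trans ?_
      exact (congrArg _ ha).trans (map_zero (polyRes (kerQ m) n l.op))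
    have h2 := Fintype.linearIndependent_iff.1 ((isFrame_kerFrame i m n).linearIndependent j) q h1
    exact Finset.sum_eq_zero fun s _ => by rw [h2 s, zero_smul]

/-- The morphism `symCotangentHom` on the associated sheaf. -/
def symCotangentTwistHom (N m : ℕ) (n : ℤ) :
    symCotangentTwist N m (m + n) ⟶ polySheaf (kerQ m) n :=
  assocDesc (F := polySheaf (kerQ m) n) (symCotangentHom N m n)

theorem isIso_symCotangentTwistHom (m : ℕ) (n : ℤ) : IsIso (symCotangentTwistHom N m n) :=
  isIso_assocDesc (F := polySheaf (kerQ m) n) (symCotangentHom N m n)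
    (isLocallySurjective_symCotangentHom m n) (isLocallyInjective_symCotangentHom m n)

/-- The isomorphism of `S^m Ω (m + n)` with the sheaf of polynomials of degree `m` with coefficients
in `O(n)` which are annihilated by `∑ k, X k • ∂/∂Y k`. -/
def symCotangentIso (N m : ℕ) (n : ℤ) :
    symCotangentTwist N m (m + n) ≅ polySheaf (kerQ m) n :=
  haveI := isIso_symCotangentTwistHom (N := N) m n
  asIso (symCotangentTwistHom N m n)

/-- The isomorphism of `ℂ[Y]_m ⊗ O(n)` with the sheaf of homogeneous polynomials of degree `m` with
coefficients in `O(n)`. -/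
def polyTwistIso (N m : ℕ) (n : ℤ) : polyTwist N m n ≅ polySheaf (homogQ m) n :=
  haveI := isIso_polyTwistHom (N := N) m n
  asIso (polyTwistHom m n)

end Comparison

end
end GenEuler

theorem mainTheorem12 (N m : ℕ) (hN : 1 ≤ N) (hm : 1 ≤ m) (n : ℤ) :
    GenEuler.IsVectorBundle (GenEuler.symCotangentTwist N m (m + n)) ∧
    GenEuler.IsVectorBundle (GenEuler.polyTwist N m n) ∧
    GenEuler.IsVectorBundle (GenEuler.polyTwist N (m - 1) (n + 1)) ∧
    ∃ (ι : GenEuler.symCotangentTwist N m (m + n) ⟶ GenEuler.polyTwist N m n)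
      (w : ι ≫ GenEuler.delta N m n = 0),
      (CategoryTheory.ShortComplex.mk ι (GenEuler.delta N m n) w).ShortExact := by
  let eS := GenEuler.symCotangentIso N m n
  let eP := GenEuler.polyTwistIso N m n
  let eP' := GenEuler.polyTwistIso N (m - 1) (n + 1)
  have hδ : GenEuler.delta N m n ≫ eP'.hom = eP.hom ≫ GenEuler.polyDelta N m n :=
    GenEuler.delta_polyTwistHom m n
  have hδ' : eP.inv ≫ GenEuler.delta N m n = GenEuler.polyDelta N m n ≫ eP'.inv := by
    rw [Iso.inv_comp_eq, ← Category.assoc, ← hδ, Category.assoc, Iso.hom_inv_id, Category.comp_id]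
  have w : (eS.hom ≫ GenEuler.kerIncl N m n ≫ eP.inv) ≫ GenEuler.delta N m n = 0 := by
    rw [Category.assoc, Category.assoc, hδ', ← Category.assoc (GenEuler.kerIncl N m n),
      GenEuler.kerIncl_polyDelta, Limits.zero_comp, Limits.comp_zero]
  refine ⟨(GenEuler.isVectorBundle_kerQ m n).of_iso eS.symm,
    (GenEuler.isVectorBundle_homogQ m n).of_iso eP.symm,
    (GenEuler.isVectorBundle_homogQ (m - 1) (n + 1)).of_iso eP'.symm, _, w, ?_⟩
  exact ShortComplex.shortExact_of_iso (ShortComplex.isoMk eS.symm eP.symm eP'.symm (by simp)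
    hδ') (GenEuler.shortExact_kerIncl_polyDelta hm n)
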